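/- **Theorem.** Let $P=\{p_1,\dots,p_n\}$, $n\ge 2$, be points in the plane with measurements $m(p)$ and baseline values $b(p)$ in $[c_1,c_2]$, where $0<c_1\le c_2$ are constants. For a region $R$ put $m_R=\sum_{p\in R}m(p)/\sum_{p\in P}m(p)$ and $b_R=\sum_{p\in R}b(p)/\sum_{p\in P}b(p)$, and let $$d_K(R)=c\Big(m_R\ln\frac{m_R}{b_R}+(1-m_R)\ln\frac{1-m_R}{1-b_R}\Big)$$ be the Kulldorff (Poisson) scan statistic, $c>0$ a constant. Fix a constant $C>0$. A region has enough support if it contains at least constant measure in the sense that $(m_R,b_R)\in[C/n,1-C/n]^2$. The model of computation is a real RAM: unit-cost arithmetic ($+,-,\times,\div$), natural logarithm and comparison of real numbers, unit-cost addition, truncated subtraction, halving and comparison of natural numbers, conversion of natural numbers to reals, and indirect addressing. 1. There is an algorithm that, given the points with their measurements and baseline values, $C$, $c$ and $\epsilon>0$, computes an additive $\epsilon$-approximation to the maximum discrepancy over axis-parallel rectangles: whenever some axis-parallel rectangle has enough support, it returns such a rectangle $R$ together with the value $d_K(R)$, and $d_K(R')\le d_K(R)+\epsilon$ for every axis-parallel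 rectangle $R'$ with enough support. It runs in time $O(\frac1\epsilon n^2\log^2 n)$ for $\epsilon\le 1$, and in time $O(n^2\log^2 n)$ for $\epsilon>1$. 2. Suppose that each point also carries a timestamp $t(p)\in\mathbb{R}$, and consider prospective time windows, that is, the regions $R\times[\tau,\infty)$ with $R$ an axis-parallel rectangle and $\tau\in\mathbb{R}$, which contain the points $p\in R$ with $t(p)\ge\tau$. There is an algorithm that solves the corresponding maximization problem over all such regions with enough support in the same sense (returning $R$, $\tau$ and the discrepancy). It runs in time $O(\frac1\epsilon n^3\log^2 n)$ for $\epsilon\le 1$, and in time $O(n^3\log^2 n)$ for $\epsilon>1$. The constants in the $O(\cdot)$ depend only on $c_1,c_2,C,c$. -/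

import Mathlib

/-! ### A real RAM

Finitely many named arrays of natural numbers and of real numbers, with indirect addressing.
Every operation costs one unit of time. On naturals there are addition, truncated subtraction
and halving (no multiplication); on reals there are the four arithmetic operations, the
natural logarithm and comparison. A natural number can be converted to a real number; there is
no conversion (no floor) in the other direction, and a program contains no real constants. -/

namespace RealRAM

/-- Memory: `s.nat a i` and `s.real a i` are the cells with index `i` of the arrays number `a`. -/
structure State where
  nat : ℕ → ℕ → ℕ
  real : ℕ → ℕ → ℝ

/-- Expressions for natural numbers; `get a e` reads the cell `e` of array `a`. -/
inductive NExp where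
  | lit (k : ℕ)
  | get (a : ℕ) (e : NExp)
  | add (e f : NExp)
  | sub (e f : NExp)
  | half (e : NExp)

def NExp.eval (s : State) : NExp → ℕ
  | .lit k => k
  | .get a e => s.nat a (e.eval s)
  | .add e f => e.eval s + f.eval s
  | .sub e f => e.eval s - f.eval s
  | .half e => e.eval s / 2

/-- One unit for each node of the expression. -/
def NExp.cost : NExp → ℕ
  | .lit _ => 1
  | .get _ e => e.cost + 1
  | .add e f => e.cost + f.cost + 1
  | .sub e f => e.cost + f.cost + 1
  | .half e => e.cost + 1

/-- Expressions for real numbers. -/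
inductive RExp where
  | ofNat (e : NExp)
  | get (a : ℕ) (e : NExp)
  | add (e f : RExp)
  | sub (e f : RExp)
  | mul (e f : RExp)
  | div (e f : RExp)
  | log (e : RExp)

noncomputable def RExp.eval (s : State) : RExp → ℝ
  | .ofNat e => (e.eval s : ℝ)
  | .get a e => s.real a (e.eval s)
  | .add e f => e.eval s + f.eval s
  | .sub e f => e.eval s - f.eval s
  | .mul e f => e.eval s * f.eval s
  | .div e f => e.eval s / f.eval s
  | .log e => Real.log (e.eval s)

def RExp.cost : RExp → ℕ
  | .ofNat e => e.cost + 1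
  | .get _ e => e.cost + 1
  | .add e f => e.cost + f.cost + 1
  | .sub e f => e.cost + f.cost + 1
  | .mul e f => e.cost + f.cost + 1
  | .div e f => e.cost + f.cost + 1
  | .log e => e.cost + 1

/-- Tests. -/
inductive Test where
  | natLe (e f : NExp)
  | realLe (e f : RExp)
  | not (t : Test)
  | and (t u : Test)

def Test.Holds (s : State) : Test → Prop
  | .natLe e f => e.eval s ≤ f.eval s
  | .realLe e f => e.eval s ≤ f.eval s
  | .not t => ¬ t.Holds s
  | .and t u => t.Holds s ∧ u.Holds s

def Test.cost : Test → ℕ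
  | .natLe e f => e.cost + f.cost + 1
  | .realLe e f => e.cost + f.cost + 1
  | .not t => t.cost + 1
  | .and t u => t.cost + u.cost + 1

/-- Programs. `setNat a e v` stores `v` in the cell `e` of the array `a`. -/
inductive Prog where
  | skip
  | setNat (a : ℕ) (e v : NExp)
  | setReal (a : ℕ) (e : NExp) (v : RExp)
  | seq (p q : Prog)
  | ite (t : Test) (p q : Prog)
  | loop (t : Test) (p : Prog)

def State.setNat (s : State) (a i v : ℕ) : State :=
  { s with nat := Function.update s.nat a (Function.update (s.nat a) i v) }

def State.setReal (s : State) (a i : ℕ) (v : ℝ) : State :=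
  { s with real := Function.update s.real a (Function.update (s.real a) i v) }

/-- `Exec p s s' T`: started in the state `s`, the program `p` halts in the state `s'`
after exactly `T` units of time. -/
inductive Exec : Prog → State → State → ℕ → Prop
  | skip (s : State) : Exec .skip s s 1
  | setNat (s : State) (a : ℕ) (e v : NExp) :
      Exec (.setNat a e v) s (s.setNat a (e.eval s) (v.eval s)) (e.cost + v.cost + 1)
  | setReal (s : State) (a : ℕ) (e : NExp) (v : RExp) :
      Exec (.setReal a e v) s (s.setReal a (e.eval s) (v.eval s)) (e.cost + v.cost + 1)
  | seq {p q : Prog} {s s' s'' : State} {T U : ℕ} :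
      Exec p s s' T → Exec q s' s'' U → Exec (.seq p q) s s'' (T + U)
  | iteTrue {t : Test} {p q : Prog} {s s' : State} {T : ℕ} :
      t.Holds s → Exec p s s' T → Exec (.ite t p q) s s' (t.cost + 1 + T)
  | iteFalse {t : Test} {p q : Prog} {s s' : State} {T : ℕ} :
      ¬ t.Holds s → Exec q s s' T → Exec (.ite t p q) s s' (t.cost + 1 + T)
  | loopStop {t : Test} {p : Prog} {s : State} :
      ¬ t.Holds s → Exec (.loop t p) s s (t.cost + 1)
  | loopStep {t : Test} {p : Prog} {s s' s'' : State} {T U : ℕ} :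
      t.Holds s → Exec p s s' T → Exec (.loop t p) s' s'' U →
      Exec (.loop t p) s s'' (t.cost + 1 + T + U)

end RealRAM

/-! ### The Kulldorff scan statistic -/

namespace Scan

/-- The Kulldorff scan statistic with factor `c`, as a function of the measurement share `x`
and the baseline share `y`. -/
noncomputable def kulldorff (c x y : ℝ) : ℝ :=
  c * (x * Real.log (x / y) + (1 - x) * Real.log ((1 - x) / (1 - y)))

/-- A closed axis-parallel rectangle `[x₁, x₂] × [y₁, y₂]`. -/
structure Rect where
  x₁ : ℝ
  x₂ : ℝ
  y₁ : ℝ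
  y₂ : ℝ
  hx : x₁ ≤ x₂
  hy : y₁ ≤ y₂

def Rect.toSet (R : Rect) : Set (ℝ × ℝ) := Set.Icc R.x₁ R.x₂ ×ˢ Set.Icc R.y₁ R.y₂

/-- `n` points in the plane with measurements `m` and baseline values `b`. -/
structure Data (n : ℕ) where
  pt : Fin n → ℝ × ℝ
  m : Fin n → ℝ
  b : Fin n → ℝ

variable {n : ℕ}

/-- All measurements and baseline values lie in `[c₁, c₂]`. -/
def Data.Bounded (D : Data n) (c₁ c₂ : ℝ) : Prop :=
  ∀ i, D.m i ∈ Set.Icc c₁ c₂ ∧ D.b i ∈ Set.Icc c₁ c₂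

/-- The share of the total weight `w` that is carried by the points with index in `A`. -/
noncomputable def share (w : Fin n → ℝ) (A : Finset (Fin n)) : ℝ :=
  (∑ i ∈ A, w i) / ∑ i, w i

/-- The discrepancy `d_K` of a set of points, `A` being the points inside the region. -/
noncomputable def Data.disc (D : Data n) (c : ℝ) (A : Finset (Fin n)) : ℝ :=
  kulldorff c (share D.m A) (share D.b A)

/-- The minimum level of support: `(m_R, b_R)` lies in the square `[C/n, 1 - C/n]²`. -/
def Data.Supported (D : Data n) (C : ℝ) (A : Finset (Fin n)) : Prop :=
  share D.m A ∈ Set.Icc (C / n) (1 - C / n) ∧ share D.b A ∈ Set.Icc (C / n) (1 - C / n)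

open Classical in
/-- The points inside the rectangle `R`. -/
noncomputable def Data.inside (D : Data n) (R : Rect) : Finset (Fin n) :=
  Finset.univ.filter fun i => D.pt i ∈ R.toSet

open Classical in
/-- The points inside `R` whose timestamp is at least `τ`, that is, the points in the
space-time region `R × [τ, ∞)`. -/
noncomputable def Data.insideSince (D : Data n) (t : Fin n → ℝ) (R : Rect) (τ : ℝ) :
    Finset (Fin n) :=
  Finset.univ.filter fun i => D.pt i ∈ R.toSet ∧ τ ≤ t i

/-! ### Input and output of the programs -/

/-- The array that holds `v` in its first `n` cells, and zeros after them. -/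
def arrayOf (v : Fin n → ℝ) (i : ℕ) : ℝ := if h : i < n then v ⟨i, h⟩ else 0

/-- The initial memory. The natural number `n` stands in cell 0 of natural array 0. Real array 0
holds the scalars `ε, C, c`, and the real arrays 1 to 5 hold the abscissas, ordinates,
measurements, baseline values and timestamps of the points. All other cells are zero. -/
def input (D : Data n) (t : Fin n → ℝ) (ε C c : ℝ) : RealRAM.State where
  nat a i := if a = 0 ∧ i = 0 then n else 0
  real a i :=
    match a with
    | 0 => match i with
      | 0 => ε
      | 1 => C
      | 2 => c
      | _ => 0
    | 1 => arrayOf (fun j => (D.pt j).1) i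
    | 2 => arrayOf (fun j => (D.pt j).2) i
    | 3 => arrayOf D.m i
    | 4 => arrayOf D.b i
    | 5 => arrayOf t i
    | _ => 0

/-- The program returns a rectangle as the first four cells of real array 6. -/
def OutputsRect (s : RealRAM.State) (R : Rect) : Prop :=
  s.real 6 0 = R.x₁ ∧ s.real 6 1 = R.x₂ ∧ s.real 6 2 = R.y₁ ∧ s.real 6 3 = R.y₂

/-- The returned value. -/
def outputValue (s : RealRAM.State) : ℝ := s.real 6 4

/-- The returned beginning of the time window. -/
def outputTime (s : RealRAM.State) : ℝ := s.real 6 5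

/-- If some rectangle has enough support, then the final memory `s` holds such a rectangle and
its discrepancy, which is within `ε` of the maximum over all rectangles with enough support. -/
def ApproxMaxRect (D : Data n) (ε C c : ℝ) (s : RealRAM.State) : Prop :=
  (∃ R : Rect, D.Supported C (D.inside R)) →
    ∃ R : Rect, OutputsRect s R ∧ D.Supported C (D.inside R) ∧
      outputValue s = D.disc c (D.inside R) ∧
      ∀ R' : Rect, D.Supported C (D.inside R') → D.disc c (D.inside R') ≤ outputValue s + ε

/-- The same over all space-time regions `R × [τ, ∞)`. -/
def ApproxMaxProspective (D : Data n) (t : Fin n → ℝ) (ε C c : ℝ) (s : RealRAM.State) : Prop :=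
  (∃ (R : Rect) (τ : ℝ), D.Supported C (D.insideSince t R τ)) →
    ∃ R : Rect, OutputsRect s R ∧ D.Supported C (D.insideSince t R (outputTime s)) ∧
      outputValue s = D.disc c (D.insideSince t R (outputTime s)) ∧
      ∀ (R' : Rect) (τ' : ℝ), D.Supported C (D.insideSince t R' τ') →
        D.disc c (D.insideSince t R' τ') ≤ outputValue s + ε

end Scan

/-!
The Kulldorff statistic is convex (`kulldorff_ge`). All weights lie between the least and the
greatest weight `lo` and `hi`, whose ratio is bounded, so a nonempty region that does not contain
all points has shares of comparable size, inside as well as outside. Hence the gradient of the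
statistic is bounded there, and its direction is `±(1, -σ)` with `σ` in a bounded interval `[0, L]`
(`Comparable.exists_gradient`): to improve on a region it suffices to increase one of the linear
functionals `±(x - σ * y)` of the shares. There is a number `κ` that depends only on the constants
such that every region with at least `κ` points inside and `κ` points outside has enough support.

*One horizontal strip.* The points of a strip, sorted by abscissa, have prefix sums `M`, `B` of
shares, and rectangles correspond to pairs of cuts, positions that do not separate points with
equal abscissae. Pairs of positions less than `4 * κ` apart are tried exhaustively (`brute_spec`),
in strips that leave out fewer than `κ` points all pairs are. Distant pairs are treated by dyadic
divide and conquer: a table holds, for each dyadic block of positions and each of finitely many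
directions, a cut of the block at which `±(M p - σ * B p)` is almost maximal. The longer the
blocks, the finer the directions, in such a way that each level has the same number of entries,
`F₀ * 2 ^ lev` for levels `0, …, lev`, and contributes the same error (`tab_spec`). Two distant
positions lie, at a suitable level, in blocks two or three apart (`exists_level`), and the table
entries of these blocks form a pair almost as good (`exists_tab_pair`) which has enough support
because of the distance of the blocks. It suffices that `F₀ * n` is about `log n / ε`, so that a
strip takes time `O(n log n + log² n / ε)`.

*The choice of strips.* Strips are bounded by ordinates from a grid: every `s`-th ordinate, where
`s` is proportional to `ε * n`, and the first and last `κ` ones. Rounding a rectangle to the grid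
loses few points and so little of the statistic (`Data.Within.disc_le_of_subset`). If it destroys
the support, the rectangle has a small statistic, and any rectangle with enough support will do;
one on the grid exists (`exists_supported_grid_box`). As the number of grid ordinates is `O(1 / ε)`
and also `O(n)`, the number of strips is both `O(n / ε)` and `O(n ^ 2)`; the first bound, for the
term `n log n`, and the second, for `log² n / ε`, give the running time
(`Setting.Moderate.searchCost_le`). For time windows the search is repeated with each timestamp of
a point as the beginning of the window, which costs a factor `n`.

*The program.* The specification of each part of the program bounds its time and says which
arrays it leaves alone (`Runs`, `Keeps`). Throughout, the best region found so far is correct and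
never gets worse (`Setting.Sound`, `Setting.Improves`). Each candidate is checked before it is
recorded, so candidates that come from meaningless table entries do no harm. The machine cannot
round real numbers; `κ`, `F₀` and `s` are found by linear search.
-/

/-! ### Reasoning about programs -/

namespace RealRAM

/-- Started in `s`, the program `p` halts within `T` units of time in a state satisfying `Q`. -/
def Runs (p : Prog) (s : State) (T : ℕ) (Q : State → Prop) : Prop :=
  ∃ s' T', Exec p s s' T' ∧ T' ≤ T ∧ Q s'

/-- Whether `p` contains an assignment to the natural array `a`. -/
def Prog.writesNat : Prog → ℕ → Bool
  | .skip, _ => false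
  | .setNat b _ _, a => Nat.beq a b
  | .setReal _ _ _, _ => false
  | .seq p q, a => p.writesNat a || q.writesNat a
  | .ite _ p q, a => p.writesNat a || q.writesNat a
  | .loop _ p, a => p.writesNat a

/-- Whether `p` contains an assignment to the real array `a`. -/
def Prog.writesReal : Prog → ℕ → Bool
  | .skip, _ => false
  | .setNat _ _ _, _ => false
  | .setReal b _ _, a => Nat.beq a b
  | .seq p q, a => p.writesReal a || q.writesReal a
  | .ite _ p q, a => p.writesReal a || q.writesReal a
  | .loop _ p, a => p.writesReal a

/-- The frame condition: `s'` agrees with `s` on every array to which `p` does not assign. -/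
structure Keeps (p : Prog) (s s' : State) : Prop where
  nat : ∀ a, p.writesNat a = false → s'.nat a = s.nat a
  real : ∀ a, p.writesReal a = false → s'.real a = s.real a

theorem Keeps.refl (p : Prog) (s : State) : Keeps p s s := ⟨fun _ _ => rfl, fun _ _ => rfl⟩

theorem Keeps.trans {p : Prog} {s s' s'' : State} (h : Keeps p s s') (h' : Keeps p s' s'') :
    Keeps p s s'' :=
  ⟨fun a ha => (h'.nat a ha).trans (h.nat a ha), fun a ha => (h'.real a ha).trans (h.real a ha)⟩

@[simp] theorem State.setNat_nat_self (s : State) (a i v j : ℕ) :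
    (s.setNat a i v).nat a j = if j = i then v else s.nat a j := by
  simp [State.setNat, Function.update_apply]

@[simp] theorem State.setNat_nat_of_ne (s : State) {a b : ℕ} (i v : ℕ) (h : b ≠ a) :
    (s.setNat a i v).nat b = s.nat b := by
  simp [State.setNat, Function.update_of_ne h]

@[simp] theorem State.setNat_real (s : State) (a i v : ℕ) : (s.setNat a i v).real = s.real := rfl

@[simp] theorem State.setReal_real_self (s : State) (a i : ℕ) (v : ℝ) (j : ℕ) :
    (s.setReal a i v).real a j = if j = i then v else s.real a j := by
  simp [State.setReal, Function.update_apply]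

@[simp] theorem State.setReal_real_of_ne (s : State) {a b : ℕ} (i : ℕ) (v : ℝ) (h : b ≠ a) :
    (s.setReal a i v).real b = s.real b := by
  simp [State.setReal, Function.update_of_ne h]

@[simp] theorem State.setReal_nat (s : State) (a i : ℕ) (v : ℝ) :
    (s.setReal a i v).nat = s.nat := rfl

theorem Exec.keeps {p : Prog} {s s' : State} {T : ℕ} (h : Exec p s s' T) : Keeps p s s' := by
  induction h with
  | skip s => exact Keeps.refl _ _
  | setNat s a e v =>
    refine ⟨fun b hb => State.setNat_nat_of_ne _ _ _ ?_, fun _ _ => rfl⟩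
    exact Nat.ne_of_beq_eq_false hb
  | setReal s a e v =>
    refine ⟨fun _ _ => rfl, fun b hb => State.setReal_real_of_ne _ _ _ ?_⟩
    exact Nat.ne_of_beq_eq_false hb
  | seq _ _ ih₁ ih₂ =>
    refine ⟨fun a ha => ?_, fun a ha => ?_⟩
    · simp only [Prog.writesNat, Bool.or_eq_false_iff] at ha
      exact (ih₂.nat a ha.2).trans (ih₁.nat a ha.1)
    · simp only [Prog.writesReal, Bool.or_eq_false_iff] at ha
      exact (ih₂.real a ha.2).trans (ih₁.real a ha.1)
  | iteTrue _ _ ih =>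
    refine ⟨fun a ha => ?_, fun a ha => ?_⟩
    · simp only [Prog.writesNat, Bool.or_eq_false_iff] at ha
      exact ih.nat a ha.1
    · simp only [Prog.writesReal, Bool.or_eq_false_iff] at ha
      exact ih.real a ha.1
  | iteFalse _ _ ih =>
    refine ⟨fun a ha => ?_, fun a ha => ?_⟩
    · simp only [Prog.writesNat, Bool.or_eq_false_iff] at ha
      exact ih.nat a ha.2
    · simp only [Prog.writesReal, Bool.or_eq_false_iff] at ha
      exact ih.real a ha.2
  | loopStop _ => exact Keeps.refl _ _
  | loopStep _ _ _ ih₁ ih₂ =>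
    exact ⟨fun a ha => (ih₂.nat a ha).trans (ih₁.nat a ha),
      fun a ha => (ih₂.real a ha).trans (ih₁.real a ha)⟩

/-- The final state of a terminating program. -/
theorem Runs.exists_final {p : Prog} {s : State} {T : ℕ} {Q : State → Prop}
    (h : Runs p s T Q) : ∃ s', Q s' ∧ Keeps p s s' ∧ Runs p s T fun s'' => s'' = s' := by
  obtain ⟨s', T', h, hT, hQ⟩ := h
  exact ⟨s', hQ, h.keeps, s', T', h, hT, rfl⟩

theorem Runs.mono {p : Prog} {s : State} {T T' : ℕ} {Q Q' : State → Prop} (h : Runs p s T Q)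
    (hT : T ≤ T') (hQ : ∀ s', Keeps p s s' → Q s' → Q' s') : Runs p s T' Q' := by
  obtain ⟨s', U, h, hU, hs⟩ := h
  exact ⟨s', U, h, hU.trans hT, hQ _ h.keeps hs⟩

theorem Runs.seq {p q : Prog} {s : State} {T U : ℕ} {Q R : State → Prop} (hp : Runs p s T Q)
    (hq : ∀ s', Keeps p s s' → Q s' → Runs q s' U R) : Runs (.seq p q) s (T + U) R := by
  obtain ⟨s', T', h, hT, hs⟩ := hp
  obtain ⟨s'', U', h', hU, hs'⟩ := hq s' h.keeps hs
  exact ⟨s'', T' + U', .seq h h', by omega, hs'⟩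

/-- The rule for loops: `m` rounds, each of which takes at most `b` units of time and leads from
the invariant `I i` to the invariant `I (i + 1)`. -/
theorem Runs.loop {t : Test} {p : Prog} {m b : ℕ} (I : ℕ → State → Prop) {s : State}
    (h0 : I 0 s)
    (hstep : ∀ i < m, ∀ s', Keeps p s s' → I i s' → t.Holds s' ∧ Runs p s' b (I (i + 1)))
    (hend : ∀ s', Keeps p s s' → I m s' → ¬ t.Holds s') :
    Runs (.loop t p) s (m * (b + t.cost + 1) + (t.cost + 1)) (I m) := by
  have key : ∀ d i, i + d = m → ∀ s', Keeps p s s' → I i s' →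
      Runs (.loop t p) s' (d * (b + t.cost + 1) + (t.cost + 1)) (I m) := by
    intro d
    induction d with
    | zero =>
      intro i hi s' hk hI
      obtain rfl : i = m := by omega
      exact ⟨s', _, .loopStop (hend s' hk hI), by omega, hI⟩
    | succ d ih =>
      intro i hi s' hk hI
      obtain ⟨ht, s₁, T₁, h₁, hT₁, hI₁⟩ := hstep i (by omega) s' hk hI
      obtain ⟨s₂, T₂, h₂, hT₂, hI₂⟩ := ih (i + 1) (by omega) s₁ (hk.trans h₁.keeps) hI₁
      refine ⟨s₂, _, .loopStep ht h₁ h₂, ?_, hI₂⟩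
      rw [Nat.succ_mul]
      omega
  exact key m 0 (by omega) s (Keeps.refl _ _) h0

/-- Programs without loops. -/
def Prog.loopFree : Prog → Bool
  | .skip => true
  | .setNat _ _ _ => true
  | .setReal _ _ _ => true
  | .seq p q => p.loopFree && q.loopFree
  | .ite _ p q => p.loopFree && q.loopFree
  | .loop _ _ => false

open Classical in
/-- The final state of a program without loops. -/
noncomputable def Prog.run : Prog → State → State
  | .skip, s => s
  | .setNat a e v, s => s.setNat a (e.eval s) (v.eval s)
  | .setReal a e v, s => s.setReal a (e.eval s) (v.eval s)
  | .seq p q, s => q.run (p.run s)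
  | .ite t p q, s => if t.Holds s then p.run s else q.run s
  | .loop _ _, s => s

/-- The time taken by a program without loops, at most. -/
def Prog.time : Prog → ℕ
  | .skip => 1
  | .setNat _ e v => e.cost + v.cost + 1
  | .setReal _ e v => e.cost + v.cost + 1
  | .seq p q => p.time + q.time
  | .ite t p q => t.cost + 1 + max p.time q.time
  | .loop _ _ => 0

theorem Runs.of_loopFree {p : Prog} (h : p.loopFree = true) (s : State) :
    Runs p s p.time fun s' => s' = p.run s := by
  induction p generalizing s with
  | skip => exact ⟨_, _, .skip s, le_rfl, rfl⟩
  | setNat a e v => exact ⟨_, _, .setNat s a e v, le_rfl, rfl⟩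
  | setReal a e v => exact ⟨_, _, .setReal s a e v, le_rfl, rfl⟩
  | seq p q ihp ihq =>
    simp only [Prog.loopFree, Bool.and_eq_true] at h
    refine (ihp h.1 s).seq fun s' _ hs => ?_
    subst hs
    exact ihq h.2 _
  | ite t p q ihp ihq =>
    simp only [Prog.loopFree, Bool.and_eq_true] at h
    by_cases ht : t.Holds s
    · obtain ⟨s', T, hE, hT, hs⟩ := ihp h.1 s
      refine ⟨s', _, .iteTrue ht hE, ?_, ?_⟩
      · simp only [Prog.time]; omega
      · simpa [Prog.run, ht] using hs
    · obtain ⟨s', T, hE, hT, hs⟩ := ihq h.2 s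
      refine ⟨s', _, .iteFalse ht hE, ?_, ?_⟩
      · simp only [Prog.time]; omega
      · simpa [Prog.run, ht] using hs
  | loop t p => simp [Prog.loopFree] at h

theorem Runs.of_run {p : Prog} (h : p.loopFree = true) {s : State} {Q : State → Prop}
    (hQ : Q (p.run s)) : Runs p s p.time Q :=
  (Runs.of_loopFree h s).mono le_rfl fun _ _ hs => hs ▸ hQ

/-- The value of the scalar variable that stands in cell 0 of the natural array `a`. -/
abbrev nv (a : ℕ) : NExp := .get a (.lit 0)

/-- The value of the scalar variable that stands in cell 0 of the real array `a`. -/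
abbrev rv (a : ℕ) : RExp := .get a (.lit 0)

/-- Assignment to the scalar variable in the natural array `a`. -/
abbrev setN (a : ℕ) (e : NExp) : Prog := .setNat a (.lit 0) e

/-- Assignment to the scalar variable in the real array `a`. -/
abbrev setR (a : ℕ) (e : RExp) : Prog := .setReal a (.lit 0) e

/-- `a := a + 1`. -/
abbrev incr (a : ℕ) : Prog := setN a (.add (nv a) (.lit 1))

/-- The test `e < f`. -/
abbrev natLt (e f : NExp) : Test := .natLe (.add e (.lit 1)) f

infixr:60 " ;; " => Prog.seq

/-- Linear search: the loop that increments `a` stops at the first value satisfying `P`. -/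
theorem Runs.linearSearch {t : Test} {a : ℕ} {P : ℕ → Prop} {s : State}
    (ht : ∀ v, t.Holds (s.setNat a 0 v) ↔ ¬ P v) (hP : ∃ v, s.nat a 0 ≤ v ∧ P v) :
    ∃ v, s.nat a 0 ≤ v ∧ P v ∧ (∀ u, s.nat a 0 ≤ u → u < v → ¬ P u) ∧
      Runs (.loop t (incr a)) s ((v - s.nat a 0) * (t.cost + 7) + (t.cost + 1))
        fun s' => s' = s.setNat a 0 v := by
  classical
  have hself : s.setNat a 0 (s.nat a 0) = s := by simp [State.setNat]
  have hset : ∀ u v, (s.setNat a 0 u).setNat a 0 v = s.setNat a 0 v := by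
    intro u v; simp [State.setNat]
  refine ⟨Nat.find hP, (Nat.find_spec hP).1, (Nat.find_spec hP).2,
    fun u hu hlt hPu => Nat.find_min hP hlt ⟨hu, hPu⟩, ?_⟩
  have hle := (Nat.find_spec hP).1
  have := Runs.loop (t := t) (p := incr a) (m := Nat.find hP - s.nat a 0) (b := 6) (s := s)
    (fun i s' => s' = s.setNat a 0 (s.nat a 0 + i)) (by simp [hself])
    (fun i hi s' _ hs => by
      subst hs
      refine ⟨(ht _).2 fun hPi => Nat.find_min hP (m := s.nat a 0 + i) (by omega)
        ⟨by omega, hPi⟩, ?_⟩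
      refine (Runs.of_loopFree rfl _).mono (by simp [Prog.time, NExp.cost]) fun s'' _ h => ?_
      subst h
      simp [Prog.run, NExp.eval, hset, add_assoc])
    (fun s' _ hs => by
      subst hs
      rw [ht, not_not, Nat.add_sub_cancel' hle]
      exact (Nat.find_spec hP).2)
  refine this.mono (le_of_eq (by ring)) fun s' _ hs => ?_
  rw [hs, Nat.add_sub_cancel' hle]

end RealRAM

/-! ### The Kulldorff statistic is convex, with bounded gradient at bounded ratios -/

namespace Scan

theorem mul_log_div_ge {x' y' a : ℝ} (ha : 0 < a) (hx : 0 ≤ x') (hy : 0 ≤ y')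
    (h : 0 < x' → 0 < y') : x' * Real.log a + x' - a * y' ≤ x' * Real.log (x' / y') := by
  rcases hx.eq_or_lt with rfl | hx
  · simp; positivity
  · have hy := h hx
    have h1 : Real.log (a * y' / x') ≤ a * y' / x' - 1 := Real.log_le_sub_one_of_pos (by positivity)
    have h2 : Real.log (a * y' / x') = Real.log a - Real.log (x' / y') := by
      rw [Real.log_div (by positivity) (by positivity), Real.log_mul (by positivity) (by positivity),
        Real.log_div (by positivity) (by positivity)]
      ring
    rw [h2] at h1
    have h3 := mul_le_mul_of_nonneg_left h1 hx.le
    have h4 : x' * (a * y' / x' - 1) = a * y' - x' := by field_simp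
    rw [h4] at h3
    linarith

/-- A pair of shares `(x, y)` that can occur for a set of points: if one of the two is trivial,
so is the other. -/
structure Admissible (x y : ℝ) : Prop where
  x0 : 0 ≤ x
  x1 : x ≤ 1
  y0 : 0 ≤ y
  y1 : y ≤ 1
  pos : 0 < x → 0 < y
  lt : x < 1 → y < 1

/-- The tangent planes of the linear functions with the density ratios `a` inside and `b` outside
lie below the graph of the statistic. -/
theorem kulldorff_ge {c x' y' a b : ℝ} (hc : 0 ≤ c) (ha : 0 < a) (hb : 0 < b)
    (h : Admissible x' y') :
    c * (x' * Real.log a + (1 - x') * Real.log b + 1 - a * y' - b * (1 - y')) ≤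
      kulldorff c x' y' := by
  have h1 := mul_log_div_ge ha h.x0 h.y0 h.pos
  have h2 := mul_log_div_ge hb (sub_nonneg.2 h.x1) (sub_nonneg.2 h.y1)
    (fun hh => sub_pos.2 (h.lt (sub_pos.1 hh)))
  unfold kulldorff
  exact mul_le_mul_of_nonneg_left (by linarith) hc

theorem kulldorff_nonneg {c x y : ℝ} (hc : 0 ≤ c) (h : Admissible x y) : 0 ≤ kulldorff c x y := by
  have := kulldorff_ge hc one_pos one_pos h
  simpa using this

/-- The logarithmic mean of `a` and `b` lies between them; only the bounds `0` and `L` are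
needed. -/
theorem exists_slope {a b L : ℝ} (ha : 0 < a) (hb : 0 < b) (haL : a ≤ L) (hbL : b ≤ L) :
    ∃ σ : ℝ, 0 ≤ σ ∧ σ ≤ L ∧ a - b = (Real.log a - Real.log b) * σ := by
  wlog hab : b ≤ a generalizing a b
  · obtain ⟨σ, h0, h1, h2⟩ := this hb ha hbL haL (le_of_not_ge hab)
    exact ⟨σ, h0, h1, by linarith⟩
  rcases hab.eq_or_lt with rfl | hab
  · exact ⟨0, le_rfl, by linarith, by simp⟩
  have hlog : 0 < Real.log a - Real.log b := sub_pos.2 (Real.log_lt_log hb hab)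
  have h1 : Real.log (b / a) ≤ b / a - 1 := Real.log_le_sub_one_of_pos (by positivity)
  rw [Real.log_div hb.ne' ha.ne'] at h1
  have h2 : a - b ≤ a * (Real.log a - Real.log b) := by
    have := mul_le_mul_of_nonneg_left h1 ha.le
    have h3 : a * (b / a - 1) = b - a := by field_simp
    rw [h3] at this
    linarith
  refine ⟨(a - b) / (Real.log a - Real.log b), by have := sub_pos.2 hab; positivity, ?_, ?_⟩
  · rw [div_le_iff₀ hlog]
    exact h2.trans (by gcongr)
  · field_simp

/-- The shares `x` and `y`, and the complementary shares, have ratios at most `L`. -/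
structure Comparable (L x y : ℝ) : Prop where
  x0 : 0 < x
  x1 : x < 1
  y0 : 0 < y
  y1 : y < 1
  xy : x ≤ L * y
  yx : y ≤ L * x
  xy' : 1 - x ≤ L * (1 - y)
  yx' : 1 - y ≤ L * (1 - x)

/-- Where the ratios are bounded, the gradient is bounded, and its direction is `±(1, -σ)` for a
number `σ` in a bounded interval. So one real parameter describes all linear functionals that
have to be maximized. -/
theorem Comparable.exists_gradient {c L x y : ℝ} (hc : 0 ≤ c) (h : Comparable L x y) :
    ∃ g σ : ℝ, |g| ≤ 2 * L ∧ 0 ≤ σ ∧ σ ≤ L ∧ ∀ x' y', Admissible x' y' →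
      kulldorff c x y + c * (g * ((x' - x) - σ * (y' - y))) ≤ kulldorff c x' y' := by
  have hx1 := sub_pos.2 h.x1
  have hy1 := sub_pos.2 h.y1
  have hx0 := h.x0
  have hy0 := h.y0
  have ha : 0 < x / y := by positivity
  have hb : 0 < (1 - x) / (1 - y) := by positivity
  have haL : x / y ≤ L := (div_le_iff₀ hy0).2 h.xy
  have hbL : (1 - x) / (1 - y) ≤ L := (div_le_iff₀ hy1).2 h.xy'
  have haL' : (x / y)⁻¹ ≤ L := by rw [inv_div]; exact (div_le_iff₀ hx0).2 h.yx
  have hbL' : ((1 - x) / (1 - y))⁻¹ ≤ L := by rw [inv_div]; exact (div_le_iff₀ hx1).2 h.yx'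
  have hlog : ∀ {a : ℝ}, 0 < a → a ≤ L → a⁻¹ ≤ L → |Real.log a| ≤ L := by
    intro a ha h1 h2
    rw [abs_le]
    have h3 := Real.log_le_sub_one_of_pos ha
    have h4 := Real.log_le_sub_one_of_pos (inv_pos.2 ha)
    rw [Real.log_inv] at h4
    constructor <;> linarith
  obtain ⟨σ, hσ0, hσL, hσ⟩ := exists_slope ha hb haL hbL
  refine ⟨Real.log (x / y) - Real.log ((1 - x) / (1 - y)), σ, ?_, hσ0, hσL, ?_⟩
  · have h1 := hlog ha haL haL'
    have h2 := hlog hb hbL hbL'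
    calc |Real.log (x / y) - Real.log ((1 - x) / (1 - y))|
        ≤ |Real.log (x / y)| + |Real.log ((1 - x) / (1 - y))| := abs_sub _ _
      _ ≤ 2 * L := by linarith
  · intro x' y' h'
    refine le_trans (le_of_eq ?_) (kulldorff_ge hc ha hb h')
    have e1 : x / y * y = x := by field_simp
    have e2 : (1 - x) / (1 - y) * (1 - y) = 1 - x := by field_simp
    unfold kulldorff
    set la := Real.log (x / y)
    set lb := Real.log ((1 - x) / (1 - y))
    set a := x / y
    set b := (1 - x) / (1 - y)
    rw [mul_sub (la - lb), ← mul_assoc (la - lb), ← hσ]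
    linear_combination c * e1 + c * e2

/-- Lipschitz continuity, in one direction. -/
theorem Comparable.kulldorff_le {c L x y δ x' y' : ℝ} (hc : 0 ≤ c) (h : Comparable L x y)
    (hL : 1 ≤ L) (h' : Admissible x' y') (hx : |x' - x| ≤ δ) (hy : |y' - y| ≤ δ) :
    kulldorff c x y ≤ kulldorff c x' y' + 4 * c * L ^ 2 * δ := by
  obtain ⟨g, σ, hg, hσ0, hσ1, H⟩ := h.exists_gradient hc
  have h1 := H x' y' h'
  have h2 : |g * ((x' - x) - σ * (y' - y))| ≤ (2 * L) * (2 * L * δ) := by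
    rw [abs_mul]
    refine mul_le_mul hg ?_ (abs_nonneg _) (by linarith)
    have h3 : |σ * (y' - y)| ≤ L * δ := by
      rw [abs_mul, abs_of_nonneg hσ0]
      exact mul_le_mul hσ1 hy (abs_nonneg _) (by linarith)
    have h4 : δ ≤ L * δ := le_mul_of_one_le_left ((abs_nonneg _).trans hx) hL
    calc |x' - x - σ * (y' - y)| ≤ |x' - x| + |σ * (y' - y)| := abs_sub _ _
      _ ≤ 2 * L * δ := by linarith
  have h5 := mul_le_mul_of_nonneg_left (neg_le_of_abs_le h2) hc
  linarith

/-! ### Shares of sets of points -/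

variable {n : ℕ}

theorem share_ge {w : Fin n → ℝ} {lo hi : ℝ} (hlo : 0 < lo) (hw : ∀ i, lo ≤ w i ∧ w i ≤ hi)
    (A : Finset (Fin n)) : (A.card : ℝ) / (hi / lo * n) ≤ share w A := by
  rcases Nat.eq_zero_or_pos n with rfl | hn
  · have : A = ∅ := by ext i; exact i.elim0
    subst this; simp [share]
  have hhi : 0 < hi := hlo.trans_le ((hw ⟨0, hn⟩).1.trans (hw ⟨0, hn⟩).2)
  have hn' : (0 : ℝ) < n := by exact_mod_cast hn
  have h1 : (A.card : ℝ) * lo ≤ ∑ i ∈ A, w i := by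
    simpa using Finset.card_nsmul_le_sum A w lo fun i _ => (hw i).1
  have h2 : ∑ i, w i ≤ n * hi := by
    simpa using Finset.sum_le_card_nsmul Finset.univ w hi fun i _ => (hw i).2
  have h3 : (n : ℝ) * lo ≤ ∑ i, w i := by
    simpa using Finset.card_nsmul_le_sum Finset.univ w lo fun i _ => (hw i).1
  have h4 : 0 < ∑ i, w i := lt_of_lt_of_le (by positivity) h3
  unfold share
  rw [div_le_div_iff₀ (by positivity) h4]
  calc (A.card : ℝ) * ∑ i, w i ≤ A.card * (n * hi) := by gcongr
    _ = A.card * lo * (hi / lo * n) := by field_simp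
    _ ≤ _ := by gcongr

theorem share_le {w : Fin n → ℝ} {lo hi : ℝ} (hlo : 0 < lo) (hw : ∀ i, lo ≤ w i ∧ w i ≤ hi)
    (A : Finset (Fin n)) : share w A ≤ hi / lo * A.card / n := by
  rcases Nat.eq_zero_or_pos n with rfl | hn
  · have : A = ∅ := by ext i; exact i.elim0
    subst this; simp [share]
  have hhi : 0 < hi := hlo.trans_le ((hw ⟨0, hn⟩).1.trans (hw ⟨0, hn⟩).2)
  have hn' : (0 : ℝ) < n := by exact_mod_cast hn
  have h1 : ∑ i ∈ A, w i ≤ A.card * hi := by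
    simpa using Finset.sum_le_card_nsmul A w hi fun i _ => (hw i).2
  have h3 : (n : ℝ) * lo ≤ ∑ i, w i := by
    simpa using Finset.card_nsmul_le_sum Finset.univ w lo fun i _ => (hw i).1
  have h4 : 0 < ∑ i, w i := lt_of_lt_of_le (by positivity) h3
  unfold share
  rw [div_le_div_iff₀ h4 hn']
  calc (∑ i ∈ A, w i) * n ≤ A.card * hi * n := by gcongr
    _ = hi / lo * A.card * (n * lo) := by field_simp
    _ ≤ _ := by gcongr

theorem share_sdiff {w : Fin n → ℝ} {A B : Finset (Fin n)} (h : A ⊆ B) :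
    share w (B \ A) = share w B - share w A := by
  unfold share
  rw [← sub_div, ← Finset.sum_sdiff h]
  ring

theorem one_sub_share {w : Fin n → ℝ} (h : ∑ i, w i ≠ 0) (A : Finset (Fin n)) :
    1 - share w A = share w Aᶜ := by
  rw [Finset.compl_eq_univ_sdiff, share_sdiff (Finset.subset_univ A)]
  simp [share, div_self h]

theorem share_mono {w : Fin n → ℝ} (h : ∀ i, 0 ≤ w i) {A B : Finset (Fin n)} (hAB : A ⊆ B) :
    share w A ≤ share w B := by
  unfold share
  have : 0 ≤ ∑ i, w i := Finset.sum_nonneg fun i _ => h i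
  gcongr
  exact fun i _ _ => h i

/-- All measurements and baseline values lie in `[lo, hi]`; in contrast to `Data.Bounded`, it
serves for bounds that the program computes. -/
structure Data.Within (D : Data n) (lo hi : ℝ) : Prop where
  pos : 0 < lo
  m : ∀ i, lo ≤ D.m i ∧ D.m i ≤ hi
  b : ∀ i, lo ≤ D.b i ∧ D.b i ≤ hi

variable {D : Data n} {lo hi : ℝ}

theorem Data.Within.one_le_ratio (h : D.Within lo hi) (hn : 0 < n) : 1 ≤ hi / lo := by
  rw [one_le_div h.pos]
  exact (h.m ⟨0, hn⟩).1.trans (h.m ⟨0, hn⟩).2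

theorem Data.Within.sum_m_pos (h : D.Within lo hi) (hn : 0 < n) : 0 < ∑ i, D.m i :=
  Finset.sum_pos (fun i _ => h.pos.trans_le (h.m i).1) ⟨⟨0, hn⟩, Finset.mem_univ _⟩

theorem Data.Within.sum_b_pos (h : D.Within lo hi) (hn : 0 < n) : 0 < ∑ i, D.b i :=
  Finset.sum_pos (fun i _ => h.pos.trans_le (h.b i).1) ⟨⟨0, hn⟩, Finset.mem_univ _⟩

/-- The two shares of a set differ by a bounded factor only. -/
theorem Data.Within.share_le_mul (h : D.Within lo hi) (hn : 0 < n) (A : Finset (Fin n)) :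
    share D.m A ≤ (hi / lo) ^ 2 * share D.b A ∧ share D.b A ≤ (hi / lo) ^ 2 * share D.m A := by
  have hρ : 0 < hi / lo := one_pos.trans_le (h.one_le_ratio hn)
  have hn' : (0 : ℝ) < n := by exact_mod_cast hn
  have key : hi / lo * A.card / n = (hi / lo) ^ 2 * (A.card / (hi / lo * n)) := by
    field_simp
  constructor
  · refine (share_le h.pos h.m A).trans ?_
    rw [key]
    gcongr
    exact share_ge h.pos h.b A
  · refine (share_le h.pos h.b A).trans ?_
    rw [key]
    gcongr
    exact share_ge h.pos h.m A

theorem share_pos_iff {w : Fin n → ℝ} (h : ∀ i, 0 < w i) (A : Finset (Fin n)) :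
    0 < share w A ↔ A.Nonempty := by
  constructor
  · intro hA
    by_contra hne
    rw [Finset.not_nonempty_iff_eq_empty] at hne
    simp [hne, share] at hA
  · intro hA
    obtain ⟨i, hi⟩ := hA
    have h1 : 0 < ∑ i, w i := Finset.sum_pos (fun i _ => h i) ⟨i, Finset.mem_univ _⟩
    have h2 : 0 < ∑ i ∈ A, w i := Finset.sum_pos (fun i _ => h i) ⟨i, hi⟩
    exact div_pos h2 h1

theorem Data.Within.admissible (h : D.Within lo hi) (hn : 0 < n) (A : Finset (Fin n)) :
    Admissible (share D.m A) (share D.b A) := by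
  have hm : ∀ i, 0 < D.m i := fun i => h.pos.trans_le (h.m i).1
  have hb : ∀ i, 0 < D.b i := fun i => h.pos.trans_le (h.b i).1
  have e1 := one_sub_share (h.sum_m_pos hn).ne' A
  have e2 := one_sub_share (h.sum_b_pos hn).ne' A
  have p1 : ∀ B, 0 ≤ share D.m B := fun B => by
    have := share_mono (fun i => (hm i).le) (Finset.empty_subset B)
    simpa [share] using this
  have p2 : ∀ B, 0 ≤ share D.b B := fun B => by
    have := share_mono (fun i => (hb i).le) (Finset.empty_subset B)
    simpa [share] using this
  refine ⟨p1 A, by linarith [p1 Aᶜ], p2 A, by linarith [p2 Aᶜ], ?_, ?_⟩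
  · rw [share_pos_iff hm, share_pos_iff hb]; exact id
  · intro hlt
    have : 0 < share D.m Aᶜ := by linarith
    rw [share_pos_iff hm, ← share_pos_iff hb] at this
    linarith

theorem Data.Within.comparable (h : D.Within lo hi) (hn : 0 < n) {A : Finset (Fin n)} {C : ℝ}
    (hC : 0 < C) (hA : D.Supported C A) :
    Comparable ((hi / lo) ^ 2) (share D.m A) (share D.b A) := by
  have hn' : (0 : ℝ) < n := by exact_mod_cast hn
  have hCn : 0 < C / n := by positivity
  obtain ⟨⟨h1, h2⟩, h3, h4⟩ := hA
  have e1 := one_sub_share (h.sum_m_pos hn).ne' A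
  have e2 := one_sub_share (h.sum_b_pos hn).ne' A
  have h5 := h.share_le_mul hn A
  have h6 := h.share_le_mul hn Aᶜ
  refine ⟨by linarith, by linarith, by linarith, by linarith, h5.1, h5.2, ?_, ?_⟩
  · rw [e1, e2]; exact h6.1
  · rw [e1, e2]; exact h6.2

/-- Removing few points from a supported set changes the discrepancy by little. -/
theorem Data.Within.disc_le_of_subset (h : D.Within lo hi) (hn : 0 < n) {C c : ℝ} (hC : 0 < C)
    (hc : 0 ≤ c) {A B : Finset (Fin n)} (hA : D.Supported C A) (hBA : B ⊆ A) {d : ℕ}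
    (hd : A.card ≤ B.card + d) :
    D.disc c A ≤ D.disc c B + 4 * c * ((hi / lo) ^ 2) ^ 3 * d / n := by
  have hn' : (0 : ℝ) < n := by exact_mod_cast hn
  have hρ := h.one_le_ratio hn
  have hcard : (A \ B).card ≤ d := by rw [Finset.card_sdiff_of_subset hBA]; omega
  have hcard' : ((A \ B).card : ℝ) ≤ d := by exact_mod_cast hcard
  have key : ∀ {w : Fin n → ℝ}, (∀ i, lo ≤ w i ∧ w i ≤ hi) →
      |share w B - share w A| ≤ (hi / lo) ^ 2 * d / n := by
    intro w hw
    have h1 := share_sdiff (w := w) hBA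
    have h2 := share_mono (fun i => h.pos.le.trans (hw i).1) hBA
    rw [abs_sub_comm, abs_of_nonneg (by linarith), ← h1]
    refine (share_le h.pos hw _).trans ?_
    gcongr
    nlinarith
  refine ((h.comparable hn hC hA).kulldorff_le hc (one_le_pow₀ hρ) (h.admissible hn B)
    (key h.m) (key h.b)).trans (le_of_eq ?_)
  unfold Data.disc
  ring

end Scan

/-! ### Approximate directional maxima over dyadic blocks -/

namespace Scan

open Classical in
/-- The better of two candidate positions for the maximum of `e * (M p - σ * B p)` over cuts. -/
noncomputable def pick (cut : ℕ → Prop) (M B : ℕ → ℝ) (e σ : ℝ) (a b : ℕ) : ℕ :=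
  if cut a ∧ (cut b → e * (M b - σ * B b) ≤ e * (M a - σ * B a)) then a else b

/-- The tables of the divide and conquer scheme. Level `l` distinguishes blocks of `2 ^ l`
consecutive positions and `F = F₀ * 2 ^ l` directions `σ = L * f / F`; the entry `A * F + f`
belongs to block `A` and direction `f`. A block of the next level takes the better of the
candidates of its two halves, for the direction of half the index. So the resolution in the
directions doubles with the size of the blocks, and all levels have the same number of entries. -/
noncomputable def tab (cut : ℕ → Prop) (M B : ℕ → ℝ) (L : ℝ) (F₀ : ℕ) (e : ℝ) : ℕ → ℕ → ℕ
  | 0, z => z / F₀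
  | l + 1, z =>
    let F := F₀ * 2 ^ l
    let f := z % (F + F)
    pick cut M B e (L * f / (F + F : ℕ)) (tab cut M B L F₀ e l (z - f + f / 2))
      (tab cut M B L F₀ e l (z - f + F + f / 2))

/-- Bounds for the growth of the prefix sums of the shares of `k` of the `n` points. -/
structure PrefixBounds (n k : ℕ) (ρ : ℝ) (M : ℕ → ℝ) : Prop where
  lower : ∀ p q, p ≤ q → q ≤ k → ((q - p : ℕ) : ℝ) / (ρ * n) ≤ M q - M p
  upper : ∀ p q, p ≤ q → q ≤ k → M q - M p ≤ ρ * (q - p : ℕ) / n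
  lower' : ∀ p q, p ≤ q → q ≤ k → ((n - (q - p) : ℕ) : ℝ) / (ρ * n) ≤ 1 - (M q - M p)
  upper' : ∀ p q, p ≤ q → q ≤ k → 1 - (M q - M p) ≤ ρ * (n - (q - p) : ℕ) / n

variable {n k F₀ lev κ : ℕ} {ρ L : ℝ} {M B : ℕ → ℝ} {cut : ℕ → Prop}

theorem PrefixBounds.abs_le (h : PrefixBounds n k ρ B) (hρ : 0 ≤ ρ) {p q d : ℕ} (hp : p ≤ k)
    (hq : q ≤ k) (hpq : p ≤ q + d) (hqp : q ≤ p + d) : |B q - B p| ≤ ρ * d / n := by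
  wlog hle : p ≤ q generalizing p q
  · rw [abs_sub_comm]
    exact this hq hp hqp hpq (by omega)
  have h1 := h.upper p q hle hq
  have h2 := (h.lower p q hle hq)
  have h3 : (0 : ℝ) ≤ ((q - p : ℕ) : ℝ) / (ρ * n) := by positivity
  rw [abs_of_nonneg (by linarith)]
  refine h1.trans ?_
  have : ((q - p : ℕ) : ℝ) ≤ d := by exact_mod_cast (by omega : q - p ≤ d)
  gcongr

theorem PrefixBounds.comparable (hM : PrefixBounds n k ρ M) (hB : PrefixBounds n k ρ B)
    (hn : 0 < n) (hρ : 0 < ρ) {i j : ℕ} (hij : i < j) (hj : j ≤ k) (hlt : j - i < n) :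
    Comparable (ρ ^ 2) (M j - M i) (B j - B i) := by
  have hn' : (0 : ℝ) < n := by exact_mod_cast hn
  have e1 : ∀ d : ℕ, ρ * (d : ℝ) / n = ρ ^ 2 * (d / (ρ * n)) := fun d => by field_simp
  have h1 := hM.lower i j hij.le hj
  have h2 := hM.upper i j hij.le hj
  have h3 := hM.lower' i j hij.le hj
  have h4 := hM.upper' i j hij.le hj
  have k1 := hB.lower i j hij.le hj
  have k2 := hB.upper i j hij.le hj
  have k3 := hB.lower' i j hij.le hj
  have k4 := hB.upper' i j hij.le hj
  rw [e1] at h2 h4 k2 k4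
  have p1 : 0 < ((j - i : ℕ) : ℝ) / (ρ * n) := by
    have : (0 : ℝ) < (j - i : ℕ) := by exact_mod_cast (by omega : 0 < j - i)
    positivity
  have p2 : 0 < ((n - (j - i) : ℕ) : ℝ) / (ρ * n) := by
    have : (0 : ℝ) < (n - (j - i) : ℕ) := by exact_mod_cast (by omega : 0 < n - (j - i))
    positivity
  have hρ2 : 0 ≤ ρ ^ 2 := by positivity
  refine ⟨by linarith, by linarith, by linarith, by linarith, ?_, ?_, ?_, ?_⟩
  · exact h2.trans (by gcongr)
  · exact k2.trans (by gcongr)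
  · exact h4.trans (by gcongr)
  · exact k4.trans (by gcongr)

theorem tab_succ (e : ℝ) (l A : ℕ) {f : ℕ} (hf : f < F₀ * 2 ^ l + F₀ * 2 ^ l) :
    tab cut M B L F₀ e (l + 1) (A * (F₀ * 2 ^ l + F₀ * 2 ^ l) + f) =
      pick cut M B e (L * f / (F₀ * 2 ^ l + F₀ * 2 ^ l : ℕ))
        (tab cut M B L F₀ e l (2 * A * (F₀ * 2 ^ l) + f / 2))
        (tab cut M B L F₀ e l ((2 * A + 1) * (F₀ * 2 ^ l) + f / 2)) := by
  set F := F₀ * 2 ^ l with hF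
  have hmod : (A * (F + F) + f) % (F + F) = f := by
    rw [mul_comm, Nat.mul_add_mod, Nat.mod_eq_of_lt hf]
  have e1 : A * (F + F) + f - f + f / 2 = 2 * A * F + f / 2 := by
    rw [Nat.add_sub_cancel]; ring
  have e2 : A * (F + F) + f - f + F + f / 2 = (2 * A + 1) * F + f / 2 := by
    rw [Nat.add_sub_cancel]; ring
  simp only [tab]
  rw [← hF, hmod, e1, e2]

theorem div_two_pow_succ (p l : ℕ) : p / 2 ^ (l + 1) = p / 2 ^ l / 2 := by
  rw [Nat.div_div_eq_div_mul, pow_succ]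

/-- The entries of the tables lie in their blocks. -/
theorem tab_div (hF : 0 < F₀) (e : ℝ) (l : ℕ) : ∀ A f, f < F₀ * 2 ^ l →
    tab cut M B L F₀ e l (A * (F₀ * 2 ^ l) + f) / 2 ^ l = A := by
  induction l with
  | zero =>
    intro A f hf
    simp only [pow_zero, mul_one, Nat.div_one] at hf ⊢
    simp only [tab]
    rw [mul_comm, Nat.mul_add_div hF, Nat.div_eq_of_lt hf, add_zero]
  | succ l ih =>
    intro A f hf
    have hFF : F₀ * 2 ^ (l + 1) = F₀ * 2 ^ l + F₀ * 2 ^ l := by ring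
    rw [hFF] at hf ⊢
    have h1 := ih (2 * A) (f / 2) (by omega)
    have h2 := ih (2 * A + 1) (f / 2) (by omega)
    rw [tab_succ _ _ _ hf, div_two_pow_succ]
    unfold pick
    split_ifs <;> omega

/-- The entries of the tables are almost optimal cuts of their blocks. Each level adds the same
amount to the error, since the product of the spacing of the directions and the length of the
blocks is the same on all levels. -/
theorem tab_spec (hB : PrefixBounds n k ρ B) (hρ : 0 ≤ ρ) (hL : 0 ≤ L) (hF : 0 < F₀)
    (hcut : ∀ p, cut p → p ≤ k) {e : ℝ} (he : |e| = 1) (l : ℕ) :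
    ∀ A f p, f < F₀ * 2 ^ l → p / 2 ^ l = A → cut p →
      cut (tab cut M B L F₀ e l (A * (F₀ * 2 ^ l) + f)) ∧
        e * (M p - L * f / (F₀ * 2 ^ l : ℕ) * B p) ≤
          e * (M (tab cut M B L F₀ e l (A * (F₀ * 2 ^ l) + f)) - L * f / (F₀ * 2 ^ l : ℕ) *
            B (tab cut M B L F₀ e l (A * (F₀ * 2 ^ l) + f))) + l * (L * ρ / (2 * F₀ * n)) := by
  induction l with
  | zero =>
    intro A f p hf hp hc
    have := tab_div (cut := cut) (M := M) (B := B) (L := L) hF e 0 A f hf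
    rw [pow_zero, Nat.div_one] at this hp
    rw [pow_zero] at *
    rw [this, ← hp]
    exact ⟨hc, by simp⟩
  | succ l ih =>
    intro A f p hf hp hc
    have hFF : F₀ * 2 ^ (l + 1) = F₀ * 2 ^ l + F₀ * 2 ^ l := by ring
    rw [hFF] at hf ⊢
    rw [tab_succ _ _ _ hf]
    have d1 := tab_div (cut := cut) (M := M) (B := B) (L := L) hF e l (2 * A) (f / 2) (by omega)
    have d2 := tab_div (cut := cut) (M := M) (B := B) (L := L) hF e l (2 * A + 1) (f / 2)
      (by omega)
    set F := F₀ * 2 ^ l with hFdef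
    have hFpos : 0 < F := by positivity
    have hf2 : f / 2 < F := by omega
    have ih1 := ih (2 * A) (f / 2) p hf2
    have ih2 := ih (2 * A + 1) (f / 2) p hf2
    set σ' : ℝ := L * f / (F + F : ℕ) with hσ'
    set σ : ℝ := L * (f / 2 : ℕ) / F with hσ
    set t₁ := tab cut M B L F₀ e l (2 * A * F + f / 2)
    set t₂ := tab cut M B L F₀ e l ((2 * A + 1) * F + f / 2)
    -- the change of direction costs at most half the spacing times the length of a block
    have htrans : ∀ t, p / 2 ^ l = t / 2 ^ l → cut t →
        e * (M p - σ * B p) ≤ e * (M t - σ * B t) + l * (L * ρ / (2 * F₀ * n)) →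
        e * (M p - σ' * B p) ≤ e * (M t - σ' * B t) + (l + 1 : ℕ) * (L * ρ / (2 * F₀ * n)) := by
      intro t hpt hct hle
      have h2l : 0 < 2 ^ l := by positivity
      have b1 : |B t - B p| ≤ ρ * (2 ^ l : ℕ) / n := by
        have m1 := Nat.div_add_mod p (2 ^ l)
        have m2 := Nat.div_add_mod t (2 ^ l)
        have m3 := Nat.mod_lt p h2l
        have m4 := Nat.mod_lt t h2l
        rw [hpt] at m1
        exact hB.abs_le hρ (hcut _ hc) (hcut _ hct) (by omega) (by omega)
      have hFr : (0 : ℝ) < F := by exact_mod_cast hFpos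
      have b2 : |σ' - σ| ≤ L / (2 * F) := by
        have h1 : σ' - σ = L * (f - 2 * (f / 2 : ℕ)) / (2 * F) := by
          rw [hσ', hσ]; push_cast; field_simp; ring
        have h2 : (f : ℝ) - 2 * (f / 2 : ℕ) = (f % 2 : ℕ) := by
          have : f = 2 * (f / 2) + f % 2 := (Nat.div_add_mod f 2).symm
          have : (f : ℝ) = 2 * (f / 2 : ℕ) + (f % 2 : ℕ) := by exact_mod_cast this
          linarith
        have h3 : ((f % 2 : ℕ) : ℝ) ≤ 1 := by exact_mod_cast (by omega : f % 2 ≤ 1)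
        rw [h1, h2, abs_of_nonneg (by positivity)]
        gcongr
        nlinarith
      have b3 : |e * ((σ' - σ) * (B t - B p))| ≤ L * ρ / (2 * F₀ * n) := by
        rw [abs_mul, he, one_mul, abs_mul]
        refine (mul_le_mul b2 b1 (abs_nonneg _) (by positivity)).trans (le_of_eq ?_)
        have hF0 : (F₀ : ℝ) ≠ 0 := by exact_mod_cast hF.ne'
        rw [hFdef]
        push_cast
        rcases eq_or_ne (n : ℝ) 0 with h0 | h0
        · rw [h0]; simp
        · field_simp
      have b4 := neg_le_of_abs_le b3
      have b5 := le_of_abs_le b3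
      push_cast
      linarith
    have hhalf : p / 2 ^ l = 2 * A ∨ p / 2 ^ l = 2 * A + 1 := by
      rw [div_two_pow_succ] at hp
      omega
    rcases hhalf with hl | hr
    · obtain ⟨i2, i3⟩ := ih1 hl hc
      have i4 := htrans _ (hl.trans d1.symm) i2 i3
      unfold pick
      split_ifs with hp
      · exact ⟨i2, i4⟩
      · push Not at hp
        obtain ⟨h1, h2⟩ := hp i2
        exact ⟨h1, by linarith⟩
    · obtain ⟨i2, i3⟩ := ih2 hr hc
      have i4 := htrans _ (hr.trans d2.symm) i2 i3
      unfold pick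
      split_ifs with hp
      · exact ⟨hp.1, by linarith [hp.2 i2]⟩
      · exact ⟨i2, i4⟩

/-- Two positions that are far apart lie, on some level, in blocks that are close to each other
but not adjacent. -/
theorem exists_level {i j lev : ℕ} (hij : i + 2 ≤ j) (hj : j < 2 ^ lev) :
    ∃ l < lev, i / 2 ^ l + 2 ≤ j / 2 ^ l ∧ j / 2 ^ l ≤ i / 2 ^ l + 3 := by
  classical
  have hout : ¬ (i / 2 ^ lev + 2 ≤ j / 2 ^ lev) := by
    rw [Nat.div_eq_of_lt hj, Nat.div_eq_of_lt (by omega : i < 2 ^ lev)]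
    omega
  have hex : ∃ l, ¬ (i / 2 ^ l + 2 ≤ j / 2 ^ l) :=
    ⟨lev, hout⟩
  have hspec := Nat.find_spec hex
  have hpos : Nat.find hex ≠ 0 := fun h => by
    rw [h] at hspec
    simp only [pow_zero, Nat.div_one] at hspec
    exact hspec hij
  obtain ⟨l, hl⟩ := Nat.exists_eq_succ_of_ne_zero hpos
  have hlev : Nat.find hex ≤ lev := Nat.find_min' hex hout
  have h1 := Nat.find_min hex (m := l) (by omega)
  rw [not_not] at h1
  rw [hl, Nat.succ_eq_add_one, div_two_pow_succ, div_two_pow_succ] at hspec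
  exact ⟨l, by omega, h1, by omega⟩

/-- Every `σ` in `[0, L]` is close to one of `F` directions. -/
theorem exists_direction {F : ℕ} (hF : 0 < F) {L σ : ℝ} (hL : 0 < L) (hσ0 : 0 ≤ σ) (hσL : σ ≤ L) :
    ∃ f < F, |σ - L * f / F| ≤ L / F := by
  have hFr : (0 : ℝ) < F := by exact_mod_cast hF
  have hx : 0 ≤ σ * F / L := by positivity
  have hx1 : σ * F / L ≤ F := by
    rw [div_le_iff₀ hL]
    nlinarith
  have hf1 := Nat.floor_le hx
  have hf2 := Nat.lt_floor_add_one (σ * F / L)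
  refine ⟨min ⌊σ * F / L⌋₊ (F - 1), by omega, ?_⟩
  have hF1 : ((F - 1 : ℕ) : ℝ) = F - 1 := by
    rw [Nat.cast_sub (by omega)]; simp
  have hb : |σ * F / L - ((min ⌊σ * F / L⌋₊ (F - 1) : ℕ) : ℝ)| ≤ 1 := by
    rw [Nat.cast_min, hF1, abs_le]
    rcases min_cases ((⌊σ * F / L⌋₊ : ℕ) : ℝ) ((F : ℝ) - 1) with ⟨h, h'⟩ | ⟨h, h'⟩ <;>
      rw [h] <;> constructor <;> linarith
  generalize ((min ⌊σ * F / L⌋₊ (F - 1) : ℕ) : ℝ) = f at hb ⊢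
  have : σ - L * f / F = L / F * (σ * F / L - f) := by field_simp
  rw [this, abs_mul, abs_of_pos (by positivity)]
  calc _ ≤ L / F * 1 := by gcongr
    _ = _ := mul_one _

/-- For every pair of distant cuts, some pair of table entries that the algorithm inspects is
almost as good. All pairs of positions in the two blocks are at least `κ` apart, and at least `κ`
points lie outside of the strip, so that no unsupported pair can hide a supported one. -/
theorem exists_tab_pair (hM : PrefixBounds n k ρ M) (hB : PrefixBounds n k ρ B) (hn : 0 < n)
    (hρ : 1 ≤ ρ) (hF : 0 < F₀) (hcut : ∀ p, cut p → p ≤ k) (hk : k + κ ≤ n) (hκ : 1 ≤ κ)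
    (hlev : k < 2 ^ lev) {c ε : ℝ} (hc : 0 ≤ c)
    (hFε : 4 * c * (ρ ^ 2) ^ 3 * (lev + 2) ≤ F₀ * n * ε)
    {i j : ℕ} (hi : cut i) (hj : cut j) (hij : i + 4 * κ ≤ j) :
    ∃ l < lev, ∃ d, (d = 2 ∨ d = 3) ∧ ∃ z, z < F₀ * 2 ^ lev ∧
      ∃ e : ℝ, (e = 1 ∨ e = -1) ∧ ∃ a b, a = tab cut M B (ρ ^ 2) F₀ (-e) l z ∧
        b = tab cut M B (ρ ^ 2) F₀ e l (z + d * (F₀ * 2 ^ l)) ∧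
        z + d * (F₀ * 2 ^ l) < F₀ * 2 ^ lev ∧
        cut a ∧ cut b ∧ a + κ ≤ b ∧
        kulldorff c (M j - M i) (B j - B i) ≤ kulldorff c (M b - M a) (B b - B a) + ε / 2 := by
  have hn' : (0 : ℝ) < n := by exact_mod_cast hn
  have hF' : (0 : ℝ) < F₀ := by exact_mod_cast hF
  have hρ0 : 0 < ρ := one_pos.trans_le hρ
  have hik := hcut i hi
  have hjk := hcut j hj
  have hcomp := hM.comparable hB hn hρ0 (by omega : i < j) hjk (by omega)
  obtain ⟨g, σ, hg, hσ0, hσL, hgrad⟩ := hcomp.exists_gradient hc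
  obtain ⟨l, hl, hl2, hl3⟩ := exists_level (by omega : i + 2 ≤ j) (hjk.trans_lt hlev)
  set F := F₀ * 2 ^ l with hFdef
  have hFpos : 0 < F := by positivity
  have hFr : (0 : ℝ) < F := by exact_mod_cast hFpos
  have h2l : 0 < 2 ^ l := by positivity
  set L := ρ ^ 2 with hLdef
  have hL1 : 1 ≤ L := one_le_pow₀ hρ
  obtain ⟨f, hf, hσf⟩ := exists_direction hFpos (by positivity : 0 < L) hσ0 hσL
  obtain ⟨d, hd, hdj⟩ : ∃ d, (d = 2 ∨ d = 3) ∧ j / 2 ^ l = i / 2 ^ l + d :=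
    ⟨j / 2 ^ l - i / 2 ^ l, by omega, by omega⟩
  obtain ⟨e, he, hge⟩ : ∃ e : ℝ, (e = 1 ∨ e = -1) ∧ g = |g| * e := by
    rcases abs_cases g with ⟨h, -⟩ | ⟨h, -⟩
    · exact ⟨1, .inl rfl, by rw [h]; ring⟩
    · exact ⟨-1, .inr rfl, by rw [h]; ring⟩
  have he1 : |e| = 1 := by rcases he with rfl | rfl <;> simp
  have he2 : |-e| = 1 := by rw [abs_neg, he1]
  have hz : i / 2 ^ l * F + f + d * F = j / 2 ^ l * F + f := by rw [hdj]; ring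
  have hzlt : j / 2 ^ l * F + f < F₀ * 2 ^ lev := by
    have h1 : j / 2 ^ l < 2 ^ (lev - l) := by
      rw [Nat.div_lt_iff_lt_mul h2l, ← pow_add]
      rw [Nat.sub_add_cancel hl.le]; omega
    have h2 : F₀ * 2 ^ lev = 2 ^ (lev - l) * F := by
      rw [hFdef, mul_left_comm, ← pow_add, Nat.sub_add_cancel hl.le]
    calc j / 2 ^ l * F + f < j / 2 ^ l * F + F := by omega
      _ = (j / 2 ^ l + 1) * F := by ring
      _ ≤ _ := by rw [h2]; exact Nat.mul_le_mul_right _ h1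
  have da := tab_div (cut := cut) (M := M) (B := B) (L := L) hF (-e) l (i / 2 ^ l) f hf
  have db := tab_div (cut := cut) (M := M) (B := B) (L := L) hF e l (j / 2 ^ l) f hf
  obtain ⟨ca, va⟩ := tab_spec (M := M) hB hρ0.le (zero_le_one.trans hL1) hF hcut he2 l
    (i / 2 ^ l) f i hf rfl hi
  obtain ⟨cb, vb⟩ := tab_spec (M := M) hB hρ0.le (zero_le_one.trans hL1) hF hcut he1 l
    (j / 2 ^ l) f j hf rfl hj
  rw [← hFdef] at da db ca va cb vb
  refine ⟨l, hl, d, hd, i / 2 ^ l * F + f, by omega, e, he, _, _, rfl, rfl, by rw [hz]; exact hzlt,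
    ca, by rw [hz]; exact cb, ?_⟩
  rw [hz]
  set a := tab cut M B L F₀ (-e) l (i / 2 ^ l * F + f)
  set b := tab cut M B L F₀ e l (j / 2 ^ l * F + f)
  have mi := Nat.div_add_mod i (2 ^ l)
  have mj := Nat.div_add_mod j (2 ^ l)
  have ma := Nat.div_add_mod a (2 ^ l)
  have mb := Nat.div_add_mod b (2 ^ l)
  have li := Nat.mod_lt i h2l
  have lj := Nat.mod_lt j h2l
  have la := Nat.mod_lt a h2l
  have lb := Nat.mod_lt b h2l
  rw [da] at ma
  rw [db] at mb
  rw [hdj, mul_add] at mj mb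
  have hab : a + κ ≤ b := by
    rcases hd with rfl | rfl <;> omega
  refine ⟨hab, ?_⟩
  clear_value a b
  have hak := hcut a ca
  have hbk := hcut b cb
  have hadm : Admissible (M b - M a) (B b - B a) := by
    have := hM.comparable hB hn hρ0 (by omega : a < b) hbk (by omega)
    exact ⟨this.x0.le, this.x1.le, this.y0.le, this.y1.le, fun _ => this.y0, fun _ => this.y1⟩
  have hgap := hgrad _ _ hadm
  have hdist : ∀ {p q}, p ≤ k → q ≤ k → p ≤ q + 2 ^ l → q ≤ p + 2 ^ l →
      |e * ((σ - L * f / F) * (B q - B p))| ≤ 2 * (L * ρ / (2 * F₀ * n)) := by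
    intro p q hp hq h1 h2
    rw [abs_mul, he1, one_mul, abs_mul]
    refine (mul_le_mul hσf (hB.abs_le hρ0.le hp hq h1 h2) (abs_nonneg _) (by positivity)).trans
      (le_of_eq ?_)
    rw [hFdef]
    push_cast
    field_simp
  have w1 := neg_le_of_abs_le (hdist hik hak (by omega) (by omega))
  have w4 := le_of_abs_le (hdist hjk hbk (by omega) (by omega))
  set η := L * ρ / (2 * F₀ * n) with hη
  have hη0 : 0 ≤ η := by positivity
  have hmain : -(2 * (l + 2) * η) ≤
      e * ((M b - M a - (M j - M i)) - σ * (B b - B a - (B j - B i))) := by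
    linear_combination va + vb + w1 + w4
  have hlr : (l : ℝ) ≤ lev := by exact_mod_cast hl.le
  have hg2 : -(2 * L * (2 * (lev + 2) * η)) ≤
      g * ((M b - M a - (M j - M i)) - σ * (B b - B a - (B j - B i))) := by
    rw [hge, mul_assoc]
    have h1 := mul_le_mul_of_nonneg_left hmain (abs_nonneg g)
    have h2 : |g| * (2 * (l + 2) * η) ≤ 2 * L * (2 * (lev + 2) * η) := by gcongr
    linarith
  have hc2 := mul_le_mul_of_nonneg_left hg2 hc
  have hfin : c * (2 * L * (2 * (lev + 2) * η)) ≤ ε / 2 := by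
    have h1 : c * (2 * L * (2 * (lev + 2) * η)) = 2 * c * L ^ 2 * ρ * (lev + 2) / (F₀ * n) := by
      rw [hη]; field_simp
    have h2 : ρ ≤ L := by rw [hLdef]; nlinarith
    rw [h1, div_le_iff₀ (by positivity)]
    have h3 : 2 * c * L ^ 2 * ρ * (lev + 2) ≤ 2 * c * L ^ 2 * L * (lev + 2) := by gcongr
    linear_combination h3 + hFε / 2
  linear_combination hgap + hc2 + hfin

end Scan

/-! ### Sorting by ranks -/

namespace Scan

variable {n : ℕ}

/-- The order by `f`, ties being broken by the index. -/
def Before (f : Fin n → ℝ) (i j : Fin n) : Prop := f i ≤ f j ∧ ¬ (f j ≤ f i ∧ j ≤ i)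

open Classical in
/-- The number of indices that come before `i`. -/
noncomputable def rank (f : Fin n → ℝ) (i : Fin n) : ℕ :=
  (Finset.univ.filter fun j => Before f j i).card

theorem rank_lt (f : Fin n → ℝ) (i : Fin n) : rank f i < n := by
  classical
  have : rank f i < (Finset.univ : Finset (Fin n)).card := by
    refine Finset.card_lt_card (Finset.filter_ssubset.2 ⟨i, Finset.mem_univ _, ?_⟩)
    simp [Before]
  simpa using this

theorem rank_lt_rank {f : Fin n → ℝ} {i j : Fin n} (h : Before f i j) : rank f i < rank f j := by
  classical
  unfold rank
  refine Finset.card_lt_card ?_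
  rw [Finset.ssubset_iff_of_subset]
  · refine ⟨i, by simpa using h, by simp [Before]⟩
  · rw [Finset.subset_iff]
    intro k hk
    rw [Finset.mem_filter] at hk ⊢
    obtain ⟨-, hk⟩ := hk
    refine ⟨Finset.mem_univ _, hk.1.trans h.1, fun ⟨h1, h2⟩ => ?_⟩
    have h3 : f j ≤ f i := h1.trans hk.1
    have h4 : f i ≤ f k := h.1.trans h1
    have h5 : ¬ j ≤ i := fun h' => h.2 ⟨h3, h'⟩
    have h6 : ¬ i ≤ k := fun h' => hk.2 ⟨h4, h'⟩
    omega

theorem rank_injective (f : Fin n → ℝ) : Function.Injective (rank f) := by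
  intro i j hij
  by_contra hne
  have : Before f i j ∨ Before f j i := by
    unfold Before
    rcases lt_trichotomy (f i) (f j) with h | h | h
    · exact .inl ⟨h.le, fun h' => absurd h'.1 (not_le.2 h)⟩
    · rcases lt_or_gt_of_ne hne with h' | h'
      · exact .inl ⟨h.le, fun h'' => absurd h''.2 (not_le.2 h')⟩
      · exact .inr ⟨h.ge, fun h'' => absurd h''.2 (not_le.2 h')⟩
    · exact .inr ⟨h.le, fun h' => absurd h'.1 (not_le.2 h)⟩
  rcases this with h | h
  · exact absurd hij (rank_lt_rank h).ne
  · exact absurd hij (rank_lt_rank h).ne'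

/-- The permutation that sorts `f` puts `i` into the position `rank f i`. -/
theorem exists_sorting (f : Fin n → ℝ) : ∃ π : Equiv.Perm (Fin n),
    (∀ q, rank f (π q) = q) ∧ Monotone (f ∘ π) := by
  let r : Fin n → Fin n := fun i => ⟨rank f i, rank_lt f i⟩
  have hr : Function.Injective r := fun i j h => rank_injective f (by simpa [r] using h)
  let e : Equiv.Perm (Fin n) := Equiv.ofBijective r (Finite.injective_iff_bijective.1 hr)
  have he : ∀ q, rank f (e.symm q) = q := by
    intro q
    have : r (e.symm q) = q := e.apply_symm_apply q
    exact congrArg Fin.val this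
  refine ⟨e.symm, he, fun q q' hq => ?_⟩
  by_contra hlt
  have hlt : f (e.symm q') < f (e.symm q) := not_le.1 hlt
  have := rank_lt_rank (f := f) (i := e.symm q') (j := e.symm q)
    ⟨hlt.le, fun h => absurd h.1 (not_le.2 hlt)⟩
  rw [he, he] at this
  exact absurd hq (not_le.2 this)

/-! ### Boxes, strips and cuts -/

open Classical in
/-- The points of a closed box whose timestamp is at least `τ`. -/
noncomputable def Data.box (D : Data n) (t : Fin n → ℝ) (τ x₁ x₂ y₁ y₂ : ℝ) : Finset (Fin n) :=
  Finset.univ.filter fun i =>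
    x₁ ≤ (D.pt i).1 ∧ (D.pt i).1 ≤ x₂ ∧ y₁ ≤ (D.pt i).2 ∧ (D.pt i).2 ≤ y₂ ∧ τ ≤ t i

theorem Data.mem_box {D : Data n} {t : Fin n → ℝ} {τ x₁ x₂ y₁ y₂ : ℝ} {i : Fin n} :
    i ∈ D.box t τ x₁ x₂ y₁ y₂ ↔
      x₁ ≤ (D.pt i).1 ∧ (D.pt i).1 ≤ x₂ ∧ y₁ ≤ (D.pt i).2 ∧ (D.pt i).2 ≤ y₂ ∧ τ ≤ t i := by
  simp [Data.box]

theorem Data.insideSince_eq_box (D : Data n) (t : Fin n → ℝ) (R : Rect) (τ : ℝ) :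
    D.insideSince t R τ = D.box t τ R.x₁ R.x₂ R.y₁ R.y₂ := by
  ext i
  rw [Data.mem_box]
  simp [Data.insideSince, Rect.toSet, Prod.le_def]
  tauto

open Classical in
/-- The points of the strip `y₁ ≤ y ≤ y₂` with timestamp at least `τ`, in the order `π`. -/
noncomputable def Data.strip (D : Data n) (t : Fin n → ℝ) (π : Equiv.Perm (Fin n))
    (τ y₁ y₂ : ℝ) : List (Fin n) :=
  ((List.finRange n).map π).filter fun i =>
    decide (τ ≤ t i ∧ y₁ ≤ (D.pt i).2 ∧ (D.pt i).2 ≤ y₂)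

theorem Data.mem_strip {D : Data n} {t : Fin n → ℝ} {π : Equiv.Perm (Fin n)} {τ y₁ y₂ : ℝ}
    {i : Fin n} :
    i ∈ D.strip t π τ y₁ y₂ ↔ τ ≤ t i ∧ y₁ ≤ (D.pt i).2 ∧ (D.pt i).2 ≤ y₂ := by
  simp only [Data.strip, List.mem_filter, List.mem_map, List.mem_finRange, true_and,
    decide_eq_true_eq, and_iff_right_iff_imp]
  exact fun _ => ⟨π.symm i, π.apply_symm_apply i⟩

theorem Data.nodup_strip (D : Data n) (t : Fin n → ℝ) (π : Equiv.Perm (Fin n)) (τ y₁ y₂ : ℝ) :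
    (D.strip t π τ y₁ y₂).Nodup :=
  ((List.nodup_finRange n).map π.injective).filter _

theorem Data.length_strip_le (D : Data n) (t : Fin n → ℝ) (π : Equiv.Perm (Fin n))
    (τ y₁ y₂ : ℝ) : (D.strip t π τ y₁ y₂).length ≤ n := by
  refine (List.length_filter_le _ _).trans ?_
  simp

theorem Data.sorted_strip {D : Data n} (t : Fin n → ℝ) {π : Equiv.Perm (Fin n)}
    (hπ : Monotone ((fun i => (D.pt i).1) ∘ π)) (τ y₁ y₂ : ℝ) :
    (D.strip t π τ y₁ y₂).Pairwise fun i j => (D.pt i).1 ≤ (D.pt j).1 := by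
  refine List.Pairwise.filter _ ?_
  rw [List.pairwise_map]
  refine (List.pairwise_lt_finRange n).imp fun {a b} h => ?_
  exact hπ h.le

/-- The abscissa of the point number `p` of a list. -/
noncomputable def Data.xAt (D : Data n) (l : List (Fin n)) (p : ℕ) : ℝ :=
  if h : p < l.length then (D.pt l[p]).1 else 0

/-- The weight of the first `p` points of a list. -/
noncomputable def pre (w : Fin n → ℝ) (l : List (Fin n)) (p : ℕ) : ℝ := ((l.take p).map w).sum

/-- The position `p` in a sorted list separates points with different abscissas. -/
def Data.IsCut (D : Data n) (l : List (Fin n)) (p : ℕ) : Prop :=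
  p ≤ l.length ∧ ¬ ((¬ p ≤ 0 ∧ ¬ l.length ≤ p) ∧ D.xAt l p ≤ D.xAt l (p - 1))

/-- The points of the list from position `i` up to, but not including, position `j`. -/
def seg (l : List (Fin n)) (i j : ℕ) : Finset (Fin n) := ((l.take j).drop i).toFinset

theorem mem_seg {l : List (Fin n)} {i j : ℕ} {a : Fin n} :
    a ∈ seg l i j ↔ ∃ p, ∃ h : p < l.length, i ≤ p ∧ p < j ∧ l[p] = a := by
  simp only [seg, List.mem_toFinset, List.mem_iff_getElem, List.getElem_drop, List.getElem_take,
    List.length_drop, List.length_take]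
  constructor
  · rintro ⟨q, hq, rfl⟩
    exact ⟨i + q, by omega, by omega, by omega, rfl⟩
  · rintro ⟨p, hp, h1, h2, rfl⟩
    exact ⟨p - i, by omega, by simp [Nat.add_sub_cancel' h1]⟩

theorem card_seg {l : List (Fin n)} (hl : l.Nodup) {i j : ℕ} (hj : j ≤ l.length) :
    (seg l i j).card = j - i := by
  rw [seg, List.toFinset_card_of_nodup ((hl.sublist (List.take_sublist _ _)).sublist
    (List.drop_sublist _ _)), List.length_drop, List.length_take]
  omega

theorem share_seg {l : List (Fin n)} (hl : l.Nodup) (w : Fin n → ℝ) {i j : ℕ} (hij : i ≤ j) :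
    share w (seg l i j) = pre w l j / (∑ i, w i) - pre w l i / (∑ i, w i) := by
  have h1 : ∑ a ∈ seg l i j, w a = (((l.take j).drop i).map w).sum :=
    List.sum_toFinset w ((hl.sublist (List.take_sublist _ _)).sublist (List.drop_sublist _ _))
  have h2 : pre w l j = pre w l i + (((l.take j).drop i).map w).sum := by
    unfold pre
    rw [← List.sum_append, ← List.map_append]
    congr 2
    have := List.take_append_drop i (l.take j)
    rw [List.take_take, min_eq_left hij] at this
    exact this.symm
  rw [share, h1, ← sub_div, h2]
  ring

variable {D : Data n} {t : Fin n → ℝ} {l : List (Fin n)}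

theorem Data.xAt_le (hs : l.Pairwise fun i j => (D.pt i).1 ≤ (D.pt j).1) {p q : ℕ} (hpq : p ≤ q)
    (hq : q < l.length) : D.xAt l p ≤ D.xAt l q := by
  rcases hpq.eq_or_lt with rfl | hlt
  · exact le_rfl
  · rw [Data.xAt, Data.xAt, dif_pos hq, dif_pos (hlt.trans hq)]
    exact List.pairwise_iff_getElem.1 hs p q (hlt.trans hq) hq hlt

theorem Data.xAt_eq (p : ℕ) (h : p < l.length) : D.xAt l p = (D.pt l[p]).1 := by
  rw [Data.xAt, dif_pos h]

theorem Data.mem_box_iff_seg {π : Equiv.Perm (Fin n)} {τ x₁ x₂ y₁ y₂ : ℝ} {a : Fin n} :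
    a ∈ D.box t τ x₁ x₂ y₁ y₂ ↔ ∃ p, ∃ h : p < (D.strip t π τ y₁ y₂).length,
      (x₁ ≤ D.xAt (D.strip t π τ y₁ y₂) p ∧ D.xAt (D.strip t π τ y₁ y₂) p ≤ x₂) ∧
        (D.strip t π τ y₁ y₂)[p] = a := by
  have key : a ∈ D.box t τ x₁ x₂ y₁ y₂ ↔
      a ∈ D.strip t π τ y₁ y₂ ∧ x₁ ≤ (D.pt a).1 ∧ (D.pt a).1 ≤ x₂ := by
    rw [Data.mem_box, Data.mem_strip]; tauto
  rw [key, List.mem_iff_getElem]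
  constructor
  · rintro ⟨⟨p, hp, rfl⟩, h⟩
    exact ⟨p, hp, by rwa [Data.xAt_eq p hp], rfl⟩
  · rintro ⟨p, hp, h, rfl⟩
    exact ⟨⟨p, hp, rfl⟩, by rwa [Data.xAt_eq p hp] at h⟩

/-- The part of a strip between two cuts is a box. -/
theorem Data.box_eq_seg {π : Equiv.Perm (Fin n)} (hπ : Monotone ((fun i => (D.pt i).1) ∘ π))
    {τ y₁ y₂ : ℝ} {i j : ℕ} (hij : i < j) (hi : D.IsCut (D.strip t π τ y₁ y₂) i)
    (hj : D.IsCut (D.strip t π τ y₁ y₂) j) :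
    D.box t τ (D.xAt (D.strip t π τ y₁ y₂) i) (D.xAt (D.strip t π τ y₁ y₂) (j - 1)) y₁ y₂ =
      seg (D.strip t π τ y₁ y₂) i j := by
  ext a
  rw [Data.mem_box_iff_seg (π := π), mem_seg]
  have hs := D.sorted_strip t hπ τ y₁ y₂
  set l := D.strip t π τ y₁ y₂
  obtain ⟨hil, hi⟩ := hi
  obtain ⟨hjl, hj⟩ := hj
  refine exists_congr fun p => exists_congr fun hp => ?_
  rw [← and_assoc]
  refine and_congr_left fun _ => ⟨fun ⟨h1, h2⟩ => ⟨?_, ?_⟩, fun ⟨h1, h2⟩ =>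
    ⟨Data.xAt_le hs h1 hp, Data.xAt_le hs (by omega) (by omega)⟩⟩
  · by_contra hlt
    refine hi ⟨⟨by omega, by omega⟩, h1.trans (Data.xAt_le hs (by omega) (by omega))⟩
  · by_contra hlt
    exact hj ⟨⟨by omega, by omega⟩, (Data.xAt_le hs (by omega : j ≤ p) hp).trans h2⟩

/-- Every box that contains a point is the part of its strip between two cuts. -/
theorem Data.exists_seg_eq_box {π : Equiv.Perm (Fin n)}
    (hπ : Monotone ((fun i => (D.pt i).1) ∘ π)) {τ x₁ x₂ y₁ y₂ : ℝ}
    (hne : (D.box t τ x₁ x₂ y₁ y₂).Nonempty) :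
    ∃ i j, i < j ∧ D.IsCut (D.strip t π τ y₁ y₂) i ∧ D.IsCut (D.strip t π τ y₁ y₂) j ∧
      seg (D.strip t π τ y₁ y₂) i j = D.box t τ x₁ x₂ y₁ y₂ := by
  classical
  have hs := D.sorted_strip t hπ τ y₁ y₂
  have hmem := fun a => D.mem_box_iff_seg (t := t) (π := π) (τ := τ) (x₁ := x₁) (x₂ := x₂)
    (y₁ := y₁) (y₂ := y₂) (a := a)
  set l := D.strip t π τ y₁ y₂
  have ei : ∃ p, l.length ≤ p ∨ x₁ ≤ D.xAt l p := ⟨_, .inl le_rfl⟩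
  have ej : ∃ p, l.length ≤ p ∨ x₂ < D.xAt l p := ⟨_, .inl le_rfl⟩
  have il : Nat.find ei ≤ l.length := Nat.find_min' ei (.inl le_rfl)
  have jl : Nat.find ej ≤ l.length := Nat.find_min' ej (.inl le_rfl)
  have i1 : ∀ p < l.length, (Nat.find ei ≤ p ↔ x₁ ≤ D.xAt l p) := fun p hp =>
    ⟨fun h => by
      rcases Nat.find_spec ei with h' | h'
      · omega
      · exact h'.trans (Data.xAt_le hs h hp), fun h => Nat.find_min' ei (.inr h)⟩
  have j1 : ∀ p < l.length, (p < Nat.find ej ↔ D.xAt l p ≤ x₂) := fun p hp => by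
    rw [← not_iff_not, not_lt, not_le]
    exact ⟨fun h => by
      rcases Nat.find_spec ej with h' | h'
      · omega
      · exact h'.trans_le (Data.xAt_le hs h hp), fun h => Nat.find_min' ej (.inr h)⟩
  have heq : ∀ a, a ∈ seg l (Nat.find ei) (Nat.find ej) ↔ a ∈ D.box t τ x₁ x₂ y₁ y₂ := by
    intro a
    rw [hmem, mem_seg]
    refine exists_congr fun p => exists_congr fun hp => ?_
    rw [← and_assoc, i1 p hp, j1 p hp]
  refine ⟨Nat.find ei, Nat.find ej, ?_, ⟨il, ?_⟩, ⟨jl, ?_⟩, Finset.ext heq⟩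
  · obtain ⟨a, ha⟩ := hne
    obtain ⟨p, hp, h1, h2, -⟩ := mem_seg.1 ((heq a).2 ha)
    omega
  · rintro ⟨⟨h1, h2⟩, h3⟩
    have h4 := (i1 (Nat.find ei) (by omega)).1 le_rfl
    have h5 := (i1 (Nat.find ei - 1) (by omega)).2 (h4.trans h3)
    omega
  · rintro ⟨⟨h1, h2⟩, h3⟩
    have h4 := (j1 (Nat.find ej - 1) (by omega)).1 (by omega)
    have h5 := (j1 (Nat.find ej) (by omega)).2 (h3.trans h4)
    omega

theorem prefixBounds_pre {w : Fin n → ℝ} {lo hi : ℝ} (hlo : 0 < lo)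
    (hw : ∀ i, lo ≤ w i ∧ w i ≤ hi) (hn : 0 < n) (hl : l.Nodup) :
    PrefixBounds n l.length (hi / lo) fun p => pre w l p / ∑ i, w i := by
  have hsum : 0 < ∑ i, w i :=
    Finset.sum_pos (fun i _ => hlo.trans_le (hw i).1) ⟨⟨0, hn⟩, Finset.mem_univ _⟩
  have hc : ∀ p q, q ≤ l.length → (seg l p q)ᶜ.card = n - (q - p) := fun p q hq => by
    rw [Finset.card_compl, Fintype.card_fin, card_seg hl hq]
  refine ⟨fun p q hpq hq => ?_, fun p q hpq hq => ?_, fun p q hpq hq => ?_, fun p q hpq hq => ?_⟩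
  · rw [← share_seg hl w hpq, ← card_seg hl hq]; exact share_ge hlo hw _
  · rw [← share_seg hl w hpq, ← card_seg hl hq]; exact share_le hlo hw _
  · rw [← share_seg hl w hpq, one_sub_share hsum.ne', ← hc p q hq]; exact share_ge hlo hw _
  · rw [← share_seg hl w hpq, one_sub_share hsum.ne', ← hc p q hq]; exact share_le hlo hw _

end Scan

/-! ### Rounding the ordinates to a grid -/

namespace Scan

variable {n κ s : ℕ} {D : Data n} {t : Fin n → ℝ} {lo hi C c : ℝ}

theorem Data.Within.le_share (h : D.Within lo hi) (hn : 0 < n) (hκ : C * hi ≤ κ * lo)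
    {A : Finset (Fin n)} (hA : κ ≤ A.card) : C / n ≤ share D.m A ∧ C / n ≤ share D.b A := by
  have hn' : (0 : ℝ) < n := by exact_mod_cast hn
  have hlo := h.pos
  have hρ : 0 < hi / lo := one_pos.trans_le (h.one_le_ratio hn)
  have key : C / n ≤ (A.card : ℝ) / (hi / lo * n) := by
    have hA' : (κ : ℝ) ≤ A.card := by exact_mod_cast hA
    rw [div_le_div_iff₀ hn' (by positivity)]
    have : C * (hi / lo) ≤ A.card := by
      rw [mul_div_assoc', div_le_iff₀ hlo]
      exact hκ.trans (by gcongr)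
    calc C * (hi / lo * n) = C * (hi / lo) * n := by ring
      _ ≤ _ := by gcongr
  exact ⟨key.trans (share_ge h.pos h.m A), key.trans (share_ge h.pos h.b A)⟩

theorem Data.Within.supported_iff (h : D.Within lo hi) (hn : 0 < n) {A : Finset (Fin n)} :
    D.Supported C A ↔ (C / n ≤ share D.m A ∧ C / n ≤ share D.b A) ∧
      C / n ≤ share D.m Aᶜ ∧ C / n ≤ share D.b Aᶜ := by
  rw [← one_sub_share (h.sum_m_pos hn).ne', ← one_sub_share (h.sum_b_pos hn).ne']
  unfold Data.Supported
  simp only [Set.mem_Icc, le_sub_comm (a := C / (n : ℝ))]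
  tauto

/-- Sets of at least `κ` points whose complements have at least `κ` points are supported. -/
theorem Data.Within.supported (h : D.Within lo hi) (hn : 0 < n) (hκ : C * hi ≤ κ * lo)
    {A : Finset (Fin n)} (h1 : κ ≤ A.card) (h2 : A.card + κ ≤ n) : D.Supported C A := by
  have hc : κ ≤ Aᶜ.card := by rw [Finset.card_compl, Fintype.card_fin]; omega
  exact (h.supported_iff hn).2 ⟨h.le_share hn hκ h1, h.le_share hn hκ hc⟩

theorem Data.Within.supported_of_superset (h : D.Within lo hi) (hn : 0 < n)
    (hκ : C * hi ≤ κ * lo) {A B : Finset (Fin n)} (hA : D.Supported C A) (hAB : A ⊆ B)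
    (hB : B.card + κ ≤ n) : D.Supported C B := by
  have hc : κ ≤ Bᶜ.card := by rw [Finset.card_compl, Fintype.card_fin]; omega
  have h1 := ((h.supported_iff hn).1 hA).1
  exact (h.supported_iff hn).2
    ⟨⟨h1.1.trans (share_mono (fun i => h.pos.le.trans (h.m i).1) hAB),
      h1.2.trans (share_mono (fun i => h.pos.le.trans (h.b i).1) hAB)⟩, h.le_share hn hκ hc⟩

theorem Data.Within.supported_of_subset (h : D.Within lo hi) (hn : 0 < n)
    (hκ : C * hi ≤ κ * lo) {A B : Finset (Fin n)} (hA : D.Supported C A) (hBA : B ⊆ A)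
    (hB : κ ≤ B.card) : D.Supported C B := by
  have h1 := ((h.supported_iff hn).1 hA).2
  have hc : Aᶜ ⊆ Bᶜ := Finset.compl_subset_compl.2 hBA
  exact (h.supported_iff hn).2 ⟨h.le_share hn hκ hB,
    h1.1.trans (share_mono (fun i => h.pos.le.trans (h.m i).1) hc),
    h1.2.trans (share_mono (fun i => h.pos.le.trans (h.b i).1) hc)⟩

theorem Data.Within.nonempty_of_supported (h : D.Within lo hi) (hn : 0 < n) (hC : 0 < C)
    {A : Finset (Fin n)} (hA : D.Supported C A) : A.Nonempty := by
  have hn' : (0 : ℝ) < n := by exact_mod_cast hn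
  have : 0 < C / n := by positivity
  exact (share_pos_iff (fun i => h.pos.trans_le (h.m i).1) A).1 (this.trans_le hA.1.1)

/-- The positions, in the sorted order of the ordinates, that serve as boundaries: every `s`-th
position, and the first and the last `κ` positions. -/
def Grid (n κ s q : ℕ) : Prop := q < κ ∨ n ≤ q + κ ∨ s ∣ q

/-- The ordinate at the position `q` of the order `π`. -/
def Data.yAt (D : Data n) (π : Equiv.Perm (Fin n)) (q : Fin n) : ℝ := (D.pt (π q)).2

theorem card_le_of_window {π : Equiv.Perm (Fin n)} {S : Finset (Fin n)} {x y : ℕ}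
    (h : ∀ i ∈ S, x ≤ (π.symm i : ℕ) ∧ (π.symm i : ℕ) < y) : S.card ≤ y - x := by
  rw [← Nat.card_Ico]
  refine Finset.card_le_card_of_injOn (fun i => (π.symm i : ℕ)) (fun i hi => ?_) ?_
  · simpa using h i hi
  · intro i _ j _ hij
    exact π.symm.injective (Fin.ext hij)

section Rounding

variable {π : Equiv.Perm (Fin n)}

theorem Data.yAt_symm (i : Fin n) : D.yAt π (π.symm i) = (D.pt i).2 := by
  simp [Data.yAt]

theorem lt_of_yAt_lt (hπ : Monotone (D.yAt π)) {p q : Fin n} (h : D.yAt π p < D.yAt π q) :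
    p < q := by
  by_contra hle
  exact absurd (hπ (not_lt.1 hle)) (not_le.2 h)

/-- Between two grid positions that follow one another there are fewer than `s` positions. -/
theorem lt_add_of_no_grid (hs : 0 < s) {b q : ℕ}
    (h : ∀ g, b < g → g ≤ q → ¬ Grid n κ s g) : q < b + s := by
  by_contra hle
  have h1 := Nat.div_add_mod q s
  have h2 := Nat.mod_lt q hs
  exact h (s * (q / s)) (by omega) (by omega) (.inr (.inr ⟨_, rfl⟩))

/-- Shrinking the range of ordinates to grid positions loses at most `2 * (s - 1)` points. -/
theorem exists_rounding (hπ : Monotone (D.yAt π)) (hs : 0 < s) (hκ : 1 ≤ κ)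
    {τ x₁ x₂ y₁ y₂ : ℝ} (hne : (D.box t τ x₁ x₂ y₁ y₂).Nonempty) :
    ∃ u v : Fin n, Grid n κ s u ∧ Grid n κ s v ∧
      D.box t τ x₁ x₂ (D.yAt π u) (D.yAt π v) ⊆ D.box t τ x₁ x₂ y₁ y₂ ∧
      (D.box t τ x₁ x₂ y₁ y₂).card ≤
        (D.box t τ x₁ x₂ (D.yAt π u) (D.yAt π v)).card + 2 * (s - 1) := by
  classical
  obtain ⟨i₀, hi₀⟩ := hne
  rw [Data.mem_box] at hi₀
  have hn : 0 < n := i₀.pos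
  have hlast : ∀ q : Fin n, q ≤ (⟨n - 1, by omega⟩ : Fin n) := fun q => by
    rw [Fin.le_def]; dsimp only; omega
  have hfirst : ∀ q : Fin n, (⟨0, hn⟩ : Fin n) ≤ q := fun q => by
    rw [Fin.le_def]; dsimp only; omega
  obtain ⟨u, hu, humin⟩ := Finset.exists_min_image
    (Finset.univ.filter fun q : Fin n => Grid n κ s q ∧ y₁ ≤ D.yAt π q) id
    ⟨⟨n - 1, by omega⟩, by
      simp only [Finset.mem_filter, Finset.mem_univ, true_and]
      refine ⟨.inr (.inl (by omega)), ?_⟩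
      refine hi₀.2.2.1.trans ?_
      rw [← Data.yAt_symm (π := π) i₀]
      exact hπ (hlast _)⟩
  obtain ⟨v, hv, hvmax⟩ := Finset.exists_max_image
    (Finset.univ.filter fun q : Fin n => Grid n κ s q ∧ D.yAt π q ≤ y₂) id
    ⟨⟨0, hn⟩, by
      simp only [Finset.mem_filter, Finset.mem_univ, true_and]
      refine ⟨.inl (by omega), ?_⟩
      refine le_trans ?_ hi₀.2.2.2.1
      rw [← Data.yAt_symm (π := π) i₀]
      exact hπ (hfirst _)⟩
  simp only [Finset.mem_filter, Finset.mem_univ, true_and, id_eq] at hu hv humin hvmax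
  refine ⟨u, v, hu.1, hv.1, fun i hi => ?_, ?_⟩
  · rw [Data.mem_box] at hi ⊢
    exact ⟨hi.1, hi.2.1, hu.2.trans hi.2.2.1, hi.2.2.2.1.trans hv.2, hi.2.2.2.2⟩
  set A := D.box t τ x₁ x₂ y₁ y₂ with hA
  set A' := D.box t τ x₁ x₂ (D.yAt π u) (D.yAt π v) with hA'
  have hsub : A ⊆ A' ∪ ((A.filter fun i => (D.pt i).2 < D.yAt π u) ∪
      (A.filter fun i => D.yAt π v < (D.pt i).2)) := by
    intro i hi
    simp only [Finset.mem_union, Finset.mem_filter]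
    by_cases h1 : (D.pt i).2 < D.yAt π u
    · exact .inr (.inl ⟨hi, h1⟩)
    by_cases h2 : D.yAt π v < (D.pt i).2
    · exact .inr (.inr ⟨hi, h2⟩)
    refine .inl ?_
    rw [hA, Data.mem_box] at hi
    rw [hA', Data.mem_box]
    exact ⟨hi.1, hi.2.1, not_lt.1 h1, not_lt.1 h2, hi.2.2.2.2⟩
  have c1 : (A.filter fun i => (D.pt i).2 < D.yAt π u).card ≤ s - 1 := by
    refine (card_le_of_window (π := π) (x := u + 1 - s) (y := u) fun i hi => ?_).trans (by omega)
    rw [Finset.mem_filter, hA, Data.mem_box] at hi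
    obtain ⟨hi, hlt⟩ := hi
    rw [← Data.yAt_symm (π := π) i] at hlt
    have hq : π.symm i < u := lt_of_yAt_lt hπ hlt
    refine ⟨?_, hq⟩
    -- the first multiple of `s` from the position of `i` on is a grid position
    by_contra hle
    have h1 := Nat.div_add_mod (π.symm i + (s - 1)) s
    have h2 := Nat.mod_lt (π.symm i + (s - 1)) hs
    have h3 : s * ((π.symm i + (s - 1)) / s) < u := by omega
    have h4 := humin ⟨s * ((π.symm i + (s - 1)) / s), h3.trans u.2⟩
      ⟨.inr (.inr ⟨_, rfl⟩), hi.2.2.1.trans (by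
        rw [← Data.yAt_symm (π := π) i]
        refine hπ ?_
        rw [Fin.le_def]; dsimp only; omega)⟩
    rw [Fin.le_def] at h4
    dsimp only at h4
    omega
  have c2 : (A.filter fun i => D.yAt π v < (D.pt i).2).card ≤ s - 1 := by
    refine (card_le_of_window (π := π) (x := v + 1) (y := v + s) fun i hi => ?_).trans (by omega)
    rw [Finset.mem_filter, hA, Data.mem_box] at hi
    obtain ⟨hi, hlt⟩ := hi
    rw [← Data.yAt_symm (π := π) i] at hlt
    have hq : v < π.symm i := lt_of_yAt_lt hπ hlt
    refine ⟨hq, lt_add_of_no_grid (n := n) (κ := κ) hs fun g hg1 hg2 hg => ?_⟩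
    have h4 := hvmax ⟨g, hg2.trans_lt (π.symm i).2⟩ ⟨hg, le_trans (by
      rw [← Data.yAt_symm (π := π) i]
      exact hπ hg2) hi.2.2.2.1⟩
    rw [Fin.le_def] at h4
    dsimp only at h4
    omega
  have k1 := Finset.card_le_card hsub
  have k2 := Finset.card_union_le A' ((A.filter fun i => (D.pt i).2 < D.yAt π u) ∪
      (A.filter fun i => D.yAt π v < (D.pt i).2))
  have k3 := Finset.card_union_le (A.filter fun i => (D.pt i).2 < D.yAt π u)
      (A.filter fun i => D.yAt π v < (D.pt i).2)
  omega

/-- If more than `n - κ` points have the same ordinate, then every ordinate is the one of a grid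
position. -/
theorem exists_grid_of_heavy (hπ : Monotone (D.yAt π)) {S : Finset (Fin n)} {g : Fin n}
    (hg : Grid n κ s g) (hS : ∀ i ∈ S, (D.pt i).2 = D.yAt π g) (hcard : n < S.card + κ)
    (q : Fin n) : ∃ r : Fin n, Grid n κ s r ∧ D.yAt π r = D.yAt π q := by
  rcases lt_trichotomy (D.yAt π q) (D.yAt π g) with h | h | h
  · refine ⟨q, .inl ?_, rfl⟩
    have : S.card ≤ n - (q + 1) := card_le_of_window (π := π) fun i hi => ⟨by
      by_contra hle
      have h1 : π.symm i ≤ q := by rw [Fin.le_def]; omega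
      have := hπ h1
      rw [Data.yAt_symm, hS i hi] at this
      linarith, (π.symm i).2⟩
    have := q.2
    omega
  · exact ⟨g, hg, h.symm⟩
  · refine ⟨q, .inr (.inl ?_), rfl⟩
    have : S.card ≤ q - 0 := card_le_of_window (π := π) fun i hi => ⟨Nat.zero_le _, by
      by_contra hle
      have h1 : q ≤ π.symm i := by rw [Fin.le_def]; omega
      have := hπ h1
      rw [Data.yAt_symm, hS i hi] at this
      linarith⟩
    omega

/-- If there is a supported box at all, then there is one whose ordinates are at grid positions.
Otherwise, enlarging a box upwards from grid position to grid position leads from fewer than `κ`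
to more than `n - κ` points in one step, which requires a single ordinate with more than `n - κ`
points. -/
theorem exists_supported_grid_box (h : D.Within lo hi) (hC : 0 < C)
    (hκC : C * hi ≤ κ * lo) (hπ : Monotone (D.yAt π)) (hκ : 1 ≤ κ) (hκs : κ ≤ s)
    (hsn : 4 * s ≤ n) {τ x₁ x₂ y₁ y₂ : ℝ} (hA : D.Supported C (D.box t τ x₁ x₂ y₁ y₂)) :
    ∃ u v : Fin n, Grid n κ s u ∧ Grid n κ s v ∧
      D.Supported C (D.box t τ x₁ x₂ (D.yAt π u) (D.yAt π v)) := by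
  classical
  by_contra! hno
  have hn : 0 < n := by omega
  have hdich : ∀ u v : Fin n, Grid n κ s u → Grid n κ s v →
      (D.box t τ x₁ x₂ (D.yAt π u) (D.yAt π v)).card < κ ∨
        n < (D.box t τ x₁ x₂ (D.yAt π u) (D.yAt π v)).card + κ := by
    intro u v hu hv
    by_contra! hcon
    exact hno u v hu hv (h.supported hn hκC hcon.1 hcon.2)
  set z : Fin n := ⟨0, hn⟩ with hz
  set w : Fin n := ⟨n - 1, by omega⟩ with hw
  have hzg : Grid n κ s z := .inl (by rw [hz]; dsimp only; omega)
  have hwg : Grid n κ s w := .inr (.inl (by rw [hw]; dsimp only; omega))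
  have hzle : ∀ i, D.yAt π z ≤ (D.pt i).2 := fun i => by
    rw [← Data.yAt_symm (π := π) i]
    exact hπ (by rw [Fin.le_def, hz]; dsimp only; omega)
  have hlew : ∀ i, (D.pt i).2 ≤ D.yAt π w := fun i => by
    rw [← Data.yAt_symm (π := π) i]
    exact hπ (by rw [Fin.le_def, hw]; dsimp only; omega)
  have hslab : n < (D.box t τ x₁ x₂ (D.yAt π z) (D.yAt π w)).card + κ := by
    by_contra hle
    refine hno z w hzg hwg (h.supported_of_superset hn hκC hA (fun i hi => ?_) (not_lt.1 hle))
    rw [Data.mem_box] at hi ⊢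
    exact ⟨hi.1, hi.2.1, hzle i, hlew i, hi.2.2.2.2⟩
  obtain ⟨q, hq, hqmin⟩ := Finset.exists_min_image (Finset.univ.filter fun q : Fin n =>
    Grid n κ s q ∧ n < (D.box t τ x₁ x₂ (D.yAt π z) (D.yAt π q)).card + κ) id
    ⟨w, by simpa using ⟨hwg, hslab⟩⟩
  simp only [Finset.mem_filter, Finset.mem_univ, true_and, id_eq] at hq hqmin
  obtain ⟨hqg, hqc⟩ := hq
  have hheavy : n < (D.box t τ x₁ x₂ (D.yAt π q) (D.yAt π q)).card + κ := by
    rcases eq_or_ne q z with rfl | hqz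
    · exact hqc
    have hzq : z < q := by
      rw [Fin.lt_def, hz]
      have : (q : ℕ) ≠ 0 := fun h0 => hqz (Fin.ext h0)
      dsimp only; omega
    obtain ⟨r, hr, hrmax⟩ := Finset.exists_max_image (Finset.univ.filter fun r : Fin n =>
      Grid n κ s r ∧ r < q) id ⟨z, by simpa using ⟨hzg, hzq⟩⟩
    simp only [Finset.mem_filter, Finset.mem_univ, true_and, id_eq] at hr hrmax
    have hrc : (D.box t τ x₁ x₂ (D.yAt π z) (D.yAt π r)).card < κ := by
      refine (hdich z r hzg hr.1).resolve_right fun hbig => ?_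
      exact absurd (hqmin r ⟨hr.1, hbig⟩) (not_le.2 hr.2)
    set S := D.box t τ x₁ x₂ (D.yAt π z) (D.yAt π q) with hS
    have hsub : S ⊆ D.box t τ x₁ x₂ (D.yAt π z) (D.yAt π r) ∪
        (D.box t τ x₁ x₂ (D.yAt π q) (D.yAt π q) ∪
          (S.filter fun i => D.yAt π r < (D.pt i).2 ∧ (D.pt i).2 < D.yAt π q)) := by
      intro i hi
      simp only [Finset.mem_union, Finset.mem_filter]
      have hi' := hi
      rw [hS, Data.mem_box] at hi'
      obtain ⟨h1, h2, h3, h4, h5⟩ := hi'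
      rcases le_or_gt (D.pt i).2 (D.yAt π r) with h6 | h6
      · exact .inl (Data.mem_box.2 ⟨h1, h2, h3, h6, h5⟩)
      rcases h4.eq_or_lt with h7 | h7
      · exact .inr (.inl (Data.mem_box.2 ⟨h1, h2, h7.ge, h7.le, h5⟩))
      · exact .inr (.inr ⟨hi, h6, h7⟩)
    have hmid : (S.filter fun i => D.yAt π r < (D.pt i).2 ∧
        (D.pt i).2 < D.yAt π q).card ≤ s - 1 := by
      refine (card_le_of_window (π := π) (x := r + 1) (y := r + s) fun i hi => ?_).trans
        (by omega)
      rw [Finset.mem_filter, ← Data.yAt_symm (π := π) i] at hi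
      have h1 : r < π.symm i := lt_of_yAt_lt hπ hi.2.1
      have h2 : π.symm i < q := lt_of_yAt_lt hπ hi.2.2
      refine ⟨h1, lt_add_of_no_grid (n := n) (κ := κ) (by omega) fun g hg1 hg2 hg => ?_⟩
      have h3 := hrmax ⟨g, hg2.trans_lt (π.symm i).2⟩ ⟨hg, lt_of_le_of_lt hg2 h2⟩
      rw [Fin.le_def] at h3
      dsimp only at h3
      omega
    have k1 := Finset.card_le_card hsub
    have k2 := Finset.card_union_le (D.box t τ x₁ x₂ (D.yAt π z) (D.yAt π r))
      (D.box t τ x₁ x₂ (D.yAt π q) (D.yAt π q) ∪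
          (S.filter fun i => D.yAt π r < (D.pt i).2 ∧ (D.pt i).2 < D.yAt π q))
    have k3 := Finset.card_union_le (D.box t τ x₁ x₂ (D.yAt π q) (D.yAt π q))
      (S.filter fun i => D.yAt π r < (D.pt i).2 ∧ (D.pt i).2 < D.yAt π q)
    have k4 := hdich q q hqg hqg
    omega
  have hgrid := exists_grid_of_heavy (κ := κ) (s := s) hπ hqg (S :=
    D.box t τ x₁ x₂ (D.yAt π q) (D.yAt π q)) (fun i hi => by
      rw [Data.mem_box] at hi
      exact le_antisymm hi.2.2.2.1 hi.2.2.1) hheavy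
  obtain ⟨i₁, hi₁, hmin⟩ := Finset.exists_min_image _ (fun i => (D.pt i).2)
    (h.nonempty_of_supported hn hC hA)
  obtain ⟨i₂, hi₂, hmax⟩ := Finset.exists_max_image _ (fun i => (D.pt i).2)
    (h.nonempty_of_supported hn hC hA)
  obtain ⟨u, hu, hu'⟩ := hgrid (π.symm i₁)
  obtain ⟨v, hv, hv'⟩ := hgrid (π.symm i₂)
  rw [Data.yAt_symm] at hu' hv'
  refine hno u v hu hv ?_
  have : D.box t τ x₁ x₂ (D.yAt π u) (D.yAt π v) = D.box t τ x₁ x₂ y₁ y₂ := by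
    ext i
    constructor
    · intro hi
      rw [Data.mem_box] at hi hi₁ hi₂ ⊢
      rw [hu', hv'] at hi
      exact ⟨hi.1, hi.2.1, hi₁.2.2.1.trans hi.2.2.1, hi.2.2.2.1.trans hi₂.2.2.2.1, hi.2.2.2.2⟩
    · intro hi
      have h1 := hmin i hi
      have h2 := hmax i hi
      rw [Data.mem_box] at hi ⊢
      rw [hu', hv']
      exact ⟨hi.1, hi.2.1, h1, h2, hi.2.2.2.2⟩
  rwa [this]

/-- A strip between grid positions either leaves at least `κ` points outside, or it can be
described by one of the first and one of the last `κ` positions. -/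
theorem exists_normalized (hπ : Monotone (D.yAt π)) (π' : Equiv.Perm (Fin n)) (τ : ℝ)
    (u v : Fin n) :
    (D.strip t π' τ (D.yAt π u) (D.yAt π v)).length + κ ≤ n ∨
      ∃ u' v' : Fin n, (u' : ℕ) < κ ∧ n ≤ v' + κ ∧ D.yAt π u' = D.yAt π u ∧
        D.yAt π v' = D.yAt π v := by
  classical
  by_contra! hcon
  obtain ⟨hlen, hno⟩ := hcon
  obtain ⟨u', hu', humin⟩ := Finset.exists_min_image
    (Finset.univ.filter fun q : Fin n => D.yAt π q = D.yAt π u) id ⟨u, by simp⟩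
  obtain ⟨v', hv', hvmax⟩ := Finset.exists_max_image
    (Finset.univ.filter fun q : Fin n => D.yAt π q = D.yAt π v) id ⟨v, by simp⟩
  simp only [Finset.mem_filter, Finset.mem_univ, true_and, id_eq] at hu' hv' humin hvmax
  have hcard : (D.strip t π' τ (D.yAt π u) (D.yAt π v)).length ≤ v' + 1 - u' := by
    rw [← List.toFinset_card_of_nodup (D.nodup_strip t π' τ _ _)]
    refine card_le_of_window (π := π) fun i hi => ?_
    rw [List.mem_toFinset, Data.mem_strip, ← Data.yAt_symm (π := π) i] at hi
    constructor
    · by_contra hlt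
      have h1 : π.symm i < u' := by rw [Fin.lt_def]; omega
      have h2 := hπ h1.le
      rw [hu'] at h2
      exact absurd (humin _ (le_antisymm h2 hi.2.1)) (not_le.2 h1)
    · by_contra hlt
      have h1 : v' < π.symm i := by rw [Fin.lt_def]; omega
      have h2 := hπ h1.le
      rw [hv'] at h2
      exact absurd (hvmax _ (le_antisymm hi.2.2 h2)) (not_le.2 h1)
  have h1 := u'.2
  have h2 := v'.2
  exact hno u' v' (by omega) (by omega) hu' hv'

/-- It suffices to consider boxes whose ordinates are at grid positions. -/
theorem exists_grid_box (h : D.Within lo hi) (hn : 0 < n) (hC : 0 < C) (hc : 0 ≤ c)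
    (hκC : C * hi ≤ κ * lo) (hκ : 1 ≤ κ) (hπ : Monotone (D.yAt π)) {ε : ℝ} (hε : 0 ≤ ε)
    (hs : s = 1 ∨ κ ≤ s ∧ 4 * s ≤ n ∧ 24 * c * ((hi / lo) ^ 2) ^ 3 * s ≤ ε * n)
    (π' : Equiv.Perm (Fin n)) {τ x₁ x₂ y₁ y₂ : ℝ}
    (hA : D.Supported C (D.box t τ x₁ x₂ y₁ y₂)) :
    ∃ u v : Fin n, ((Grid n κ s u ∧ Grid n κ s v ∧
          (D.strip t π' τ (D.yAt π u) (D.yAt π v)).length + κ ≤ n) ∨ ((u : ℕ) < κ ∧ n ≤ v + κ)) ∧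
      D.Supported C (D.box t τ x₁ x₂ (D.yAt π u) (D.yAt π v)) ∧
      D.disc c (D.box t τ x₁ x₂ y₁ y₂) ≤
        D.disc c (D.box t τ x₁ x₂ (D.yAt π u) (D.yAt π v)) + ε / 2 := by
  have hn' : (0 : ℝ) < n := by exact_mod_cast hn
  have hs0 : 0 < s := by omega
  -- the normalization of the boundaries does not change the box
  suffices H : ∃ u v : Fin n, (Grid n κ s u ∧ Grid n κ s v) ∧
      D.Supported C (D.box t τ x₁ x₂ (D.yAt π u) (D.yAt π v)) ∧
      D.disc c (D.box t τ x₁ x₂ y₁ y₂) ≤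
        D.disc c (D.box t τ x₁ x₂ (D.yAt π u) (D.yAt π v)) + ε / 2 by
    obtain ⟨u, v, hg, h1, h2⟩ := H
    rcases exists_normalized (t := t) (κ := κ) hπ π' τ u v with hlen | ⟨u', v', hu, hv, hu', hv'⟩
    · exact ⟨u, v, .inl ⟨hg.1, hg.2, hlen⟩, h1, h2⟩
    · refine ⟨u', v', .inr ⟨hu, hv⟩, ?_, ?_⟩ <;> rw [hu', hv'] <;> assumption
  obtain ⟨u, v, hu, hv, hsub, hcard⟩ := exists_rounding (t := t) (κ := κ) (s := s) hπ hs0 hκ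
    (h.nonempty_of_supported hn hC hA)
  have hΛ : 0 ≤ 4 * c * ((hi / lo) ^ 2) ^ 3 := by positivity
  by_cases hsup : D.Supported C (D.box t τ x₁ x₂ (D.yAt π u) (D.yAt π v))
  · refine ⟨u, v, ⟨hu, hv⟩, hsup, (h.disc_le_of_subset hn hC hc hA hsub hcard).trans ?_⟩
    refine add_le_add le_rfl ?_
    rcases hs with rfl | ⟨-, -, hs⟩
    · simpa using div_nonneg hε zero_le_two
    · rw [div_le_iff₀ hn']
      have : ((2 * (s - 1) : ℕ) : ℝ) ≤ 2 * s := by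
        exact_mod_cast (by omega : 2 * (s - 1) ≤ 2 * s)
      calc 4 * c * ((hi / lo) ^ 2) ^ 3 * ((2 * (s - 1) : ℕ) : ℝ)
          ≤ 4 * c * ((hi / lo) ^ 2) ^ 3 * (2 * s) := by gcongr
        _ ≤ ε / 2 * n := by
          have : 0 ≤ 4 * c * ((hi / lo) ^ 2) ^ 3 * s := by positivity
          linarith
  · have hlt : (D.box t τ x₁ x₂ (D.yAt π u) (D.yAt π v)).card < κ := by
      by_contra hle
      exact hsup (h.supported_of_subset hn hκC hA hsub (not_lt.1 hle))
    rcases hs with rfl | ⟨hκs, hsn, hs⟩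
    · -- nothing was lost
      have := Finset.eq_of_subset_of_card_le hsub (by simpa using hcard)
      exact absurd (this ▸ hA) hsup
    · obtain ⟨u', v', hu', hv', hsup'⟩ := exists_supported_grid_box (t := t) h hC hκC hπ hκ hκs
        hsn hA
      refine ⟨u', v', ⟨hu', hv'⟩, hsup', ?_⟩
      have h1 := h.disc_le_of_subset (d := 3 * s) hn hC hc hA (Finset.empty_subset _)
        (by rw [Finset.card_empty]; omega)
      have h2 : D.disc c ∅ = 0 := by simp [Data.disc, kulldorff, share]
      have h3 : 0 ≤ D.disc c (D.box t τ x₁ x₂ (D.yAt π u') (D.yAt π v')) :=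
        kulldorff_nonneg hc (h.admissible hn _)
      have h4 : 4 * c * ((hi / lo) ^ 2) ^ 3 * ((3 * s : ℕ) : ℝ) / n ≤ ε / 2 := by
        rw [div_le_iff₀ hn']
        push_cast
        linarith
      linarith

end Rounding

end Scan

/-! ### The memory of the algorithm

Every scalar variable is cell 0 of an array of its own. -/

-- Arrays of natural numbers: the number of points, loop variables, and the sorted orders.
notation "aN" => (0 : ℕ)
notation "aI" => (1 : ℕ)
notation "aJ" => (2 : ℕ)
notation "aRank" => (3 : ℕ)
notation "aOrdX" => (4 : ℕ)
notation "aOrdY" => (5 : ℕ)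
-- The threshold `κ`, the number of levels, the number of directions on level 0, the size of the
-- tables, the spacing of the grid, and the number of grid ordinates.
notation "aKappa" => (6 : ℕ)
notation "aLev" => (7 : ℕ)
notation "aDirs" => (8 : ℕ)
notation "aSize" => (9 : ℕ)
notation "aStep" => (10 : ℕ)
notation "aGrid" => (11 : ℕ)
-- The current strip: the width of the exhaustive search, the number of points, their indices.
notation "aWidth" => (12 : ℕ)
notation "aLen" => (13 : ℕ)
notation "aId" => (14 : ℕ)
notation "aQ" => (15 : ℕ)
notation "aBi" => (16 : ℕ)
notation "aBj" => (17 : ℕ)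
-- The candidate pair, and whether a supported region has been found.
notation "aFrom" => (18 : ℕ)
notation "aTo" => (19 : ℕ)
notation "aFound" => (20 : ℕ)
-- The divide and conquer scheme: loop variables, the place of the current level in the tables,
-- its number of directions, its number, and the tables of maxima and of minima.
notation "aZ" => (21 : ℕ)
notation "aDir" => (22 : ℕ)
notation "aOff" => (23 : ℕ)
notation "aCur" => (24 : ℕ)
notation "aL" => (25 : ℕ)
notation "aMax" => (26 : ℕ)
notation "aMin" => (27 : ℕ)
notation "aGa" => (28 : ℕ)
notation "aGb" => (29 : ℕ)
notation "aTime" => (30 : ℕ)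
notation "aBlock" => (31 : ℕ)

-- Arrays of real numbers: input and output.
notation "rIn" => (0 : ℕ)
notation "rX" => (1 : ℕ)
notation "rY" => (2 : ℕ)
notation "rM" => (3 : ℕ)
notation "rB" => (4 : ℕ)
notation "rT" => (5 : ℕ)
notation "rOut" => (6 : ℕ)
-- The total weights, their bounds, the accuracy, the squared ratio of the bounds, and the
-- grid ordinates.
notation "rMTot" => (7 : ℕ)
notation "rBTot" => (8 : ℕ)
notation "rLo" => (9 : ℕ)
notation "rHi" => (10 : ℕ)
notation "rEps" => (11 : ℕ)
notation "rRatio" => (12 : ℕ)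
notation "rGY" => (13 : ℕ)
-- The current strip, its prefix sums, and the shares and the discrepancy of a candidate.
notation "rTau" => (14 : ℕ)
notation "rY₁" => (15 : ℕ)
notation "rY₂" => (16 : ℕ)
notation "rPreM" => (17 : ℕ)
notation "rPreB" => (18 : ℕ)
notation "rXm" => (19 : ℕ)
notation "rXb" => (20 : ℕ)
notation "rVal" => (21 : ℕ)

namespace Scan

open RealRAM

/-- The data of the problem, and the values that are computed from them before the search. -/
structure Setting (n : ℕ) where
  D : Data n
  t : Fin n → ℝ
  C : ℝ
  c : ℝ
  /-- The squared ratio of the bounds for the weights. -/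
  L : ℝ
  /-- The number of directions on level 0. -/
  F₀ : ℕ
  /-- The number of levels. -/
  lev : ℕ
  /-- The order by abscissas. -/
  π : Equiv.Perm (Fin n)

variable {n : ℕ}

/-- The memory holds the data of the problem and the values computed from them. -/
structure Setting.InMem (S : Setting n) (s : State) : Prop where
  num : s.nat aN 0 = n
  ord : ∀ q : Fin n, s.nat aOrdX q = S.π q
  dirs : s.nat aDirs 0 = S.F₀
  lev : s.nat aLev 0 = S.lev
  size : s.nat aSize 0 = S.F₀ * 2 ^ S.lev
  x : ∀ i : Fin n, s.real rX i = (S.D.pt i).1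
  y : ∀ i : Fin n, s.real rY i = (S.D.pt i).2
  m : ∀ i : Fin n, s.real rM i = S.D.m i
  b : ∀ i : Fin n, s.real rB i = S.D.b i
  t : ∀ i : Fin n, s.real rT i = S.t i
  C : s.real rIn 1 = S.C
  c : s.real rIn 2 = S.c
  mTot : s.real rMTot 0 = ∑ i, S.D.m i
  bTot : s.real rBTot 0 = ∑ i, S.D.b i
  ratio : s.real rRatio 0 = S.L

theorem Setting.InMem.congr {S : Setting n} {s s' : State} (h : S.InMem s)
    (hn : s'.nat aN = s.nat aN) (h4 : s'.nat aOrdX = s.nat aOrdX)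
    (h8 : s'.nat aDirs = s.nat aDirs) (h7 : s'.nat aLev = s.nat aLev)
    (h9 : s'.nat aSize = s.nat aSize) (r0 : s'.real rIn = s.real rIn)
    (r1 : s'.real rX = s.real rX) (r2 : s'.real rY = s.real rY) (r3 : s'.real rM = s.real rM)
    (r4 : s'.real rB = s.real rB) (r5 : s'.real rT = s.real rT)
    (r7 : s'.real rMTot = s.real rMTot) (r8 : s'.real rBTot = s.real rBTot)
    (r12 : s'.real rRatio = s.real rRatio) : S.InMem s' := by
  constructor
  · rw [hn]; exact h.num
  · rw [h4]; exact h.ord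
  · rw [h8]; exact h.dirs
  · rw [h7]; exact h.lev
  · rw [h9]; exact h.size
  · rw [r1]; exact h.x
  · rw [r2]; exact h.y
  · rw [r3]; exact h.m
  · rw [r4]; exact h.b
  · rw [r5]; exact h.t
  · rw [r0]; exact h.C
  · rw [r0]; exact h.c
  · rw [r7]; exact h.mTot
  · rw [r8]; exact h.bTot
  · rw [r12]; exact h.ratio

/-- A program that assigns to none of the arrays of `Setting.InMem`. -/
def Prog.safe (p : Prog) : Bool :=
  !(p.writesNat aN || p.writesNat aOrdX || p.writesNat aDirs || p.writesNat aLev ||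
    p.writesNat aSize || p.writesReal rIn || p.writesReal rX || p.writesReal rY ||
    p.writesReal rM || p.writesReal rB || p.writesReal rT || p.writesReal rMTot ||
    p.writesReal rBTot || p.writesReal rRatio)

theorem Setting.InMem.keeps {S : Setting n} {s s' : State} {p : Prog} (h : S.InMem s)
    (hk : Keeps p s s') (hp : Prog.safe p = true) : S.InMem s' := by
  simp only [Prog.safe, Bool.not_eq_true', Bool.or_eq_false_iff] at hp
  obtain ⟨⟨⟨⟨⟨⟨⟨⟨⟨⟨⟨⟨⟨a1, a2⟩, a3⟩, a4⟩, a5⟩, b1⟩, b2⟩, b3⟩, b4⟩, b5⟩, b6⟩, b7⟩, b8⟩, b9⟩ := hp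
  exact h.congr (hk.nat _ a1) (hk.nat _ a2) (hk.nat _ a3) (hk.nat _ a4) (hk.nat _ a5)
    (hk.real _ b1) (hk.real _ b2) (hk.real _ b3) (hk.real _ b4) (hk.real _ b5) (hk.real _ b6)
    (hk.real _ b7) (hk.real _ b8) (hk.real _ b9)

/-- The memory holds a strip: its bounds, its points `l` in the order of their abscissas, and
the prefix sums of their weights. -/
structure Setting.StripInMem (S : Setting n) (τ y₁ y₂ : ℝ) (l : List (Fin n)) (s : State) :
    Prop where
  len : s.nat aLen 0 = l.length
  id : ∀ p, ∀ h : p < l.length, s.nat aId p = (l[p] : Fin n)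
  preM : ∀ p ≤ l.length, s.real rPreM p = pre S.D.m l p
  preB : ∀ p ≤ l.length, s.real rPreB p = pre S.D.b l p
  tau : s.real rTau 0 = τ
  y₁ : s.real rY₁ 0 = y₁
  y₂ : s.real rY₂ 0 = y₂

theorem Setting.StripInMem.congr {S : Setting n} {τ y₁ y₂ : ℝ} {l : List (Fin n)} {s s' : State}
    (h : S.StripInMem τ y₁ y₂ l s) (h1 : s'.nat aLen = s.nat aLen) (h2 : s'.nat aId = s.nat aId)
    (r1 : s'.real rPreM = s.real rPreM) (r2 : s'.real rPreB = s.real rPreB)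
    (r3 : s'.real rTau = s.real rTau) (r4 : s'.real rY₁ = s.real rY₁)
    (r5 : s'.real rY₂ = s.real rY₂) : S.StripInMem τ y₁ y₂ l s' := by
  constructor
  · rw [h1]; exact h.len
  · rw [h2]; exact h.id
  · rw [r1]; exact h.preM
  · rw [r2]; exact h.preB
  · rw [r3]; exact h.tau
  · rw [r4]; exact h.y₁
  · rw [r5]; exact h.y₂

/-- A program that assigns to none of the arrays of `Setting.StripInMem`. -/
def Prog.stripSafe (p : Prog) : Bool :=
  !(p.writesNat aLen || p.writesNat aId || p.writesReal rPreM || p.writesReal rPreB ||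
    p.writesReal rTau || p.writesReal rY₁ || p.writesReal rY₂)

theorem Setting.StripInMem.keeps {S : Setting n} {τ y₁ y₂ : ℝ} {l : List (Fin n)} {s s' : State}
    {p : Prog} (h : S.StripInMem τ y₁ y₂ l s) (hk : Keeps p s s')
    (hp : Prog.stripSafe p = true) : S.StripInMem τ y₁ y₂ l s' := by
  simp only [Prog.stripSafe, Bool.not_eq_true', Bool.or_eq_false_iff] at hp
  obtain ⟨⟨⟨⟨⟨⟨a1, a2⟩, b1⟩, b2⟩, b3⟩, b4⟩, b5⟩ := hp
  exact h.congr (hk.nat _ a1) (hk.nat _ a2) (hk.real _ b1) (hk.real _ b2) (hk.real _ b3)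
    (hk.real _ b4) (hk.real _ b5)

/-! ### The best region found so far -/

/-- If a region has been found, then the output cells hold a supported region and its
discrepancy. -/
def Setting.Sound (S : Setting n) (s : State) : Prop :=
  s.nat aFound 0 ≠ 0 → ∃ R : Rect, OutputsRect s R ∧
    S.D.Supported S.C (S.D.insideSince S.t R (outputTime s)) ∧
    outputValue s = S.D.disc S.c (S.D.insideSince S.t R (outputTime s))

/-- A region of discrepancy at least `v` has been found. -/
def Beats (s : State) (v : ℝ) : Prop := s.nat aFound 0 ≠ 0 ∧ v ≤ s.real rOut 4

/-- The best region found so far is replaced by better ones only. -/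
structure Setting.Improves (S : Setting n) (s s' : State) : Prop where
  sound : S.Sound s → S.Sound s'
  beats : ∀ v, Beats s v → Beats s' v

theorem Setting.Improves.trans {S : Setting n} {s s' s'' : State} (h : S.Improves s s')
    (h' : S.Improves s' s'') : S.Improves s s'' :=
  ⟨fun hs => h'.sound (h.sound hs), fun v hv => h'.beats v (h.beats v hv)⟩

theorem Setting.Improves.of_eq (S : Setting n) {s s' : State} (h1 : s'.nat aFound = s.nat aFound)
    (h2 : s'.real rOut = s.real rOut) : S.Improves s s' := by
  constructor
  · unfold Setting.Sound OutputsRect outputTime outputValue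
    rw [h1, h2]; exact id
  · unfold Beats
    rw [h1, h2]; exact fun _ => id

theorem Setting.Improves.of_keeps (S : Setting n) {s s' : State} {p : Prog} (h : Keeps p s s')
    (h1 : p.writesNat aFound = false) (h2 : p.writesReal rOut = false) : S.Improves s s' :=
  .of_eq S (h.nat _ h1) (h.real _ h2)

/-! ### Trying a candidate -/

/-- The test whether the position `p` is a cut. -/
def cutTest (p : NExp) : Test :=
  .and (.natLe p (nv aLen))
    (.not (.and (.and (.not (.natLe p (.lit 0))) (.not (.natLe (nv aLen) p)))
      (.realLe (.get rX (.get aId p)) (.get rX (.get aId (.sub p (.lit 1)))))))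

/-- `C / n`. -/
def supportLevel : RExp := .div (.get rIn (.lit 1)) (.ofNat (nv aN))

/-- The real number `1`. -/
def one : RExp := .ofNat (.lit 1)

/-- The test `C / n ≤ x ≤ 1 - C / n`. -/
def levelTest (x : RExp) : Test :=
  .and (.realLe supportLevel x) (.realLe x (.sub one supportLevel))

/-- The share of the points from the position `aFrom` up to the position `aTo`. -/
def shareExp (preArr tot : ℕ) : RExp :=
  .sub (.div (.get preArr (nv aTo)) (rv tot)) (.div (.get preArr (nv aFrom)) (rv tot))

/-- The Kulldorff statistic. -/
def kulldorffExp (x y : RExp) : RExp :=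
  .mul (.get rIn (.lit 2)) (.add (.mul x (.log (.div x y)))
    (.mul (.sub one x) (.log (.div (.sub one x) (.sub one y)))))

/-- Makes the candidate the best region. -/
def recordProg : Prog :=
  setN aFound (.lit 1) ;;
  .setReal rOut (.lit 0) (.get rX (.get aId (nv aFrom))) ;;
  .setReal rOut (.lit 1) (.get rX (.get aId (.sub (nv aTo) (.lit 1)))) ;;
  .setReal rOut (.lit 2) (rv rY₁) ;;
  .setReal rOut (.lit 3) (rv rY₂) ;;
  .setReal rOut (.lit 4) (rv rVal) ;;
  .setReal rOut (.lit 5) (rv rTau)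

/-- Compares the part of the strip between the positions `aFrom` and `aTo` with the best region
found so far, provided that the positions are cuts and that there is enough support. -/
def tryProg : Prog :=
  .ite (.and (natLt (nv aFrom) (nv aTo)) (.and (cutTest (nv aFrom)) (cutTest (nv aTo))))
    (setR rXm (shareExp rPreM rMTot) ;;
      setR rXb (shareExp rPreB rBTot) ;;
      .ite (.and (levelTest (rv rXm)) (levelTest (rv rXb)))
        (setR rVal (kulldorffExp (rv rXm) (rv rXb)) ;;
          .ite (.and (.natLe (.lit 1) (nv aFound)) (.realLe (rv rVal) (.get rOut (.lit 4))))
            .skip recordProg)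
        .skip)
    .skip

/-- The memory in which candidates are tried: the strip is the one between the ordinates `y₁` and
`y₂`. -/
structure Setting.Ready (S : Setting n) (τ y₁ y₂ : ℝ) (s : State) : Prop where
  mem : S.InMem s
  strip : S.StripInMem τ y₁ y₂ (S.D.strip S.t S.π τ y₁ y₂) s

theorem Setting.Ready.keeps {S : Setting n} {τ y₁ y₂ : ℝ} {s s' : State} {p : Prog}
    (h : S.Ready τ y₁ y₂ s) (hk : Keeps p s s') (hp : Prog.safe p = true)
    (hp' : Prog.stripSafe p = true) : S.Ready τ y₁ y₂ s' :=
  ⟨h.mem.keeps hk hp, h.strip.keeps hk hp'⟩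

theorem cutTest_holds {S : Setting n} {τ y₁ y₂ : ℝ} {l : List (Fin n)} {s : State}
    (h : S.InMem s) (hs : S.StripInMem τ y₁ y₂ l s) (e : NExp) :
    (cutTest e).Holds s ↔ S.D.IsCut l (e.eval s) := by
  unfold cutTest Data.IsCut
  simp only [Test.Holds, NExp.eval, RExp.eval, hs.len]
  refine and_congr_right fun h1 => not_congr (and_congr_right fun ⟨h2, h3⟩ => ?_)
  rw [hs.id _ (by omega), hs.id _ (by omega), h.x, h.x, Data.xAt_eq _ (by omega),
    Data.xAt_eq _ (by omega)]

theorem try_spec {S : Setting n} (hπ : Monotone ((fun i => (S.D.pt i).1) ∘ S.π)) {τ y₁ y₂ : ℝ}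
    {s : State} (h : S.Ready τ y₁ y₂ s) :
    Runs tryProg s tryProg.time fun s' => S.Improves s s' ∧
      (s.nat aFrom 0 < s.nat aTo 0 → S.D.IsCut (S.D.strip S.t S.π τ y₁ y₂) (s.nat aFrom 0) →
        S.D.IsCut (S.D.strip S.t S.π τ y₁ y₂) (s.nat aTo 0) →
        S.D.Supported S.C (seg (S.D.strip S.t S.π τ y₁ y₂) (s.nat aFrom 0) (s.nat aTo 0)) →
        Beats s' (S.D.disc S.c (seg (S.D.strip S.t S.π τ y₁ y₂) (s.nat aFrom 0)
          (s.nat aTo 0)))) := by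
  refine Runs.of_run rfl ?_
  have hnod := S.D.nodup_strip S.t S.π τ y₁ y₂
  have hbox := S.D.box_eq_seg (t := S.t) hπ (τ := τ) (y₁ := y₁) (y₂ := y₂)
    (i := s.nat aFrom 0) (j := s.nat aTo 0)
  have hmemb := fun a => S.D.mem_strip (t := S.t) (π := S.π) (τ := τ) (y₁ := y₁) (y₂ := y₂)
    (i := a)
  have hstrip := h.strip
  set l := S.D.strip S.t S.π τ y₁ y₂
  have hcut := cutTest_holds h.mem hstrip
  set i := s.nat aFrom 0 with hi
  set j := s.nat aTo 0 with hj
  have htest : (Test.and (natLt (nv aFrom) (nv aTo)) (.and (cutTest (nv aFrom))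
      (cutTest (nv aTo)))).Holds s ↔ i < j ∧ S.D.IsCut l i ∧ S.D.IsCut l j := by
    simp only [Test.Holds, hcut]
    rfl
  by_cases hc : i < j ∧ S.D.IsCut l i ∧ S.D.IsCut l j
  swap
  · have : tryProg.run s = s := by
      unfold tryProg
      rw [Prog.run, if_neg]
      · rfl
      · rwa [htest]
    rw [this]
    exact ⟨.of_eq S rfl rfl, fun h1 h2 h3 => absurd ⟨h1, h2, h3⟩ hc⟩
  obtain ⟨hij, hci, hcj⟩ := hc
  have hxm : share S.D.m (seg l i j) = s.real rPreM j / s.real rMTot 0 -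
      s.real rPreM i / s.real rMTot 0 := by
    rw [share_seg hnod _ hij.le, hstrip.preM _ hci.1, hstrip.preM _ hcj.1, h.mem.mTot]
  have hxb : share S.D.b (seg l i j) = s.real rPreB j / s.real rBTot 0 -
      s.real rPreB i / s.real rBTot 0 := by
    rw [share_seg hnod _ hij.le, hstrip.preB _ hci.1, hstrip.preB _ hcj.1, h.mem.bTot]
  have hrun : tryProg.run s = (Prog.run (.ite (.and (levelTest (rv rXm)) (levelTest (rv rXb)))
        (setR rVal (kulldorffExp (rv rXm) (rv rXb)) ;;
          .ite (.and (.natLe (.lit 1) (nv aFound)) (.realLe (rv rVal) (.get rOut (.lit 4))))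
            .skip recordProg) .skip)
      ((s.setReal rXm 0 (share S.D.m (seg l i j))).setReal rXb 0
        (share S.D.b (seg l i j)))) := by
    unfold tryProg
    rw [Prog.run, if_pos (htest.2 ⟨hij, hci, hcj⟩)]
    have e1 : (shareExp rPreM rMTot).eval s = share S.D.m (seg l i j) := by rw [hxm]; rfl
    have e2 : ∀ v, (shareExp rPreB rBTot).eval (s.setReal rXm 0 v) = share S.D.b (seg l i j) := by
      intro v
      rw [hxb]
      simp [shareExp, RExp.eval, NExp.eval, ← hi, ← hj]
    change Prog.run _ ((s.setReal rXm 0 ((shareExp rPreM rMTot).eval s)).setReal rXb 0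
      ((shareExp rPreB rBTot).eval (s.setReal rXm 0 ((shareExp rPreM rMTot).eval s)))) = _
    rw [e1, e2]
  rw [hrun]
  have hsup : (Test.and (levelTest (rv rXm)) (levelTest (rv rXb))).Holds
      ((s.setReal rXm 0 (share S.D.m (seg l i j))).setReal rXb 0
        (share S.D.b (seg l i j))) ↔ S.D.Supported S.C (seg l i j) := by
    simp [Test.Holds, levelTest, supportLevel, one, RExp.eval, NExp.eval, Data.Supported,
      h.mem.num, h.mem.C]
  rw [Prog.run]
  split_ifs with hs
  swap
  · refine ⟨.of_eq S rfl ?_, fun _ _ _ h' => absurd (hsup.2 h') hs⟩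
    simp [Prog.run]
  rw [hsup] at hs
  rw [Prog.run, Prog.run, Prog.run]
  have hval : (kulldorffExp (rv rXm) (rv rXb)).eval
      ((s.setReal rXm 0 (share S.D.m (seg l i j))).setReal rXb 0
        (share S.D.b (seg l i j))) = S.D.disc S.c (seg l i j) := by
    simp [kulldorffExp, one, RExp.eval, NExp.eval, Data.disc, kulldorff, h.mem.c]
  rw [hval]
  split_ifs with hb
  · refine ⟨.of_eq S rfl (by simp [Prog.run, NExp.eval]), fun _ _ _ _ => ?_⟩
    simp only [Test.Holds, NExp.eval, RExp.eval] at hb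
    simp at hb
    unfold Beats
    simp [Prog.run, NExp.eval]
    exact ⟨by omega, hb.2⟩
  · have hjl : j ≤ l.length := hcj.1
    have hidi := hstrip.id i (by omega)
    have hidj := hstrip.id (j - 1) (by omega)
    have hxi : s.real rX (s.nat aId i) = S.D.xAt l i := by
      rw [hidi, h.mem.x, Data.xAt_eq]
    have hxj : s.real rX (s.nat aId (j - 1)) = S.D.xAt l (j - 1) := by
      rw [hidj, h.mem.x, Data.xAt_eq]
    have hxle : S.D.xAt l i ≤ S.D.xAt l (j - 1) :=
      Data.xAt_le (S.D.sorted_strip S.t hπ τ y₁ y₂) (by omega) (by show j - 1 < l.length; omega)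
    have hyle : y₁ ≤ y₂ := by
      have := (hmemb _).1 (List.getElem_mem (l := l) (n := i) (by omega))
      exact this.2.1.trans this.2.2
    have hfound : ∀ v, Beats s v → v ≤ S.D.disc S.c (seg l i j) := by
      intro v hv
      simp only [Test.Holds, NExp.eval, RExp.eval] at hb
      simp at hb
      exact hv.2.trans (hb (Nat.one_le_iff_ne_zero.2 hv.1)).le
    have hR := S.D.insideSince_eq_box S.t ⟨_, _, _, _, hxle, hyle⟩ τ
    dsimp only at hR
    rw [hbox hij hci hcj] at hR
    refine ⟨⟨fun _ _ => ⟨⟨_, _, _, _, hxle, hyle⟩, ?_, ?_, ?_⟩, fun v hv => ⟨?_, ?_⟩⟩,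
      fun _ _ _ _ => ⟨?_, ?_⟩⟩
    · unfold OutputsRect
      simp [recordProg, Prog.run, NExp.eval, RExp.eval, ← hi, ← hj, hxi, hxj, hstrip.y₁,
        hstrip.y₂]
    · have ht : outputTime (recordProg.run (((s.setReal rXm 0 (share S.D.m (seg l i j))).setReal
          rXb 0 (share S.D.b (seg l i j))).setReal rVal (NExp.eval
          ((s.setReal rXm 0 (share S.D.m (seg l i j))).setReal rXb 0
          (share S.D.b (seg l i j))) (.lit 0)) (S.D.disc S.c (seg l i j)))) = τ := by
        unfold outputTime
        simp [recordProg, Prog.run, NExp.eval, RExp.eval, hstrip.tau]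
      rw [ht, hR]
      exact hs
    · have ht : outputTime (recordProg.run (((s.setReal rXm 0 (share S.D.m (seg l i j))).setReal
          rXb 0 (share S.D.b (seg l i j))).setReal rVal (NExp.eval
          ((s.setReal rXm 0 (share S.D.m (seg l i j))).setReal rXb 0
          (share S.D.b (seg l i j))) (.lit 0)) (S.D.disc S.c (seg l i j)))) = τ := by
        unfold outputTime
        simp [recordProg, Prog.run, NExp.eval, RExp.eval, hstrip.tau]
      rw [ht, hR]
      unfold outputValue
      simp [recordProg, Prog.run, NExp.eval, RExp.eval]
    · simp [recordProg, Prog.run, NExp.eval, RExp.eval]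
    · simpa [recordProg, Prog.run, NExp.eval, RExp.eval] using hfound v hv
    · simp [recordProg, Prog.run, NExp.eval, RExp.eval]
    · simp [recordProg, Prog.run, NExp.eval, RExp.eval]

end Scan

/-! ### Building a strip -/

namespace Scan

open RealRAM

variable {n : ℕ}

theorem pre_append_of_le (w : Fin n → ℝ) {l : List (Fin n)} (l' : List (Fin n)) {p : ℕ}
    (hp : p ≤ l.length) : pre w (l ++ l') p = pre w l p := by
  unfold pre
  rw [List.take_append_of_le_length hp]

theorem pre_append_singleton (w : Fin n → ℝ) (l : List (Fin n)) (i : Fin n) :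
    pre w (l ++ [i]) (l.length + 1) = pre w l l.length + w i := by
  unfold pre
  rw [List.take_of_length_le (by simp), List.take_length]
  simp

/-- Appends the point at the position `aQ` of the order by abscissas to the strip. -/
def appendProg : Prog :=
  .setNat aId (nv aLen) (.get aOrdX (nv aQ)) ;;
  .setReal rPreM (.add (nv aLen) (.lit 1))
    (.add (.get rPreM (nv aLen)) (.get rM (.get aOrdX (nv aQ)))) ;;
  .setReal rPreB (.add (nv aLen) (.lit 1))
    (.add (.get rPreB (nv aLen)) (.get rB (.get aOrdX (nv aQ)))) ;;
  incr aLen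

/-- The test whether the point at the position `aQ` belongs to the strip. -/
def inStripTest : Test :=
  .and (.realLe (rv rTau) (.get rT (.get aOrdX (nv aQ))))
    (.and (.realLe (rv rY₁) (.get rY (.get aOrdX (nv aQ))))
      (.realLe (.get rY (.get aOrdX (nv aQ))) (rv rY₂)))

/-- Treats one point. -/
def buildBody : Prog := .ite inStripTest appendProg .skip ;; incr aQ

/-- Collects the points of the strip in the order of their abscissas. -/
def buildProg : Prog :=
  (setN aLen (.lit 0) ;; .setReal rPreM (.lit 0) (.ofNat (.lit 0)) ;;
    .setReal rPreB (.lit 0) (.ofNat (.lit 0)) ;; setN aQ (.lit 0)) ;;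
  .loop (natLt (nv aQ) (nv aN)) buildBody

theorem append_spec {S : Setting n} {τ y₁ y₂ : ℝ} {l : List (Fin n)} {s : State} {q : Fin n}
    (h : S.InMem s) (hs : S.StripInMem τ y₁ y₂ l s) (hq : s.nat aQ 0 = q) :
    S.StripInMem τ y₁ y₂ (l ++ [S.π q]) (appendProg.run s) := by
  have ho := h.ord q
  have hm := h.m (S.π q)
  have hb := h.b (S.π q)
  have hlen := hs.len
  constructor
  · simp [appendProg, Prog.run, NExp.eval, hlen]
  · intro p hp
    rw [List.length_append, List.length_singleton] at hp
    have : (appendProg.run s).nat aId p = if p = l.length then (S.π q : ℕ) else s.nat aId p := by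
      simp [appendProg, Prog.run, NExp.eval, hlen, hq, ho]
    rw [this, List.getElem_append]
    split_ifs with h1 h2 h2
    · omega
    · simp
    · exact hs.id p h2
    · omega
  · intro p hp
    rw [List.length_append, List.length_singleton] at hp
    have : (appendProg.run s).real rPreM p = if p = l.length + 1 then
        s.real rPreM l.length + S.D.m (S.π q) else s.real rPreM p := by
      simp [appendProg, Prog.run, NExp.eval, RExp.eval, hlen, hq, ho, hm]
    rw [this]
    split_ifs with h1
    · rw [h1, pre_append_singleton, hs.preM _ le_rfl]
    · rw [pre_append_of_le _ _ (by omega), hs.preM _ (by omega)]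
  · intro p hp
    rw [List.length_append, List.length_singleton] at hp
    have : (appendProg.run s).real rPreB p = if p = l.length + 1 then
        s.real rPreB l.length + S.D.b (S.π q) else s.real rPreB p := by
      simp [appendProg, Prog.run, NExp.eval, RExp.eval, hlen, hq, ho, hb]
    rw [this]
    split_ifs with h1
    · rw [h1, pre_append_singleton, hs.preB _ le_rfl]
    · rw [pre_append_of_le _ _ (by omega), hs.preB _ (by omega)]
  · simpa [appendProg, Prog.run] using hs.tau
  · simpa [appendProg, Prog.run] using hs.y₁
  · simpa [appendProg, Prog.run] using hs.y₂

open Classical in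
/-- The strip that is built from the first `q` points of the order by abscissas. -/
noncomputable def Setting.partialStrip (S : Setting n) (τ y₁ y₂ : ℝ) (q : ℕ) : List (Fin n) :=
  (((List.finRange n).take q).map S.π).filter fun i =>
    decide (τ ≤ S.t i ∧ y₁ ≤ (S.D.pt i).2 ∧ (S.D.pt i).2 ≤ y₂)

theorem Setting.partialStrip_succ (S : Setting n) (τ y₁ y₂ : ℝ) {q : ℕ} (hq : q < n) :
    (τ ≤ S.t (S.π ⟨q, hq⟩) ∧ y₁ ≤ (S.D.pt (S.π ⟨q, hq⟩)).2 ∧ (S.D.pt (S.π ⟨q, hq⟩)).2 ≤ y₂ →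
      S.partialStrip τ y₁ y₂ (q + 1) = S.partialStrip τ y₁ y₂ q ++ [S.π ⟨q, hq⟩]) ∧
    (¬ (τ ≤ S.t (S.π ⟨q, hq⟩) ∧ y₁ ≤ (S.D.pt (S.π ⟨q, hq⟩)).2 ∧
      (S.D.pt (S.π ⟨q, hq⟩)).2 ≤ y₂) →
      S.partialStrip τ y₁ y₂ (q + 1) = S.partialStrip τ y₁ y₂ q) := by
  have hget : (List.finRange n)[q]? = some ⟨q, hq⟩ := by
    rw [List.getElem?_eq_getElem (by simpa using hq)]
    simp
  unfold Setting.partialStrip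
  rw [List.take_add_one, List.map_append, List.filter_append, hget, Option.toList_some,
    List.map_singleton]
  constructor
  · intro h
    rw [List.filter_cons_of_pos (by simpa using h), List.filter_nil]
  · intro h
    rw [List.filter_cons_of_neg (by simpa using h), List.filter_nil, List.append_nil]

theorem buildBody_spec {S : Setting n} {τ y₁ y₂ : ℝ} {s : State} {q : ℕ} (hqn : q < n)
    (h : S.InMem s) (hs : S.StripInMem τ y₁ y₂ (S.partialStrip τ y₁ y₂ q) s)
    (hq : s.nat aQ 0 = q) :
    Runs buildBody s buildBody.time fun s' => s'.nat aQ 0 = q + 1 ∧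
      S.StripInMem τ y₁ y₂ (S.partialStrip τ y₁ y₂ (q + 1)) s' := by
  refine Runs.of_run rfl ?_
  have ho := h.ord ⟨q, hqn⟩
  have htest : inStripTest.Holds s ↔ τ ≤ S.t (S.π ⟨q, hqn⟩) ∧ y₁ ≤ (S.D.pt (S.π ⟨q, hqn⟩)).2 ∧
      (S.D.pt (S.π ⟨q, hqn⟩)).2 ≤ y₂ := by
    simp only [inStripTest, Test.Holds, RExp.eval, NExp.eval, hs.tau, hs.y₁, hs.y₂, hq]
    rw [ho, h.t, h.y]
  unfold buildBody
  rw [Prog.run, Prog.run, Prog.run]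
  split_ifs with hc
  · rw [(S.partialStrip_succ τ y₁ y₂ hqn).1 (htest.1 hc)]
    have ha := append_spec (q := ⟨q, hqn⟩) h hs hq
    refine ⟨?_, ha.congr ?_ ?_ ?_ ?_ ?_ ?_ ?_⟩
    · simp [Prog.run, appendProg, NExp.eval, hq]
    all_goals simp
  · rw [(S.partialStrip_succ τ y₁ y₂ hqn).2 fun h => hc (htest.2 h)]
    refine ⟨?_, hs.congr ?_ ?_ ?_ ?_ ?_ ?_ ?_⟩
    · simp [Prog.run, NExp.eval, hq]
    all_goals simp [Prog.run]

theorem build_spec {S : Setting n} {τ y₁ y₂ : ℝ} {s : State} (h : S.InMem s)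
    (hτ : s.real rTau 0 = τ) (h₁ : s.real rY₁ 0 = y₁) (h₂ : s.real rY₂ 0 = y₂) :
    Runs buildProg s (50 + n * (buildBody.time + 20)) fun s' => S.Ready τ y₁ y₂ s' := by
  unfold buildProg
  have hinit := Runs.of_loopFree (p := setN aLen (.lit 0) ;; .setReal rPreM (.lit 0)
    (.ofNat (.lit 0)) ;; .setReal rPreB (.lit 0) (.ofNat (.lit 0)) ;; setN aQ (.lit 0)) rfl s
  refine (hinit.seq (U := n * (buildBody.time + 7 + 1) + (7 + 1))
    (R := fun s' => S.InMem s' ∧ S.StripInMem τ y₁ y₂ (S.partialStrip τ y₁ y₂ n) s')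
    fun s₁ hk hs₁ => ?_).mono ?_ ?_
  · have hm₁ : S.InMem s₁ := h.keeps hk rfl
    have hst₁ : S.StripInMem τ y₁ y₂ (S.partialStrip τ y₁ y₂ 0) s₁ := by
      have : S.partialStrip τ y₁ y₂ 0 = [] := by simp [Setting.partialStrip]
      rw [this]
      subst hs₁
      constructor <;> simp [Prog.run, NExp.eval, RExp.eval, pre, hτ, h₁, h₂]
    have hq₁ : s₁.nat aQ 0 = 0 := by subst hs₁; simp [Prog.run, NExp.eval]
    refine (Runs.loop (m := n) (b := buildBody.time) (fun q s' => S.InMem s' ∧ s'.nat aQ 0 = q ∧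
      S.StripInMem τ y₁ y₂ (S.partialStrip τ y₁ y₂ q) s') ⟨hm₁, hq₁, hst₁⟩
      (fun q hq s' _ ⟨hm, hq', hst⟩ => ⟨?_, ?_⟩) (fun s' _ ⟨hm, hq', hst⟩ => ?_)).mono ?_
      (fun s' _ hs => ⟨hs.1, hs.2.2⟩)
    · simp only [Test.Holds, NExp.eval, hq', hm.num]; omega
    · exact (buildBody_spec hq hm hst hq').mono le_rfl fun s'' hk' hs'' =>
        ⟨hm.keeps hk' rfl, hs''⟩
    · simp only [Test.Holds, NExp.eval, hq', hm.num]; omega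
    · exact le_rfl
  · have : (setN aLen (.lit 0) ;; .setReal rPreM (.lit 0)
      (.ofNat (.lit 0)) ;; .setReal rPreB (.lit 0) (.ofNat (.lit 0)) ;;
      setN aQ (.lit 0) : Prog).time ≤ 30 := by decide
    nlinarith
  · rintro s' - ⟨hm, hs⟩
    refine ⟨hm, ?_⟩
    have : S.partialStrip τ y₁ y₂ n = S.D.strip S.t S.π τ y₁ y₂ := by
      unfold Setting.partialStrip Data.strip
      rw [List.take_of_length_le (by simp)]
    rwa [this] at hs

end Scan

/-! ### Exhaustive search for short pairs -/

namespace Scan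

open RealRAM

variable {n : ℕ}

/-- The candidate pair `(i, j)` of the strip has been taken into account. -/
def Setting.Tried (S : Setting n) (l : List (Fin n)) (s : State) (i j : ℕ) : Prop :=
  i < j → S.D.IsCut l i → S.D.IsCut l j → S.D.Supported S.C (seg l i j) →
    Beats s (S.D.disc S.c (seg l i j))

theorem Setting.Tried.mono {S : Setting n} {l : List (Fin n)} {s s' : State} {i j : ℕ}
    (h : S.Tried l s i j) (hs : S.Improves s s') : S.Tried l s' i j :=
  fun h1 h2 h3 h4 => hs.beats _ (h h1 h2 h3 h4)

/-- Tries the pair given by two expressions. -/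
def pairProg (e f : NExp) : Prog := setN aFrom e ;; setN aTo f ;; tryProg

theorem pair_spec {S : Setting n} (hπ : Monotone ((fun i => (S.D.pt i).1) ∘ S.π)) {τ y₁ y₂ : ℝ}
    {s : State} (h : S.Ready τ y₁ y₂ s) {e f : NExp} {i j : ℕ} (he : e.eval s = i)
    (hf : ∀ v, f.eval (s.setNat aFrom 0 v) = j) :
    Runs (pairProg e f) s (e.cost + f.cost + (4 + tryProg.time)) fun s' => S.Improves s s' ∧
      S.Tried (S.D.strip S.t S.π τ y₁ y₂) s' i j := by
  have hset : Runs (setN aFrom e) s (e.cost + 2) fun s₁ => s₁ = s.setNat aFrom 0 i :=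
    (Runs.of_loopFree rfl s).mono (by simp [Prog.time, NExp.cost]; omega)
      (fun s₁ _ hs₁ => by rw [hs₁, Prog.run, he]; rfl)
  refine (hset.seq (U := f.cost + 2 + tryProg.time) fun s₁ hk₁ hs₁ => ?_).mono (by omega)
    (fun _ _ h => h)
  have hset₂ : Runs (setN aTo f) s₁ (f.cost + 2) fun s₂ =>
      s₂ = (s.setNat aFrom 0 i).setNat aTo 0 j :=
    (Runs.of_loopFree rfl s₁).mono (by simp [Prog.time, NExp.cost]; omega)
      (fun s₂ _ hs₂ => by rw [hs₂, Prog.run, hs₁, hf]; rfl)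
  refine hset₂.seq fun s₂ hk₂ hs₂ => ?_
  have hr₁ := h.keeps hk₁ rfl rfl
  have hr₂ := hr₁.keeps hk₂ rfl rfl
  have himp : S.Improves s s₂ :=
    (Setting.Improves.of_keeps S hk₁ rfl rfl).trans (.of_keeps S hk₂ rfl rfl)
  have hi : s₂.nat aFrom 0 = i := by rw [hs₂]; simp
  have hj : s₂.nat aTo 0 = j := by rw [hs₂]; simp
  refine (try_spec hπ hr₂).mono le_rfl fun s₃ _ ⟨h₁, h₂⟩ => ⟨himp.trans h₁, ?_⟩
  rw [hi, hj] at h₂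
  exact h₂

/-- Tries one pair of positions, `aBj + 1` apart. -/
def bruteInner : Prog :=
  pairProg (nv aBi) (.add (.add (nv aBi) (nv aBj)) (.lit 1)) ;; incr aBj

/-- Tries the pairs whose first position is `aBi`. Second positions beyond the end of the strip are
rejected by `tryProg`. -/
def bruteOuter : Prog :=
  setN aBj (.lit 0) ;; .loop (natLt (nv aBj) (nv aWidth)) bruteInner ;; incr aBi

/-- Tries all pairs of positions of the strip that are at most `aWidth` apart. -/
def bruteProg : Prog :=
  setN aBi (.lit 0) ;; .loop (.natLe (nv aBi) (nv aLen)) bruteOuter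

theorem setN_spec (a : ℕ) (e : NExp) (s : State) :
    Runs (setN a e) s (e.cost + 2) fun s' => s' = s.setNat a 0 (e.eval s) :=
  (Runs.of_loopFree rfl s).mono (by simp [Prog.time, NExp.cost]; omega) fun _ _ h => h

theorem bruteInner_spec {S : Setting n} (hπ : Monotone ((fun i => (S.D.pt i).1) ∘ S.π))
    {τ y₁ y₂ : ℝ} {s : State} (h : S.Ready τ y₁ y₂ s) {i d : ℕ} (hi : s.nat aBi 0 = i)
    (hd : s.nat aBj 0 = d) :
    Runs bruteInner s (tryProg.time + 20) fun s' => S.Improves s s' ∧ s'.nat aBj 0 = d + 1 ∧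
      S.Tried (S.D.strip S.t S.π τ y₁ y₂) s' i (i + d + 1) := by
  unfold bruteInner
  refine ((pair_spec hπ h (i := i) (j := i + d + 1) (by simpa [NExp.eval] using hi)
    (by intro v; simp [NExp.eval, hi, hd])).seq fun s₁ hk₁ ⟨h₁, h₂⟩ =>
    (setN_spec aBj _ s₁).mono le_rfl (Q' := fun s' => S.Improves s s' ∧ s'.nat aBj 0 = d + 1 ∧
      S.Tried (S.D.strip S.t S.π τ y₁ y₂) s' i (i + d + 1)) fun s₂ hk₂ hs₂ => ?_).mono ?_
    fun _ _ h => h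
  · have himp : S.Improves s₁ s₂ := .of_keeps S hk₂ rfl rfl
    refine ⟨h₁.trans himp, ?_, h₂.mono himp⟩
    have : s₁.nat aBj = s.nat aBj := hk₁.nat _ rfl
    rw [hs₂]
    simp [NExp.eval, this, hd]
  · simp only [NExp.cost]
    omega

theorem bruteOuter_spec {S : Setting n} (hπ : Monotone ((fun i => (S.D.pt i).1) ∘ S.π))
    {τ y₁ y₂ : ℝ} {s : State} (h : S.Ready τ y₁ y₂ s) {i w : ℕ} (hi : s.nat aBi 0 = i)
    (hw : s.nat aWidth 0 = w) :
    Runs bruteOuter s ((w + 1) * (tryProg.time + 50)) fun s' => S.Improves s s' ∧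
      s'.nat aBi 0 = i + 1 ∧
      ∀ j, i < j → j ≤ i + w → S.Tried (S.D.strip S.t S.π τ y₁ y₂) s' i j := by
  unfold bruteOuter
  refine ((setN_spec aBj _ s).seq fun s₁ hk₁ hs₁ => (Runs.seq (Runs.loop (m := w)
    (b := tryProg.time + 20) (s := s₁) (p := bruteInner) (fun d s' => S.Improves s s' ∧
      s'.nat aBj 0 = d ∧ ∀ j, i < j → j ≤ i + d → S.Tried (S.D.strip S.t S.π τ y₁ y₂) s' i j)
    ⟨.of_keeps S hk₁ rfl rfl, by rw [hs₁]; simp [NExp.eval], fun j h1 h2 => by omega⟩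
    (fun d hd s' hk ⟨himp, hj, ht⟩ => ⟨?_, ?_⟩) (fun s' hk ⟨himp, hj, ht⟩ => ?_))
    fun s₂ hk₂ ⟨himp, hj, ht⟩ => (setN_spec aBi _ s₂).mono le_rfl
      (Q' := fun s' => S.Improves s s' ∧ s'.nat aBi 0 = i + 1 ∧
        ∀ j, i < j → j ≤ i + w → S.Tried (S.D.strip S.t S.π τ y₁ y₂) s' i j)
      fun s₃ hk₃ hs₃ => ?_)).mono ?_ fun _ _ h => h
  · have hw' : s'.nat aWidth 0 = w := by
      rw [hk.nat aWidth rfl, hk₁.nat aWidth rfl, hw]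
    simp only [Test.Holds, NExp.eval, hj, hw']; omega
  · have hi' : s'.nat aBi 0 = i := by rw [hk.nat aBi rfl, hk₁.nat aBi rfl, hi]
    refine (bruteInner_spec hπ ((h.keeps hk₁ rfl rfl).keeps hk rfl rfl) hi' hj).mono le_rfl
      fun s'' _ ⟨h₁, h₂, h₃⟩ => ⟨himp.trans h₁, h₂, fun j hij hj' => ?_⟩
    rcases Nat.lt_or_ge (i + d) j with hlt | hle
    · obtain rfl : j = i + d + 1 := by omega
      exact h₃
    · exact (ht j hij hle).mono h₁
  · have hw' : s'.nat aWidth 0 = w := by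
      rw [hk.nat aWidth rfl, hk₁.nat aWidth rfl, hw]
    simp only [Test.Holds, NExp.eval, hj, hw']; omega
  · have himp₃ : S.Improves s₂ s₃ := .of_keeps S hk₃ rfl rfl
    refine ⟨himp.trans himp₃, ?_, fun j h1 h2 => (ht j h1 h2).mono himp₃⟩
    have : s₂.nat aBi = s.nat aBi := (hk₂.nat aBi rfl).trans (hk₁.nat aBi rfl)
    rw [hs₃]
    simp [NExp.eval, this, hi]
  · simp only [NExp.cost, Test.cost]
    ring_nf
    omega

theorem brute_spec {S : Setting n} (hπ : Monotone ((fun i => (S.D.pt i).1) ∘ S.π))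
    {τ y₁ y₂ : ℝ} {s : State} (h : S.Ready τ y₁ y₂ s) {w : ℕ} (hw : s.nat aWidth 0 = w) :
    Runs bruteProg s ((n + 2) * ((w + 1) * (tryProg.time + 50) + 20)) fun s' => S.Improves s s' ∧
      ∀ i j, i < j → j ≤ (S.D.strip S.t S.π τ y₁ y₂).length → j ≤ i + w →
        S.Tried (S.D.strip S.t S.π τ y₁ y₂) s' i j := by
  unfold bruteProg
  have hlen := S.D.length_strip_le S.t S.π τ y₁ y₂
  have hst := h.strip.len
  set l := S.D.strip S.t S.π τ y₁ y₂ with hl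
  refine ((setN_spec aBi _ s).seq fun s₁ hk₁ hs₁ => (Runs.loop (m := l.length + 1)
    (b := (w + 1) * (tryProg.time + 50)) (s := s₁) (p := bruteOuter)
    (fun i s' => S.Improves s s' ∧ s'.nat aBi 0 = i ∧
      ∀ i' j, i' < i → i' < j → j ≤ i' + w → S.Tried l s' i' j)
    ⟨.of_keeps S hk₁ rfl rfl, by rw [hs₁]; simp [NExp.eval], fun i' j h1 => by omega⟩
    (fun i hi s' hk ⟨himp, hi', ht⟩ => ⟨?_, ?_⟩) (fun s' hk ⟨himp, hi', ht⟩ => ?_))).mono ?_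
    fun s' _ ⟨himp, _, ht⟩ => ⟨himp, fun i j h1 h2 h3 => ht i j (by omega) h1 h3⟩
  · have : s'.nat aLen 0 = l.length := by rw [hk.nat aLen rfl, hk₁.nat aLen rfl, hst]
    simp only [Test.Holds, NExp.eval, hi', this]; omega
  · have hw' : s'.nat aWidth 0 = w := by
      rw [hk.nat aWidth rfl, hk₁.nat aWidth rfl, hw]
    refine (bruteOuter_spec hπ ((h.keeps hk₁ rfl rfl).keeps hk rfl rfl) hi' hw').mono le_rfl
      fun s'' _ ⟨h₁, h₂, h₃⟩ => ⟨himp.trans h₁, h₂, fun i' j h4 h5 h6 => ?_⟩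
    rcases Nat.lt_or_ge i' i with hlt | hle
    · exact (ht i' j hlt h5 h6).mono h₁
    · obtain rfl : i' = i := by omega
      exact h₃ j h5 h6
  · have : s'.nat aLen 0 = l.length := by rw [hk.nat aLen rfl, hk₁.nat aLen rfl, hst]
    simp only [Test.Holds, NExp.eval, hi', this]; omega
  · simp only [NExp.cost, Test.cost]
    have h1 : (l.length + 1) * ((w + 1) * (tryProg.time + 50) + (2 + 2 + 1) + 1) ≤
        (n + 1) * ((w + 1) * (tryProg.time + 50) + (2 + 2 + 1) + 1) :=
      Nat.mul_le_mul_right _ (by omega)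
    generalize (w + 1) * (tryProg.time + 50) = X at *
    nlinarith

end Scan

/-! ### Divide and conquer for distant pairs -/

namespace Scan

open RealRAM

variable {n : ℕ}

/-- The prefix sums of the shares along a list. -/
noncomputable def Setting.sumM (S : Setting n) (l : List (Fin n)) (p : ℕ) : ℝ :=
  pre S.D.m l p / ∑ i, S.D.m i

/-- The prefix sums of the baseline shares along a list. -/
noncomputable def Setting.sumB (S : Setting n) (l : List (Fin n)) (p : ℕ) : ℝ :=
  pre S.D.b l p / ∑ i, S.D.b i

/-- The tables for a strip. -/
noncomputable def Setting.table (S : Setting n) (l : List (Fin n)) (e : ℝ) : ℕ → ℕ → ℕ :=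
  tab (S.D.IsCut l) (S.sumM l) (S.sumB l) S.L S.F₀ e

/-- The number of entries of a level of the tables. -/
def Setting.size (S : Setting n) : ℕ := S.F₀ * 2 ^ S.lev

/-- The natural array `a` holds the level `k` of the table for the sign `e` from the cell `off`
on. -/
def Setting.TabInMem (S : Setting n) (l : List (Fin n)) (e : ℝ) (k a off : ℕ) (s : State) :
    Prop :=
  ∀ z < S.size, s.nat a (off + z) = S.table l e k z

/-- Writes one entry: on level 0 the blocks are single positions. The block and the direction of
the entry are kept as counters, since the machine does not divide natural numbers. -/
def initTabBody : Prog :=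
  .setNat aMax (nv aZ) (nv aBlock) ;; .setNat aMin (nv aZ) (nv aBlock) ;; incr aZ ;; incr aDir ;;
  .ite (.natLe (nv aDirs) (nv aDir)) (setN aDir (.lit 0) ;; incr aBlock) .skip

/-- Writes level 0 of the tables. -/
def initTabProg : Prog :=
  (setN aZ (.lit 0) ;; setN aDir (.lit 0) ;; setN aBlock (.lit 0)) ;;
  .loop (natLt (nv aZ) (nv aSize)) initTabBody

theorem mod_succ_eq {z F : ℕ} (hF : 0 < F) :
    (z + 1) % F = (if F ≤ z % F + 1 then 0 else z % F + 1) ∧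
      (z + 1) / F = if F ≤ z % F + 1 then z / F + 1 else z / F := by
  have h1 := Nat.div_add_mod z F
  have h2 := Nat.mod_lt z hF
  split_ifs with h
  · have h4 : z + 1 = F * (z / F + 1) := by rw [mul_add]; omega
    exact ⟨by rw [h4, Nat.mul_mod_right], by rw [h4, Nat.mul_div_cancel_left _ hF]⟩
  · have h4 : (z + 1) / F = z / F :=
      (Nat.div_eq_iff hF).2 ⟨by rw [mul_comm]; omega, by rw [mul_comm]; omega⟩
    have h5 := Nat.div_add_mod (z + 1) F
    rw [h4] at h5
    exact ⟨by omega, h4⟩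

theorem initTab_spec {S : Setting n} (hF : 0 < S.F₀) (l : List (Fin n)) {s : State}
    (h : S.InMem s) :
    Runs initTabProg s (50 + S.size * (initTabBody.time + 20)) fun s' =>
      S.TabInMem l 1 0 aMax 0 s' ∧ S.TabInMem l (-1) 0 aMin 0 s' := by
  unfold initTabProg
  have hinit := Runs.of_loopFree (p := setN aZ (.lit 0) ;; setN aDir (.lit 0) ;;
    setN aBlock (.lit 0)) rfl s
  refine (hinit.seq fun s₁ hk₁ hs₁ => Runs.loop (m := S.size) (b := initTabBody.time)
    (fun z s' => s'.nat aZ 0 = z ∧ s'.nat aDir 0 = z % S.F₀ ∧ s'.nat aBlock 0 = z / S.F₀ ∧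
      ∀ z' < z, s'.nat aMax z' = z' / S.F₀ ∧ s'.nat aMin z' = z' / S.F₀)
    ⟨?_, ?_, ?_, fun z' h' => by omega⟩
    (fun z hz s' hk ⟨h1, h2, h3, h4⟩ => ⟨?_, ?_⟩) (fun s' hk ⟨h1, h2, h3, h4⟩ => ?_)).mono ?_
    fun s' _ ⟨_, _, _, ht⟩ => ⟨fun z hz => ?_, fun z hz => ?_⟩
  · subst hs₁; simp [Prog.run, NExp.eval]
  · subst hs₁; simp [Prog.run, NExp.eval]
  · subst hs₁; simp [Prog.run, NExp.eval]
  · have : s'.nat aSize 0 = S.size := ((h.keeps hk₁ rfl).keeps hk rfl).size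
    simp only [Test.Holds, NExp.eval, h1, this]; omega
  · refine Runs.of_run rfl ?_
    have hd := ((h.keeps hk₁ rfl).keeps hk rfl).dirs
    obtain ⟨e1, e2⟩ := mod_succ_eq (z := z) hF
    rw [e1, e2]
    have ht' : ∀ z' < z + 1, (if z' = z then z / S.F₀ else s'.nat aMax z') = z' / S.F₀ ∧
        (if z' = z then z / S.F₀ else s'.nat aMin z') = z' / S.F₀ := by
      intro z' hz'
      split_ifs with hzz
      · subst hzz; exact ⟨rfl, rfl⟩
      · exact h4 z' (by omega)
    by_cases hc : S.F₀ ≤ z % S.F₀ + 1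
    · simpa [initTabBody, Prog.run, NExp.eval, Test.Holds, h1, h2, h3, hd, hc] using ht'
    · simpa [initTabBody, Prog.run, NExp.eval, Test.Holds, h1, h2, h3, hd, hc] using ht'
  · have : s'.nat aSize 0 = S.size := ((h.keeps hk₁ rfl).keeps hk rfl).size
    simp only [Test.Holds, NExp.eval, h1, this]; omega
  · have : (setN aZ (.lit 0) ;; setN aDir (.lit 0) ;; setN aBlock (.lit 0) : Prog).time ≤ 30 := by
      decide
    simp only [NExp.cost, Test.cost]
    nlinarith
  · rw [zero_add, (ht z hz).1]; rfl
  · rw [zero_add, (ht z hz).2]; rfl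

/-- `e` reads the entry of the table `a`, on the current level, of index `aZ + d`. -/
def entry (a : ℕ) (d : NExp) : NExp := .get a (.add (.add (nv aOff) (nv aZ)) d)

/-- `2 * F`. -/
def twice : NExp := .add (nv aCur) (nv aCur)

/-- `3 * F`. -/
def thrice : NExp := .add twice (nv aCur)

/-- Tries the four pairs in which the entry of index `aZ` comes first. Pairs that reach beyond the
current level are meaningless but harmless. -/
def crossBody : Prog :=
  pairProg (entry aMin (.lit 0)) (entry aMax twice) ;;
  pairProg (entry aMax (.lit 0)) (entry aMin twice) ;;
  pairProg (entry aMin (.lit 0)) (entry aMax thrice) ;;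
  pairProg (entry aMax (.lit 0)) (entry aMin thrice) ;; incr aZ

/-- Tries the pairs of entries for blocks at distance two and three. -/
def crossProg : Prog := setN aZ (.lit 0) ;; .loop (natLt (nv aZ) (nv aSize)) crossBody

/-- The current level of the tables is level `k`. -/
structure Setting.AtLevel (S : Setting n) (l : List (Fin n)) (k off : ℕ) (s : State) : Prop where
  cur : s.nat aCur 0 = S.F₀ * 2 ^ k
  offset : s.nat aOff 0 = off
  max : S.TabInMem l 1 k aMax off s
  min : S.TabInMem l (-1) k aMin off s

theorem Setting.AtLevel.keeps {S : Setting n} {l : List (Fin n)} {k off : ℕ} {s s' : State}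
    {p : Prog} (h : S.AtLevel l k off s) (hk : Keeps p s s') (h1 : p.writesNat aCur = false)
    (h2 : p.writesNat aOff = false) (h3 : p.writesNat aMax = false)
    (h4 : p.writesNat aMin = false) : S.AtLevel l k off s' := by
  constructor
  · rw [hk.nat _ h1]; exact h.cur
  · rw [hk.nat _ h2]; exact h.offset
  · intro z hz; rw [hk.nat _ h3]; exact h.max z hz
  · intro z hz; rw [hk.nat _ h4]; exact h.min z hz

/-- The pairs of entries of index `z` and `z + d * F` on the level `k` have been tried. -/
def Setting.CrossTried (S : Setting n) (l : List (Fin n)) (s : State) (k z : ℕ) : Prop :=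
  ∀ d, d = 2 ∨ d = 3 → z + d * (S.F₀ * 2 ^ k) < S.size → ∀ e : ℝ, e = 1 ∨ e = -1 →
    S.Tried l s (S.table l (-e) k z) (S.table l e k (z + d * (S.F₀ * 2 ^ k)))

theorem Setting.CrossTried.mono {S : Setting n} {l : List (Fin n)} {s s' : State} {k z : ℕ}
    (h : S.CrossTried l s k z) (hs : S.Improves s s') : S.CrossTried l s' k z :=
  fun d hd hz e he => (h d hd hz e he).mono hs

/-- Trying a pair of entries; entries outside of the table are harmless. -/
theorem entry_pair_spec {S : Setting n} (hπ : Monotone ((fun i => (S.D.pt i).1) ∘ S.π))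
    {τ y₁ y₂ : ℝ} {s : State} (h : S.Ready τ y₁ y₂ s) {off z d a b : ℕ} {e₁ e₂ : ℝ} {k : ℕ}
    {f : NExp} (ha : S.TabInMem (S.D.strip S.t S.π τ y₁ y₂) e₁ k a off s)
    (hb : S.TabInMem (S.D.strip S.t S.π τ y₁ y₂) e₂ k b off s) (hbne : b ≠ aFrom)
    (hoff : s.nat aOff 0 = off)
    (hz : s.nat aZ 0 = z) (hzs : z < S.size) (hf : ∀ v, f.eval (s.setNat aFrom 0 v) = d) :
    Runs (pairProg (entry a (.lit 0)) (entry b f)) s (f.cost + (30 + tryProg.time)) fun s' =>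
      S.Improves s s' ∧ (z + d < S.size → S.Tried (S.D.strip S.t S.π τ y₁ y₂) s'
        (S.table (S.D.strip S.t S.π τ y₁ y₂) e₁ k z)
        (S.table (S.D.strip S.t S.π τ y₁ y₂) e₂ k (z + d))) := by
  refine (pair_spec hπ h (i := S.table (S.D.strip S.t S.π τ y₁ y₂) e₁ k z)
    (j := s.nat b (off + (z + d))) ?_ ?_).mono ?_ fun s' _ ⟨h₁, h₂⟩ => ⟨h₁, fun hzd => ?_⟩
  · rw [← ha z hzs]
    simp [entry, NExp.eval, hoff, hz]
  · intro v
    simp only [entry, NExp.eval, hf v]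
    rw [State.setNat_nat_of_ne _ _ _ hbne]
    simp [hoff, hz, add_assoc]
  · simp only [entry, NExp.cost]; omega
  · rwa [hb _ hzd] at h₂

theorem crossBody_spec {S : Setting n} (hπ : Monotone ((fun i => (S.D.pt i).1) ∘ S.π))
    {τ y₁ y₂ : ℝ} {s : State} (h : S.Ready τ y₁ y₂ s) {off z k : ℕ}
    (hl : S.AtLevel (S.D.strip S.t S.π τ y₁ y₂) k off s) (hz : s.nat aZ 0 = z)
    (hzs : z < S.size) :
    Runs crossBody s (4 * tryProg.time + 200) fun s' => S.Improves s s' ∧ s'.nat aZ 0 = z + 1 ∧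
      S.CrossTried (S.D.strip S.t S.π τ y₁ y₂) s' k z := by
  unfold crossBody
  have h2 : ∀ {s'}, S.AtLevel (S.D.strip S.t S.π τ y₁ y₂) k off s' → ∀ v,
      twice.eval (s'.setNat aFrom 0 v) = 2 * (S.F₀ * 2 ^ k) := by
    intro s' hl v; simp [twice, NExp.eval, hl.cur]; ring
  have h3 : ∀ {s'}, S.AtLevel (S.D.strip S.t S.π τ y₁ y₂) k off s' → ∀ v,
      thrice.eval (s'.setNat aFrom 0 v) = 3 * (S.F₀ * 2 ^ k) := by
    intro s' hl v; simp [thrice, twice, NExp.eval, hl.cur]; ring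
  refine ((entry_pair_spec hπ h hl.min hl.max (by decide) hl.offset hz hzs (h2 hl)).seq
    fun s₁ hk₁ ⟨i₁, t₁⟩ => ?_).mono (T := twice.cost + (30 + tryProg.time) +
      (twice.cost + (30 + tryProg.time) + (thrice.cost + (30 + tryProg.time) +
      (thrice.cost + (30 + tryProg.time) + 6)))) (by simp only [twice, thrice, NExp.cost]; omega)
    fun _ _ h => h
  have hr₁ := h.keeps hk₁ rfl rfl
  have hl₁ := hl.keeps hk₁ rfl rfl rfl rfl
  have hz₁ : s₁.nat aZ 0 = z := by rw [hk₁.nat aZ rfl, hz]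
  refine (entry_pair_spec hπ hr₁ hl₁.max hl₁.min (by decide) hl₁.offset hz₁ hzs (h2 hl₁)).seq
    fun s₂ hk₂ ⟨i₂, t₂⟩ => ?_
  have hr₂ := hr₁.keeps hk₂ rfl rfl
  have hl₂ := hl₁.keeps hk₂ rfl rfl rfl rfl
  have hz₂ : s₂.nat aZ 0 = z := by rw [hk₂.nat aZ rfl, hz₁]
  refine (entry_pair_spec hπ hr₂ hl₂.min hl₂.max (by decide) hl₂.offset hz₂ hzs (h3 hl₂)).seq
    fun s₃ hk₃ ⟨i₃, t₃⟩ => ?_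
  have hr₃ := hr₂.keeps hk₃ rfl rfl
  have hl₃ := hl₂.keeps hk₃ rfl rfl rfl rfl
  have hz₃ : s₃.nat aZ 0 = z := by rw [hk₃.nat aZ rfl, hz₂]
  refine (entry_pair_spec hπ hr₃ hl₃.max hl₃.min (by decide) hl₃.offset hz₃ hzs (h3 hl₃)).seq
    fun s₄ hk₄ ⟨i₄, t₄⟩ => ?_
  have hz₄ : s₄.nat aZ 0 = z := by rw [hk₄.nat aZ rfl, hz₃]
  refine (setN_spec aZ _ s₄).mono le_rfl fun s₅ hk₅ hs₅ => ?_
  have i₅ : S.Improves s₄ s₅ := .of_keeps S hk₅ rfl rfl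
  refine ⟨(((i₁.trans i₂).trans i₃).trans i₄).trans i₅, ?_, ?_⟩
  · rw [hs₅]; simp [NExp.eval, hz₄]
  · rintro d (rfl | rfl) hd e (rfl | rfl)
    · exact (t₁ hd).mono (((i₂.trans i₃).trans i₄).trans i₅)
    · rw [neg_neg]
      exact (t₂ hd).mono ((i₃.trans i₄).trans i₅)
    · exact (t₃ hd).mono (i₄.trans i₅)
    · rw [neg_neg]
      exact (t₄ hd).mono i₅

theorem cross_spec {S : Setting n} (hπ : Monotone ((fun i => (S.D.pt i).1) ∘ S.π))
    {τ y₁ y₂ : ℝ} {s : State} (h : S.Ready τ y₁ y₂ s) {off k : ℕ}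
    (hl : S.AtLevel (S.D.strip S.t S.π τ y₁ y₂) k off s) :
    Runs crossProg s ((S.size + 1) * (4 * tryProg.time + 250)) fun s' => S.Improves s s' ∧
      ∀ z < S.size, S.CrossTried (S.D.strip S.t S.π τ y₁ y₂) s' k z := by
  unfold crossProg
  refine ((setN_spec aZ _ s).seq fun s₁ hk₁ hs₁ => Runs.loop (m := S.size)
    (b := 4 * tryProg.time + 200) (s := s₁) (p := crossBody)
    (fun z s' => S.Improves s s' ∧ s'.nat aZ 0 = z ∧
      ∀ z' < z, S.CrossTried (S.D.strip S.t S.π τ y₁ y₂) s' k z')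
    ⟨.of_keeps S hk₁ rfl rfl, by rw [hs₁]; simp [NExp.eval], fun z' h1 => by omega⟩
    (fun z hz s' hk ⟨himp, hz', ht⟩ => ⟨?_, ?_⟩) (fun s' hk ⟨himp, hz', ht⟩ => ?_)).mono ?_
    fun s' _ ⟨himp, _, ht⟩ => ⟨himp, ht⟩
  · have : s'.nat aSize 0 = S.size := ((h.mem.keeps hk₁ rfl).keeps hk rfl).size
    simp only [Test.Holds, NExp.eval, hz', this]; omega
  · refine (crossBody_spec hπ ((h.keeps hk₁ rfl rfl).keeps hk rfl rfl)
      ((hl.keeps hk₁ rfl rfl rfl rfl).keeps hk rfl rfl rfl rfl) hz' hz).mono le_rfl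
      fun s'' _ ⟨h₁, h₂, h₃⟩ => ⟨himp.trans h₁, h₂, fun z' hz'' => ?_⟩
    rcases Nat.lt_or_ge z' z with hlt | hle
    · exact (ht z' hlt).mono h₁
    · obtain rfl : z' = z := by omega
      exact h₃
  · have : s'.nat aSize 0 = S.size := ((h.mem.keeps hk₁ rfl).keeps hk rfl).size
    simp only [Test.Holds, NExp.eval, hz', this]; omega
  · simp only [NExp.cost, Test.cost]
    nlinarith

/-- The value of the position `p` in the current direction, with the sign `sg`. -/
def scoreExp (sg : RExp) (p : NExp) : RExp :=
  .mul sg (.sub (.div (.get rPreM p) (rv rMTot))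
    (.mul (.div (.mul (rv rRatio) (.ofNat (nv aDir))) (.ofNat (.add (nv aCur) (nv aCur))))
      (.div (.get rPreB p) (rv rBTot))))

/-- The test by which `pick` prefers `aFrom` to `aTo`. -/
def pickTest (sg : RExp) : Test :=
  .and (cutTest (nv aFrom)) (.not (.and (cutTest (nv aTo))
    (.not (.realLe (scoreExp sg (nv aTo)) (scoreExp sg (nv aFrom))))))

/-- The cell of the next level of the tables with index `aZ`. -/
def destExp : NExp := .add (.add (nv aOff) (nv aSize)) (nv aZ)

/-- Computes one entry of the next level of the table `a`. -/
def mergeOne (a : ℕ) (sg : RExp) : Prog :=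
  setN aFrom (.get a (.add (nv aOff) (.add (.sub (nv aZ) (nv aDir)) (.half (nv aDir))))) ;;
  setN aTo (.get a (.add (nv aOff)
    (.add (.add (.sub (nv aZ) (nv aDir)) (nv aCur)) (.half (nv aDir))))) ;;
  .ite (pickTest sg) (.setNat a destExp (nv aFrom)) (.setNat a destExp (nv aTo))

theorem pickTest_holds {S : Setting n} {τ y₁ y₂ : ℝ} {l : List (Fin n)} {s : State}
    (h : S.InMem s) (hs : S.StripInMem τ y₁ y₂ l s) {sg : RExp} {e : ℝ} (hsg : sg.eval s = e) :
    (pickTest sg).Holds s ↔ S.D.IsCut l (s.nat aFrom 0) ∧ (S.D.IsCut l (s.nat aTo 0) →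
      e * (S.sumM l (s.nat aTo 0) - S.L * (s.nat aDir 0) / ((s.nat aCur 0 + s.nat aCur 0 : ℕ) : ℝ)
        * S.sumB l (s.nat aTo 0)) ≤
      e * (S.sumM l (s.nat aFrom 0) - S.L * (s.nat aDir 0) /
        ((s.nat aCur 0 + s.nat aCur 0 : ℕ) : ℝ) * S.sumB l (s.nat aFrom 0))) := by
  have key : ∀ p : NExp, S.D.IsCut l (p.eval s) → (scoreExp sg p).eval s =
      e * (S.sumM l (p.eval s) - S.L * (s.nat aDir 0) / ((s.nat aCur 0 + s.nat aCur 0 : ℕ) : ℝ)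
        * S.sumB l (p.eval s)) := by
    intro p hp
    simp only [scoreExp, RExp.eval, NExp.eval, hsg, hs.preM _ hp.1, hs.preB _ hp.1, h.mTot, h.bTot,
      h.ratio, Setting.sumM, Setting.sumB]
  unfold pickTest
  simp only [Test.Holds, cutTest_holds h hs, not_and, not_not]
  refine and_congr_right fun ha => forall_congr' fun hb => ?_
  rw [key _ ha, key _ hb]
  rfl

/-- The entries of the tables from which the entry of index `z` on the next level is computed
have their indices in the table. -/
theorem child_lt {F N z : ℕ} (hF : 0 < F) (hN : F + F ∣ N) (hz : z < N) :
    z - z % (F + F) + z % (F + F) / 2 < N ∧ z - z % (F + F) + F + z % (F + F) / 2 < N := by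
  obtain ⟨q, rfl⟩ := hN
  have h1 := Nat.div_add_mod z (F + F)
  have h2 := Nat.mod_lt z (show 0 < F + F by omega)
  have h3 : z / (F + F) < q := Nat.div_lt_of_lt_mul hz
  have h4 : (F + F) * (z / (F + F)) + (F + F) ≤ (F + F) * q := by
    rw [← Nat.mul_succ]; exact Nat.mul_le_mul_left _ h3
  omega

theorem mergeOne_spec {S : Setting n} {τ y₁ y₂ : ℝ} {s : State} (h : S.Ready τ y₁ y₂ s)
    {a off z k : ℕ} {e : ℝ} {sg : RExp} (hsg : ∀ s, sg.eval s = e) (ha₁ : a ≠ aFrom)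
    (ha₂ : a ≠ aTo) (hF : 0 < S.F₀) (hk : k < S.lev)
    (ht : S.TabInMem (S.D.strip S.t S.π τ y₁ y₂) e k a off s)
    (hcur : s.nat aCur 0 = S.F₀ * 2 ^ k) (hoff : s.nat aOff 0 = off) (hz : s.nat aZ 0 = z)
    (hdir : s.nat aDir 0 = z % (S.F₀ * 2 ^ k + S.F₀ * 2 ^ k)) (hzs : z < S.size) :
    Runs (mergeOne a sg) s (mergeOne a sg).time fun s' =>
      s'.nat a = Function.update (s.nat a) (off + S.size + z)
        (S.table (S.D.strip S.t S.π τ y₁ y₂) e (k + 1) z) := by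
  have hsize : s.nat aSize 0 = S.size := h.mem.size
  set l := S.D.strip S.t S.π τ y₁ y₂ with hl
  have hdvd : S.F₀ * 2 ^ k + S.F₀ * 2 ^ k ∣ S.size := by
    rw [show S.F₀ * 2 ^ k + S.F₀ * 2 ^ k = S.F₀ * 2 ^ (k + 1) by ring]
    exact Nat.mul_dvd_mul_left _ (pow_dvd_pow 2 hk)
  obtain ⟨hc₁, hc₂⟩ := child_lt (by positivity) hdvd hzs
  have htab : S.table l e (k + 1) z = pick (S.D.IsCut l) (S.sumM l) (S.sumB l) e
      (S.L * (z % (S.F₀ * 2 ^ k + S.F₀ * 2 ^ k) : ℕ) / ((S.F₀ * 2 ^ k + S.F₀ * 2 ^ k : ℕ) : ℝ))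
      (S.table l e k (z - z % (S.F₀ * 2 ^ k + S.F₀ * 2 ^ k) +
        z % (S.F₀ * 2 ^ k + S.F₀ * 2 ^ k) / 2))
      (S.table l e k (z - z % (S.F₀ * 2 ^ k + S.F₀ * 2 ^ k) + S.F₀ * 2 ^ k +
        z % (S.F₀ * 2 ^ k + S.F₀ * 2 ^ k) / 2)) := rfl
  generalize hu : z - z % (S.F₀ * 2 ^ k + S.F₀ * 2 ^ k) +
    z % (S.F₀ * 2 ^ k + S.F₀ * 2 ^ k) / 2 = u at hc₁ htab
  generalize hv : z - z % (S.F₀ * 2 ^ k + S.F₀ * 2 ^ k) + S.F₀ * 2 ^ k +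
    z % (S.F₀ * 2 ^ k + S.F₀ * 2 ^ k) / 2 = v at hc₂ htab
  have hv₁ : (NExp.get a (.add (nv aOff) (.add (.sub (nv aZ) (nv aDir))
      (.half (nv aDir))))).eval s = S.table l e k u := by
    rw [← ht _ hc₁, ← hu]
    simp [NExp.eval, hoff, hz, hdir]
  have hv₂ : ∀ w, (NExp.get a (.add (nv aOff)
      (.add (.add (.sub (nv aZ) (nv aDir)) (nv aCur)) (.half (nv aDir))))).eval
      (s.setNat aFrom 0 w) = S.table l e k v := by
    intro w
    rw [← ht _ hc₂, ← hv]
    simp only [NExp.eval]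
    rw [State.setNat_nat_of_ne _ _ _ ha₁]
    simp [hoff, hz, hdir, hcur]
  rw [htab]
  refine ((setN_spec aFrom _ s).seq fun s₁ hk₁ hs₁ => ((setN_spec aTo _ s₁).seq
    (U := (Prog.ite (pickTest sg) (.setNat a destExp (nv aFrom))
      (.setNat a destExp (nv aTo))).time) fun s₂ hk₂ hs₂ => Runs.of_run rfl ?_)).mono
    (by simp only [mergeOne, Prog.time, NExp.cost]; omega) fun _ _ h => h
  rw [hv₁] at hs₁
  rw [hs₁, hv₂, ← hs₁] at hs₂
  have hr₂ := (h.keeps hk₁ rfl rfl).keeps hk₂ rfl rfl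
  have hp := pickTest_holds hr₂.mem hr₂.strip (hsg s₂)
  have e1 : s₂.nat aFrom 0 = S.table l e k u := by
    rw [hs₂, hs₁]; simp
  have e2 : s₂.nat aTo 0 = S.table l e k v := by
    rw [hs₂]; simp
  have e3 : s₂.nat aDir 0 = z % (S.F₀ * 2 ^ k + S.F₀ * 2 ^ k) := by
    rw [hk₂.nat aDir rfl, hk₁.nat aDir rfl, hdir]
  have e4 : s₂.nat aCur 0 = S.F₀ * 2 ^ k := by
    rw [hk₂.nat aCur rfl, hk₁.nat aCur rfl, hcur]
  have e5 : destExp.eval s₂ = off + S.size + z := by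
    simp only [destExp, NExp.eval]
    rw [hk₂.nat aOff rfl, hk₁.nat aOff rfl, hk₂.nat aSize rfl, hk₁.nat aSize rfl,
      hk₂.nat aZ rfl, hk₁.nat aZ rfl, hoff, hz, hsize]
  have e6 : s₂.nat a = s.nat a := by
    rw [hs₂, State.setNat_nat_of_ne _ _ _ ha₂, hs₁, State.setNat_nat_of_ne _ _ _ ha₁]
  rw [e1, e2, e3, e4] at hp
  rw [Prog.run]
  unfold pick
  split_ifs with h1 h2 h2
  · rw [Prog.run, e5, ← e6]
    simp only [NExp.eval, e1]
    exact Function.update_self ..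
  · exact absurd (hp.1 h1) h2
  · exact absurd (hp.2 h2) h1
  · rw [Prog.run, e5, ← e6]
    simp only [NExp.eval, e2]
    exact Function.update_self ..

/-- The real number `-1`. -/
def minusOne : RExp := .sub (.ofNat (.lit 0)) one

/-- Computes the entry of index `aZ` of the next level of both tables; `aDir` runs through the
directions of that level. -/
def mergeBody : Prog :=
  mergeOne aMax one ;; mergeOne aMin minusOne ;; incr aZ ;; incr aDir ;;
  .ite (.natLe (.add (nv aCur) (nv aCur)) (nv aDir)) (setN aDir (.lit 0)) .skip

/-- Computes the next level of both tables. -/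
def mergeProg : Prog :=
  (setN aZ (.lit 0) ;; setN aDir (.lit 0)) ;; .loop (natLt (nv aZ) (nv aSize)) mergeBody

/-- The table `a` holds the level `k`, and the first `z` entries of the next level. -/
structure Setting.Merging (S : Setting n) (l : List (Fin n)) (e : ℝ) (k a off z : ℕ) (s : State) :
    Prop where
  old : S.TabInMem l e k a off s
  new : ∀ z' < z, s.nat a (off + S.size + z') = S.table l e (k + 1) z'

theorem Setting.Merging.update {S : Setting n} {l : List (Fin n)} {e : ℝ} {k a off z : ℕ}
    {s s' : State} (h : S.Merging l e k a off z s)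
    (hs : s'.nat a = Function.update (s.nat a) (off + S.size + z) (S.table l e (k + 1) z)) :
    S.Merging l e k a off (z + 1) s' := by
  constructor
  · intro z' hz'
    rw [hs, Function.update_of_ne (by omega)]
    exact h.old z' hz'
  · intro z' hz'
    rw [hs]
    rcases Nat.lt_or_ge z' z with hlt | hle
    · rw [Function.update_of_ne (by omega)]
      exact h.new z' hlt
    · obtain rfl : z' = z := by omega
      rw [Function.update_self]

theorem Setting.Merging.congr {S : Setting n} {l : List (Fin n)} {e : ℝ} {k a off z : ℕ}
    {s s' : State} (h : S.Merging l e k a off z s) (hs : s'.nat a = s.nat a) :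
    S.Merging l e k a off z s' :=
  ⟨fun z' hz' => by rw [hs]; exact h.old z' hz', fun z' hz' => by rw [hs]; exact h.new z' hz'⟩

theorem merge_spec {S : Setting n} (hF : 0 < S.F₀) {τ y₁ y₂ : ℝ} {s : State}
    (h : S.Ready τ y₁ y₂ s) {off k : ℕ} (hk : k < S.lev)
    (hl : S.AtLevel (S.D.strip S.t S.π τ y₁ y₂) k off s) :
    Runs mergeProg s (S.size * (mergeBody.time + 20) + 30) fun s' =>
      S.TabInMem (S.D.strip S.t S.π τ y₁ y₂) 1 (k + 1) aMax (off + S.size) s' ∧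
      S.TabInMem (S.D.strip S.t S.π τ y₁ y₂) (-1) (k + 1) aMin (off + S.size) s' := by
  unfold mergeProg
  set l := S.D.strip S.t S.π τ y₁ y₂ with hldef
  set F := S.F₀ * 2 ^ k with hFdef
  have hinit := Runs.of_loopFree (p := setN aZ (.lit 0) ;; setN aDir (.lit 0)) rfl s
  refine (hinit.seq fun s₁ hk₁ hs₁ => Runs.loop (m := S.size) (b := mergeBody.time)
    (fun z s' => s'.nat aZ 0 = z ∧ s'.nat aDir 0 = z % (F + F) ∧
      S.Merging l 1 k aMax off z s' ∧ S.Merging l (-1) k aMin off z s')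
    ⟨?_, ?_, ?_, ?_⟩
    (fun z hz s' hk' ⟨h1, h2, h3, h4⟩ => ⟨?_, ?_⟩) (fun s' hk ⟨h1, h2, h3, h4⟩ => ?_)).mono ?_
    fun s' _ ⟨_, _, h3, h4⟩ => ⟨h3.new, h4.new⟩
  · subst hs₁; simp [Prog.run, NExp.eval]
  · subst hs₁; simp [Prog.run, NExp.eval]
  · exact ⟨fun z hz => by rw [hk₁.nat aMax rfl]; exact hl.max z hz, fun z hz => by omega⟩
  · exact ⟨fun z hz => by rw [hk₁.nat aMin rfl]; exact hl.min z hz, fun z hz => by omega⟩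
  · have : s'.nat aSize 0 = S.size := ((h.mem.keeps hk₁ rfl).keeps hk' rfl).size
    simp only [Test.Holds, NExp.eval, h1, this]; omega
  · have hr := (h.keeps hk₁ rfl rfl).keeps hk' rfl rfl
    have hcur : s'.nat aCur 0 = F := by rw [hk'.nat aCur rfl, hk₁.nat aCur rfl, hl.cur]
    have hoff : s'.nat aOff 0 = off := by rw [hk'.nat aOff rfl, hk₁.nat aOff rfl, hl.offset]
    refine ((mergeOne_spec hr (a := aMax) (sg := one) (e := 1)
      (fun s => by simp [one, RExp.eval, NExp.eval]) (by decide) (by decide) hF hk h3.old hcur hoff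
      h1 h2 hz).seq fun s₂ hk₂ hs₂ => (mergeOne_spec (hr.keeps hk₂ rfl rfl) (a := aMin)
      (sg := minusOne) (e := -1) (off := off) (z := z) (k := k)
      (fun s => by simp [minusOne, one, RExp.eval, NExp.eval])
      (by decide) (by decide) hF hk ?_ ?_ ?_ ?_ ?_ hz).seq
      fun s₃ hk₃ hs₃ => Runs.of_run (p := incr aZ ;; incr aDir ;;
        .ite (.natLe (.add (nv aCur) (nv aCur)) (nv aDir)) (setN aDir (.lit 0)) .skip) rfl ?_).mono
      le_rfl fun _ _ h => h
    · intro z' hz'; rw [hk₂.nat aMin rfl]; exact h4.old z' hz'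
    · rw [hk₂.nat aCur rfl, hcur]
    · rw [hk₂.nat aOff rfl, hoff]
    · rw [hk₂.nat aZ rfl, h1]
    · rw [hk₂.nat aDir rfl, h2]
    · have h3' := (h3.update hs₂).congr (hk₃.nat aMax rfl)
      have h4' := (h4.congr (hk₂.nat aMin rfl)).update hs₃
      have f1 : s₃.nat aZ 0 = z := by rw [hk₃.nat aZ rfl, hk₂.nat aZ rfl, h1]
      have f2 : s₃.nat aDir 0 = z % (F + F) := by rw [hk₃.nat aDir rfl, hk₂.nat aDir rfl, h2]
      have f3 : s₃.nat aCur 0 = F := by rw [hk₃.nat aCur rfl, hk₂.nat aCur rfl, hcur]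
      have hFF : 0 < F + F := by positivity
      rw [(mod_succ_eq (z := z) hFF).1]
      by_cases hc : F + F ≤ z % (F + F) + 1
      · refine ⟨?_, ?_, h3'.congr ?_, h4'.congr ?_⟩ <;>
          simp [Prog.run, NExp.eval, Test.Holds, f1, f2, f3, hc]
      · refine ⟨?_, ?_, h3'.congr ?_, h4'.congr ?_⟩ <;>
          simp [Prog.run, NExp.eval, Test.Holds, f1, f2, f3, hc]
  · have : s'.nat aSize 0 = S.size :=
      ((h.mem.keeps hk₁ rfl).keeps (by assumption) rfl).size
    simp only [Test.Holds, NExp.eval, h1, this]; omega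
  · have : (setN aZ (.lit 0) ;; setN aDir (.lit 0) : Prog).time ≤ 10 := by
      decide
    simp only [NExp.cost, Test.cost]
    nlinarith

/-- Tries the pairs of entries of one level, and passes to the next level. -/
def levelBody : Prog :=
  crossProg ;; mergeProg ;; (setN aOff (.add (nv aOff) (nv aSize)) ;;
    setN aCur (.add (nv aCur) (nv aCur)) ;; incr aL)

/-- Computes the tables level by level, and tries the pairs of entries for blocks at distance two
and three. -/
def dncProg : Prog :=
  initTabProg ;; (setN aOff (.lit 0) ;; setN aCur (nv aDirs) ;; setN aL (.lit 0)) ;;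
  .loop (natLt (nv aL) (nv aLev)) levelBody

/-- A bound for the time per entry that `levelBody` takes. -/
def levelCost : ℕ := 4 * tryProg.time + mergeBody.time + 400

theorem levelBody_spec {S : Setting n} (hπ : Monotone ((fun i => (S.D.pt i).1) ∘ S.π))
    (hF : 0 < S.F₀) {τ y₁ y₂ : ℝ} {s : State} (h : S.Ready τ y₁ y₂ s) {off k : ℕ} (hk : k < S.lev)
    (hL : s.nat aL 0 = k) (hl : S.AtLevel (S.D.strip S.t S.π τ y₁ y₂) k off s) :
    Runs levelBody s ((S.size + 1) * levelCost) fun s' => S.Improves s s' ∧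
      s'.nat aL 0 = k + 1 ∧ S.AtLevel (S.D.strip S.t S.π τ y₁ y₂) (k + 1) (off + S.size) s' ∧
      ∀ z < S.size, S.CrossTried (S.D.strip S.t S.π τ y₁ y₂) s' k z := by
  unfold levelBody
  refine ((cross_spec hπ h hl).seq fun s₁ hk₁ ⟨i₁, t₁⟩ =>
    (merge_spec hF (h.keeps hk₁ rfl rfl) hk (hl.keeps hk₁ rfl rfl rfl rfl)).seq fun s₂ hk₂ ⟨m₁, m₂⟩ =>
    Runs.of_run (p := setN aOff (.add (nv aOff) (nv aSize)) ;;
      setN aCur (.add (nv aCur) (nv aCur)) ;; incr aL) rfl ?_).mono ?_ fun _ _ h => h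
  · have hsize : s₂.nat aSize 0 = S.size := ((h.mem.keeps hk₁ rfl).keeps hk₂ rfl).size
    have f1 : s₂.nat aCur 0 = S.F₀ * 2 ^ k := by
      rw [hk₂.nat aCur rfl, hk₁.nat aCur rfl, hl.cur]
    have f2 : s₂.nat aOff 0 = off := by rw [hk₂.nat aOff rfl, hk₁.nat aOff rfl, hl.offset]
    have f3 : s₂.nat aL 0 = k := by rw [hk₂.nat aL rfl, hk₁.nat aL rfl, hL]
    have i₂ : S.Improves s₁ s₂ := .of_keeps S hk₂ rfl rfl
    have i₃ : S.Improves s₂ ((setN aOff (.add (nv aOff) (nv aSize)) ;;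
      setN aCur (.add (nv aCur) (nv aCur)) ;; incr aL : Prog).run s₂) :=
      .of_eq S (by simp [Prog.run]) (by simp [Prog.run])
    refine ⟨(i₁.trans i₂).trans i₃, ?_, ⟨?_, ?_, fun z hz => ?_, fun z hz => ?_⟩,
      fun z hz => (t₁ z hz).mono (i₂.trans i₃)⟩
    · simp [Prog.run, NExp.eval, f3]
    · simp [Prog.run, NExp.eval, f1]; ring
    · simp [Prog.run, NExp.eval, f2, hsize]
    · rw [← m₁ z hz]; simp [Prog.run]
    · rw [← m₂ z hz]; simp [Prog.run]
  · have : (setN aOff (.add (nv aOff) (nv aSize)) ;;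
      setN aCur (.add (nv aCur) (nv aCur)) ;; incr aL : Prog).time ≤ 40 := by decide
    unfold levelCost
    nlinarith

theorem dnc_spec {S : Setting n} (hπ : Monotone ((fun i => (S.D.pt i).1) ∘ S.π))
    (hF : 0 < S.F₀) {τ y₁ y₂ : ℝ} {s : State} (h : S.Ready τ y₁ y₂ s) :
    Runs dncProg s ((S.size + 1) * ((S.lev + 1) * (levelCost + initTabBody.time + 200)))
      fun s' => S.Improves s s' ∧ ∀ k < S.lev, ∀ z < S.size,
        S.CrossTried (S.D.strip S.t S.π τ y₁ y₂) s' k z := by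
  unfold dncProg
  set l := S.D.strip S.t S.π τ y₁ y₂
  refine ((initTab_spec hF l h.mem).seq fun s₁ hk₁ ⟨m₁, m₂⟩ => ((Runs.of_loopFree (p :=
    setN aOff (.lit 0) ;; setN aCur (nv aDirs) ;; setN aL (.lit 0)) rfl s₁).seq fun s₂ hk₂ hs₂ =>
    Runs.loop (m := S.lev) (b := (S.size + 1) * levelCost)
    (fun k s' => S.Improves s s' ∧ s'.nat aL 0 = k ∧ S.AtLevel l k (k * S.size) s' ∧
      ∀ k' < k, ∀ z < S.size, S.CrossTried l s' k' z) ⟨?_, ?_, ?_, fun k' h => by omega⟩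
    (fun k hk s' hk' ⟨h1, h2, h3, h4⟩ => ⟨?_, ?_⟩) (fun s' hk' ⟨h1, h2, h3, h4⟩ => ?_))).mono ?_
    fun s' _ ⟨h1, _, _, h4⟩ => ⟨h1, h4⟩
  · exact (Setting.Improves.of_keeps S hk₁ rfl rfl).trans (.of_keeps S hk₂ rfl rfl)
  · subst hs₂; simp [Prog.run, NExp.eval]
  · have hd : s₁.nat aDirs 0 = S.F₀ := (h.mem.keeps hk₁ rfl).dirs
    refine ⟨?_, ?_, fun z hz => ?_, fun z hz => ?_⟩
    · subst hs₂; simp [Prog.run, NExp.eval, hd]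
    · subst hs₂; simp [Prog.run, NExp.eval]
    · rw [zero_mul, ← m₁ z hz]; subst hs₂; simp [Prog.run]
    · rw [zero_mul, ← m₂ z hz]; subst hs₂; simp [Prog.run]
  · have : s'.nat aLev 0 = S.lev := (((h.mem.keeps hk₁ rfl).keeps hk₂ rfl).keeps hk' rfl).lev
    simp only [Test.Holds, NExp.eval, h2, this]; omega
  · refine (levelBody_spec hπ hF (((h.keeps hk₁ rfl rfl).keeps hk₂ rfl rfl).keeps hk' rfl rfl) hk
      h2 h3).mono le_rfl fun s'' _ ⟨g1, g2, g3, g4⟩ => ⟨h1.trans g1, g2, ?_, fun k' hk'' z hz => ?_⟩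
    · rw [Nat.succ_mul]; exact g3
    · rcases Nat.lt_or_ge k' k with hlt | hle
      · exact (h4 k' hlt z hz).mono g1
      · obtain rfl : k' = k := by omega
        exact g4 z hz
  · have : s'.nat aLev 0 = S.lev := (((h.mem.keeps hk₁ rfl).keeps hk₂ rfl).keeps hk' rfl).lev
    simp only [Test.Holds, NExp.eval, h2, this]; omega
  · have : (setN aOff (.lit 0) ;; setN aCur (nv aDirs) ;; setN aL (.lit 0) : Prog).time ≤ 30 := by
      decide
    simp only [NExp.cost, Test.cost]
    nlinarith [Nat.zero_le (S.size * S.lev), Nat.zero_le (S.size * S.lev * initTabBody.time),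
      Nat.zero_le (S.lev * initTabBody.time), Nat.zero_le (S.size * levelCost)]

/-- Tries enough pairs of positions of the strip between the ordinates `rY₁` and `rY₂`: all
pairs at most `aWidth` apart, and those that approximate the others. -/
def stripProg : Prog := buildProg ;; bruteProg ;; dncProg

/-- A bound for the time that `stripProg` takes, with the width `w` of the exhaustive search. -/
def Setting.stripCost (S : Setting n) (w : ℕ) : ℕ :=
  ((n + 2) * (w + 1) + (S.size + 1) * (S.lev + 1)) *
    (buildBody.time + tryProg.time + levelCost + initTabBody.time + 500)

/-- The setting fits the accuracy `ε`, where the weights lie between `lo` and `hi`, and `κ` is a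
number of points that ensures enough support. -/
structure Setting.Fits (S : Setting n) (lo hi ε : ℝ) (κ : ℕ) : Prop where
  npos : 0 < n
  within : S.D.Within lo hi
  C_pos : 0 < S.C
  c_nonneg : 0 ≤ S.c
  eps_nonneg : 0 ≤ ε
  ratio : S.L = (hi / lo) ^ 2
  dirs_pos : 0 < S.F₀
  dirs : 4 * S.c * ((hi / lo) ^ 2) ^ 3 * (S.lev + 2) ≤ S.F₀ * n * ε
  lev : n < 2 ^ S.lev
  kappa_pos : 1 ≤ κ
  kappa : S.C * hi ≤ κ * lo
  sorted : Monotone ((fun i => (S.D.pt i).1) ∘ S.π)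

theorem Beats.mono {s : State} {v v' : ℝ} (h : Beats s v) (hv : v' ≤ v) : Beats s v' :=
  ⟨h.1, hv.trans h.2⟩

/-- The pairs of entries of the tables approximate all distant pairs. -/
theorem Setting.Fits.beats_of_crossTried {S : Setting n} {lo hi ε : ℝ} {κ : ℕ}
    (hS : S.Fits lo hi ε κ) {τ y₁ y₂ : ℝ} {s : State}
    (hlen : (S.D.strip S.t S.π τ y₁ y₂).length + κ ≤ n)
    (hcr : ∀ k < S.lev, ∀ z < S.size, S.CrossTried (S.D.strip S.t S.π τ y₁ y₂) s k z) {i j : ℕ}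
    (hi : S.D.IsCut (S.D.strip S.t S.π τ y₁ y₂) i) (hj : S.D.IsCut (S.D.strip S.t S.π τ y₁ y₂) j)
    (hij : i + 4 * κ ≤ j) :
    Beats s (S.D.disc S.c (seg (S.D.strip S.t S.π τ y₁ y₂) i j) - ε / 2) := by
  have hnod := S.D.nodup_strip S.t S.π τ y₁ y₂
  set l := S.D.strip S.t S.π τ y₁ y₂
  have hM := prefixBounds_pre hS.within.pos hS.within.m hS.npos hnod
  have hB := prefixBounds_pre hS.within.pos hS.within.b hS.npos hnod
  obtain ⟨k, hk, d, hd, z, hz, e, he, a, b, ha, hb, hzd, hca, hcb, hab, hle⟩ :=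
    exists_tab_pair hM hB hS.npos (hS.within.one_le_ratio hS.npos) hS.dirs_pos (fun p hp => hp.1)
      hlen hS.kappa_pos (by have := hS.lev; omega) hS.c_nonneg hS.dirs hi hj hij
  have htried := hcr k hk z hz d hd hzd e he
  unfold Setting.table Setting.sumM Setting.sumB at htried
  rw [hS.ratio, ← ha, ← hb] at htried
  have hκ := hS.kappa_pos
  have hcard := card_seg hnod (i := a) (j := b) hcb.1
  have hbl : b ≤ l.length := hcb.1
  have hbeats := htried (by omega) hca hcb
    (hS.within.supported hS.npos hS.kappa (by rw [hcard]; omega) (by rw [hcard]; omega))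
  refine hbeats.mono ?_
  rw [← share_seg hnod _ (by omega), ← share_seg hnod _ (by omega), ← share_seg hnod _ (by omega),
    ← share_seg hnod _ (by omega)] at hle
  unfold Data.disc
  linarith

theorem strip_spec {S : Setting n} {lo hi ε : ℝ} {κ : ℕ} (hS : S.Fits lo hi ε κ) {τ y₁ y₂ : ℝ}
    {s : State} {w : ℕ} (h : S.InMem s) (hτ : s.real rTau 0 = τ) (h₁ : s.real rY₁ 0 = y₁)
    (h₂ : s.real rY₂ 0 = y₂) (hw : s.nat aWidth 0 = w) :
    Runs stripProg s (S.stripCost w) fun s' => S.Improves s s' ∧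
      (((S.D.strip S.t S.π τ y₁ y₂).length ≤ w ∨
        (S.D.strip S.t S.π τ y₁ y₂).length + κ ≤ n ∧ 4 * κ ≤ w) →
      ∀ x₁ x₂, S.D.Supported S.C (S.D.box S.t τ x₁ x₂ y₁ y₂) →
        Beats s' (S.D.disc S.c (S.D.box S.t τ x₁ x₂ y₁ y₂) - ε / 2)) := by
  unfold stripProg
  refine ((build_spec h hτ h₁ h₂).seq fun s₁ hk₁ hr₁ => (brute_spec (w := w) hS.sorted hr₁
    (by rw [hk₁.nat aWidth rfl, hw])).seq fun s₂ hk₂ ⟨i₂, t₂⟩ =>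
    (dnc_spec hS.sorted hS.dirs_pos (hr₁.keeps hk₂ rfl rfl)).mono le_rfl
    (Q' := fun s' => S.Improves s s' ∧ (((S.D.strip S.t S.π τ y₁ y₂).length ≤ w ∨
        (S.D.strip S.t S.π τ y₁ y₂).length + κ ≤ n ∧ 4 * κ ≤ w) →
      ∀ x₁ x₂, S.D.Supported S.C (S.D.box S.t τ x₁ x₂ y₁ y₂) →
        Beats s' (S.D.disc S.c (S.D.box S.t τ x₁ x₂ y₁ y₂) - ε / 2)))
    fun s₃ hk₃ ⟨i₃, t₃⟩ => ⟨?_, fun hlen x₁ x₂ hsup => ?_⟩).mono ?_ fun _ _ h => h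
  · exact ((Setting.Improves.of_keeps S hk₁ rfl rfl).trans i₂).trans i₃
  · obtain ⟨i, j, hij, hci, hcj, hseg⟩ := S.D.exists_seg_eq_box (t := S.t) hS.sorted
      (hS.within.nonempty_of_supported hS.npos hS.C_pos hsup)
    rw [← hseg] at hsup ⊢
    by_cases hjw : j ≤ i + w
    · have := hS.eps_nonneg
      exact i₃.beats _ ((t₂ i j hij hcj.1 hjw hij hci hcj hsup).mono (by linarith))
    · have hjl := hcj.1
      rcases hlen with hlen | ⟨hlen, hκw⟩
      · omega
      · exact hS.beats_of_crossTried hlen t₃ hci hcj (by omega)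
  · unfold Setting.stripCost
    generalize buildBody.time = c1
    generalize tryProg.time = c2
    generalize levelCost = c3
    generalize initTabBody.time = c4
    generalize (S.size + 1) = N
    generalize (S.lev + 1) = M
    have h1 : 1 ≤ w + 1 := by omega
    generalize (w + 1) = W at *
    have k1 : n * (c1 + 20) + 50 ≤ (n + 2) * W * (c1 + 50) := by
      calc n * (c1 + 20) + 50 ≤ (n + 2) * 1 * (c1 + 50) := by nlinarith
        _ ≤ _ := by gcongr
    have k2 : (n + 2) * (W * (c2 + 50) + 20) ≤ (n + 2) * W * (c2 + 70) := by
      rw [mul_assoc]; gcongr; nlinarith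
    have k3 : (n + 2) * W * (c1 + 50) + (n + 2) * W * (c2 + 70) ≤
        (n + 2) * W * (c1 + c2 + c3 + c4 + 500) := by
      rw [← mul_add]; exact Nat.mul_le_mul_left _ (by omega)
    have k4 : N * (M * (c3 + c4 + 200)) ≤ N * M * (c1 + c2 + c3 + c4 + 500) := by
      rw [mul_assoc]; gcongr <;> omega
    have k5 := add_mul ((n + 2) * W) (N * M) (c1 + c2 + c3 + c4 + 500)
    omega

end Scan

/-! ### The search over the grid -/

namespace Scan

open RealRAM

variable {n : ℕ}

/-- The memory in which the strips are searched: besides the setting it holds the numbers `κ` and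
`g`, the table `G` of ordinates, and the beginning `τ` of the time window. -/
structure Setting.SearchInMem (S : Setting n) (κ g : ℕ) (G : ℕ → ℝ) (τ : ℝ) (s : State) :
    Prop where
  mem : S.InMem s
  kappa : s.nat aKappa 0 = κ
  grid : s.nat aGrid 0 = g
  ordinate : s.real rGY = G
  tau : s.real rTau 0 = τ

theorem Setting.SearchInMem.keeps {S : Setting n} {κ g : ℕ} {G : ℕ → ℝ} {τ : ℝ} {s s' : State}
    {p : Prog} (h : S.SearchInMem κ g G τ s) (hk : Keeps p s s') (hp : Prog.safe p = true)
    (h1 : p.writesNat aKappa = false) (h2 : p.writesNat aGrid = false)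
    (h3 : p.writesReal rGY = false) (h4 : p.writesReal rTau = false) :
    S.SearchInMem κ g G τ s' :=
  ⟨h.mem.keeps hk hp, by rw [hk.nat _ h1, h.kappa], by rw [hk.nat _ h2, h.grid],
    by rw [hk.real _ h3, h.ordinate], by rw [hk.real _ h4, h.tau]⟩

/-- The boxes that span a strip have been taken into account, provided that the width `w` of the
exhaustive search is large enough. -/
def Setting.StripTried (S : Setting n) (κ : ℕ) (ε τ y₁ y₂ : ℝ) (w : ℕ) (s : State) : Prop :=
  ((S.D.strip S.t S.π τ y₁ y₂).length ≤ w ∨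
    (S.D.strip S.t S.π τ y₁ y₂).length + κ ≤ n ∧ 4 * κ ≤ w) →
  ∀ x₁ x₂, S.D.Supported S.C (S.D.box S.t τ x₁ x₂ y₁ y₂) →
    Beats s (S.D.disc S.c (S.D.box S.t τ x₁ x₂ y₁ y₂) - ε / 2)

theorem Setting.StripTried.mono {S : Setting n} {κ w : ℕ} {ε τ y₁ y₂ : ℝ} {s s' : State}
    (h : S.StripTried κ ε τ y₁ y₂ w s) (hs : S.Improves s s') : S.StripTried κ ε τ y₁ y₂ w s' :=
  fun hl x₁ x₂ hsup => hs.beats _ (h hl x₁ x₂ hsup)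

/-- Searches one strip. -/
def gridInner (o we : NExp) : Prog :=
  setR rY₁ (.get rGY (nv aGa)) ;; setR rY₂ (.get rGY (.add o (nv aGb))) ;; setN aWidth we ;;
  stripProg ;; incr aGb

/-- Searches the strips with the lower boundary of number `aGa`. -/
def gridOuter (bd o we : NExp) : Prog :=
  setN aGb (.lit 0) ;; .loop (natLt (nv aGb) bd) (gridInner o we) ;; incr aGa

/-- Searches the strips between the ordinates with the numbers `a` and `o + b` in the table of
ordinates, where `a` and `b` are less than `bd`; the width of the exhaustive search is `we`. -/
def gridProg (bd o we : NExp) : Prog :=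
  setN aGa (.lit 0) ;; .loop (natLt (nv aGa) bd) (gridOuter bd o we)

section

variable {S : Setting n} {lo hi ε : ℝ} {κ g : ℕ} {G : ℕ → ℝ} {τ : ℝ} {bd o we : NExp}
  {m o' w : ℕ}

theorem setR_spec (a : ℕ) (e : RExp) (s : State) :
    Runs (setR a e) s (e.cost + 2) fun s' => s' = s.setReal a 0 (e.eval s) :=
  (Runs.of_loopFree rfl s).mono (by simp [Prog.time, NExp.cost]; omega) fun _ _ h => h

theorem gridInner_spec (hS : S.Fits lo hi ε κ)
    (ho : ∀ s, S.SearchInMem κ g G τ s → o.eval s = o')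
    (hw : ∀ s, S.SearchInMem κ g G τ s → we.eval s = w) {s : State}
    (h : S.SearchInMem κ g G τ s) {a b : ℕ} (ha : s.nat aGa 0 = a) (hb : s.nat aGb 0 = b) :
    Runs (gridInner o we) s (o.cost + we.cost + S.stripCost w + 50) fun s' => S.Improves s s' ∧
      s'.nat aGb 0 = b + 1 ∧ S.StripTried κ ε τ (G a) (G (o' + b)) w s' := by
  unfold gridInner
  refine ((setR_spec rY₁ _ s).seq fun s₁ hk₁ hs₁ => (setR_spec rY₂ _ s₁).seq fun s₂ hk₂ hs₂ =>
    (setN_spec aWidth _ s₂).seq fun s₃ hk₃ hs₃ => (strip_spec hS (w := w) (y₁ := G a)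
    (y₂ := G (o' + b)) (τ := τ) ?_ ?_ ?_ ?_ ?_).seq fun s₄ hk₄ ⟨i₄, t₄⟩ =>
    (setN_spec aGb _ s₄).mono le_rfl (Q' := fun s' => S.Improves s s' ∧ s'.nat aGb 0 = b + 1 ∧
      S.StripTried κ ε τ (G a) (G (o' + b)) w s') fun s₅ hk₅ hs₅ => ?_).mono ?_ fun _ _ h => h
  all_goals try have h₁ := h.keeps hk₁ rfl rfl rfl rfl rfl
  all_goals try have h₂ := h₁.keeps hk₂ rfl rfl rfl rfl rfl
  all_goals try have h₃ := h₂.keeps hk₃ rfl rfl rfl rfl rfl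
  · exact h₃.mem
  · exact h₃.tau
  · rw [hk₃.real rY₁ rfl, hk₂.real rY₁ rfl, hs₁]
    simp [NExp.eval, RExp.eval, ha, h.ordinate]
  · rw [hk₃.real rY₂ rfl, hs₂]
    simp only [State.setReal_real_self, RExp.eval, NExp.eval, ho _ h₁, if_true, h₁.ordinate,
      hk₁.nat aGb rfl, hb]
  · rw [hs₃]
    simp only [State.setNat_nat_self, hw _ h₂, if_true]
  · have i₃ : S.Improves s s₃ := ((Setting.Improves.of_keeps S hk₁ rfl rfl).trans
      (.of_keeps S hk₂ rfl rfl)).trans (.of_keeps S hk₃ rfl rfl)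
    have i₅ : S.Improves s₄ s₅ := .of_keeps S hk₅ rfl rfl
    refine ⟨(i₃.trans i₄).trans i₅, ?_, Setting.StripTried.mono t₄ i₅⟩
    rw [hs₅]
    simp [NExp.eval, hk₄.nat aGb rfl, hk₃.nat aGb rfl, hk₂.nat aGb rfl, hk₁.nat aGb rfl, hb]
  · simp only [NExp.cost, RExp.cost]
    omega

theorem gridOuter_spec (hS : S.Fits lo hi ε κ)
    (hbd : ∀ s, S.SearchInMem κ g G τ s → bd.eval s = m)
    (ho : ∀ s, S.SearchInMem κ g G τ s → o.eval s = o')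
    (hw : ∀ s, S.SearchInMem κ g G τ s → we.eval s = w) {s : State}
    (h : S.SearchInMem κ g G τ s) {a : ℕ} (ha : s.nat aGa 0 = a) :
    Runs (gridOuter bd o we) s ((m + 1) * (bd.cost + o.cost + we.cost + S.stripCost w + 80))
      fun s' => S.Improves s s' ∧ s'.nat aGa 0 = a + 1 ∧
      ∀ b < m, S.StripTried κ ε τ (G a) (G (o' + b)) w s' := by
  unfold gridOuter
  refine ((setN_spec aGb _ s).seq fun s₁ hk₁ hs₁ => (Runs.loop (m := m) (s := s₁)
    (b := o.cost + we.cost + S.stripCost w + 50) (fun b s' => S.Improves s s' ∧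
      s'.nat aGb 0 = b ∧ ∀ b' < b, S.StripTried κ ε τ (G a) (G (o' + b')) w s')
    ⟨.of_keeps S hk₁ rfl rfl, by rw [hs₁]; simp [NExp.eval], fun b' h => by omega⟩
    (fun b hb s' hk ⟨h1, h2, h3⟩ => ⟨?_, ?_⟩) (fun s' hk ⟨h1, h2, h3⟩ => ?_)).seq
    fun s₂ hk₂ ⟨i₂, _, t₂⟩ => (setN_spec aGa _ s₂).mono le_rfl (Q' := fun s' => S.Improves s s' ∧
      s'.nat aGa 0 = a + 1 ∧ ∀ b < m, S.StripTried κ ε τ (G a) (G (o' + b)) w s')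
      fun s₃ hk₃ hs₃ => ?_).mono ?_ fun _ _ h => h
  · have := hbd _ ((h.keeps hk₁ rfl rfl rfl rfl rfl).keeps hk rfl rfl rfl rfl rfl)
    simp only [Test.Holds, NExp.eval, h2, this]; omega
  · refine (gridInner_spec (a := a) hS ho hw ((h.keeps hk₁ rfl rfl rfl rfl rfl).keeps hk rfl rfl rfl rfl
      rfl) (by rw [hk.nat aGa rfl, hk₁.nat aGa rfl, ha]) h2).mono le_rfl
      fun s'' _ ⟨g1, g2, g3⟩ => ⟨h1.trans g1, g2, fun b' hb' => ?_⟩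
    rcases Nat.lt_or_ge b' b with hlt | hle
    · exact (h3 b' hlt).mono g1
    · obtain rfl : b' = b := by omega
      exact g3
  · have := hbd _ ((h.keeps hk₁ rfl rfl rfl rfl rfl).keeps hk rfl rfl rfl rfl rfl)
    simp only [Test.Holds, NExp.eval, h2, this]; omega
  · have i₃ : S.Improves s₂ s₃ := .of_keeps S hk₃ rfl rfl
    refine ⟨i₂.trans i₃, ?_, fun b hb => (t₂ b hb).mono i₃⟩
    rw [hs₃]
    simp [NExp.eval, hk₂.nat aGa rfl, hk₁.nat aGa rfl, ha]
  · simp only [NExp.cost, Test.cost]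
    ring_nf
    omega

theorem grid_spec (hS : S.Fits lo hi ε κ)
    (hbd : ∀ s, S.SearchInMem κ g G τ s → bd.eval s = m)
    (ho : ∀ s, S.SearchInMem κ g G τ s → o.eval s = o')
    (hw : ∀ s, S.SearchInMem κ g G τ s → we.eval s = w) {s : State}
    (h : S.SearchInMem κ g G τ s) :
    Runs (gridProg bd o we) s
      ((m + 1) * ((m + 1) * (bd.cost + o.cost + we.cost + S.stripCost w + 100)))
      fun s' => S.Improves s s' ∧
      ∀ a < m, ∀ b < m, S.StripTried κ ε τ (G a) (G (o' + b)) w s' := by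
  unfold gridProg
  refine ((setN_spec aGa _ s).seq fun s₁ hk₁ hs₁ => Runs.loop (m := m) (s := s₁)
    (b := (m + 1) * (bd.cost + o.cost + we.cost + S.stripCost w + 80))
    (fun a s' => S.Improves s s' ∧ s'.nat aGa 0 = a ∧
      ∀ a' < a, ∀ b < m, S.StripTried κ ε τ (G a') (G (o' + b)) w s')
    ⟨.of_keeps S hk₁ rfl rfl, by rw [hs₁]; simp [NExp.eval], fun b' h => by omega⟩
    (fun a ha s' hk ⟨h1, h2, h3⟩ => ⟨?_, ?_⟩) (fun s' hk ⟨h1, h2, h3⟩ => ?_)).mono ?_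
    fun s' _ ⟨h1, _, h3⟩ => ⟨h1, h3⟩
  · have := hbd _ ((h.keeps hk₁ rfl rfl rfl rfl rfl).keeps hk rfl rfl rfl rfl rfl)
    simp only [Test.Holds, NExp.eval, h2, this]; omega
  · refine (gridOuter_spec hS hbd ho hw ((h.keeps hk₁ rfl rfl rfl rfl rfl).keeps hk rfl rfl rfl
      rfl rfl) h2).mono le_rfl
      fun s'' _ ⟨g1, g2, g3⟩ => ⟨h1.trans g1, g2, fun a' ha' b hb => ?_⟩
    rcases Nat.lt_or_ge a' a with hlt | hle
    · exact (h3 a' hlt b hb).mono g1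
    · obtain rfl : a' = a := by omega
      exact g3 b hb
  · have := hbd _ ((h.keeps hk₁ rfl rfl rfl rfl rfl).keeps hk rfl rfl rfl rfl rfl)
    simp only [Test.Holds, NExp.eval, h2, this]; omega
  · simp only [NExp.cost, Test.cost]
    generalize S.stripCost w = X
    nlinarith [Nat.zero_le (m * m), Nat.zero_le (m * bd.cost)]

end

/-- `4 * κ`. -/
def fourKappa : NExp :=
  .add (.add (nv aKappa) (nv aKappa)) (.add (nv aKappa) (nv aKappa))

/-- Searches the boxes for the time window that begins at `rTau`. Strips that may contain almost
all points have their boundaries at one of the first and one of the last `κ` ordinates, and are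
searched exhaustively. -/
def searchProg : Prog :=
  gridProg (nv aKappa) (nv aKappa) (nv aN) ;; gridProg (nv aGrid) (.lit 0) fourKappa

/-- A bound for the time that `searchProg` takes. -/
def Setting.searchCost (S : Setting n) (κ g : ℕ) : ℕ :=
  (κ + 1) * ((κ + 1) * (S.stripCost n + 150)) + (g + 1) * ((g + 1) * (S.stripCost (4 * κ) + 150))

/-- The table `G` of ordinates contains the ordinates of the grid positions, and begins with the
first and the last `κ` ordinates. -/
structure Setting.Covers (S : Setting n) (κ g st : ℕ) (G : ℕ → ℝ) (π : Equiv.Perm (Fin n)) :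
    Prop where
  grid : ∀ q : Fin n, Grid n κ st q → ∃ a < g, G a = S.D.yAt π q
  first : ∀ q : Fin n, (q : ℕ) < κ → ∃ a < κ, G a = S.D.yAt π q
  last : ∀ q : Fin n, n ≤ q + κ → ∃ a < κ, G (κ + a) = S.D.yAt π q

/-- Together the two searches cover a suitable grid box for each supported box: the first one those
for which the strip may contain almost all points, the second one the others. -/
theorem search_spec {S : Setting n} {lo hi ε : ℝ} {κ g st : ℕ} {G : ℕ → ℝ} {τ : ℝ}
    (hS : S.Fits lo hi ε κ) {π : Equiv.Perm (Fin n)} (hπ : Monotone (S.D.yAt π))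
    (hst : st = 1 ∨ κ ≤ st ∧ 4 * st ≤ n ∧ 24 * S.c * ((hi / lo) ^ 2) ^ 3 * st ≤ ε * n)
    (hG : S.Covers κ g st G π) {s : State} (h : S.SearchInMem κ g G τ s) :
    Runs searchProg s (S.searchCost κ g) fun s' => S.Improves s s' ∧
      ∀ x₁ x₂ y₁ y₂, S.D.Supported S.C (S.D.box S.t τ x₁ x₂ y₁ y₂) →
        Beats s' (S.D.disc S.c (S.D.box S.t τ x₁ x₂ y₁ y₂) - ε) := by
  unfold searchProg
  refine ((grid_spec hS (bd := nv aKappa) (o := nv aKappa) (we := nv aN) (m := κ)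
    (o' := κ) (w := n) (fun s h => h.kappa) (fun s h => h.kappa)
    (fun s h => h.mem.num) h).seq fun s₁ hk₁ ⟨i₁, t₁⟩ => (grid_spec hS (bd := nv aGrid)
    (o := .lit 0) (we := fourKappa) (m := g) (o' := 0) (w := 4 * κ) (fun s h => h.grid) (fun s h => rfl) ?_
    (h.keeps hk₁ rfl rfl rfl rfl rfl)).mono le_rfl (Q' := fun s' => S.Improves s s' ∧
      ∀ x₁ x₂ y₁ y₂, S.D.Supported S.C (S.D.box S.t τ x₁ x₂ y₁ y₂) →
        Beats s' (S.D.disc S.c (S.D.box S.t τ x₁ x₂ y₁ y₂) - ε))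
    fun s₂ hk₂ ⟨i₂, t₂⟩ => ⟨i₁.trans i₂, fun x₁ x₂ y₁ y₂ hA => ?_⟩).mono ?_ fun _ _ h => h
  · intro s h
    simp only [fourKappa, NExp.eval, h.kappa]; omega
  · obtain ⟨u, v, huv, hsup, hle⟩ := exists_grid_box hS.within hS.npos hS.C_pos hS.c_nonneg
      hS.kappa hS.kappa_pos hπ hS.eps_nonneg hst S.π hA
    rcases huv with ⟨hu, hv, hlen⟩ | ⟨hu, hv⟩
    · obtain ⟨a, ha, hau⟩ := hG.grid u hu
      obtain ⟨b, hb, hbv⟩ := hG.grid v hv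
      have := t₂ a ha b hb
      rw [zero_add, hau, hbv] at this
      exact (this (.inr ⟨hlen, le_rfl⟩) x₁ x₂ hsup).mono (by linarith)
    · obtain ⟨a, ha, hau⟩ := hG.first u hu
      obtain ⟨b, hb, hbv⟩ := hG.last v hv
      have := t₁ a ha b hb
      rw [hau, hbv] at this
      exact i₂.beats _ ((this (.inl (S.D.length_strip_le _ _ _ _ _)) x₁ x₂ hsup).mono
        (by linarith))
  · unfold Setting.searchCost
    simp only [NExp.cost, fourKappa]
    exact Nat.add_le_add
      (Nat.mul_le_mul_left _ (Nat.mul_le_mul_left _ (by omega)))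
      (Nat.mul_le_mul_left _ (Nat.mul_le_mul_left _ (by omega)))

end Scan

/-! ### Preparing the search: scalars -/

namespace Scan

open RealRAM

variable {n : ℕ}

/-- The memory holds the input. -/
structure InputInMem (D : Data n) (t : Fin n → ℝ) (ε C c : ℝ) (s : State) : Prop where
  num : s.nat aN 0 = n
  eps : s.real rIn 0 = ε
  C : s.real rIn 1 = C
  c : s.real rIn 2 = c
  x : ∀ i : Fin n, s.real rX i = (D.pt i).1
  y : ∀ i : Fin n, s.real rY i = (D.pt i).2
  m : ∀ i : Fin n, s.real rM i = D.m i
  b : ∀ i : Fin n, s.real rB i = D.b i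
  t : ∀ i : Fin n, s.real rT i = t i

theorem inputInMem_input (D : Data n) (t : Fin n → ℝ) (ε C c : ℝ) :
    InputInMem D t ε C c (input D t ε C c) := by
  constructor
  · simp [input]
  · rfl
  · rfl
  · rfl
  all_goals
    intro i
    simp [input, arrayOf, i.2]

/-- A program that assigns to none of the arrays of the input. -/
def Prog.inputSafe (p : Prog) : Bool :=
  !(p.writesNat aN || p.writesReal rIn || p.writesReal rX || p.writesReal rY ||
    p.writesReal rM || p.writesReal rB || p.writesReal rT)

theorem InputInMem.keeps {D : Data n} {t : Fin n → ℝ} {ε C c : ℝ} {s s' : State} {p : Prog}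
    (h : InputInMem D t ε C c s) (hk : Keeps p s s') (hp : Prog.inputSafe p = true) :
    InputInMem D t ε C c s' := by
  simp only [Prog.inputSafe, Bool.not_eq_true', Bool.or_eq_false_iff] at hp
  obtain ⟨⟨⟨⟨⟨⟨a1, b1⟩, b2⟩, b3⟩, b4⟩, b5⟩, b6⟩ := hp
  constructor
  · rw [hk.nat _ a1]; exact h.num
  · rw [hk.real _ b1]; exact h.eps
  · rw [hk.real _ b1]; exact h.C
  · rw [hk.real _ b1]; exact h.c
  · rw [hk.real _ b2]; exact h.x
  · rw [hk.real _ b3]; exact h.y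
  · rw [hk.real _ b4]; exact h.m
  · rw [hk.real _ b5]; exact h.b
  · rw [hk.real _ b6]; exact h.t

/-- Lowers the lower bound and raises the upper bound so that `v` lies between them. -/
def boundProg (v : RExp) : Prog :=
  .ite (.realLe (rv rLo) v) .skip (setR rLo v) ;; .ite (.realLe v (rv rHi)) .skip (setR rHi v)

/-- Takes one point into account. -/
def totalsBody : Prog :=
  setR rMTot (.add (rv rMTot) (.get rM (nv aI))) ;;
  setR rBTot (.add (rv rBTot) (.get rB (nv aI))) ;;
  boundProg (.get rM (nv aI)) ;; boundProg (.get rB (nv aI)) ;; incr aI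

/-- Computes the total weights, and the least and the greatest weight. -/
def totalsProg : Prog :=
  (setN aI (.lit 0) ;; setR rMTot (.ofNat (.lit 0)) ;; setR rBTot (.ofNat (.lit 0)) ;;
    setR rLo (.get rM (.lit 0)) ;; setR rHi (.get rM (.lit 0))) ;;
  .loop (natLt (nv aI) (nv aN)) totalsBody

theorem boundProg_spec {v : RExp} {x : ℝ} {s : State} (hv : v.eval s = x)
    (hv' : ∀ y, v.eval (s.setReal rLo 0 y) = x) :
    Runs (boundProg v) s (boundProg v).time fun s' =>
      s'.real rLo 0 = min (s.real rLo 0) x ∧ s'.real rHi 0 = max (s.real rHi 0) x := by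
  refine Runs.of_run rfl ?_
  unfold boundProg
  simp only [Prog.run, Test.Holds, RExp.eval, NExp.eval]
  by_cases h1 : s.real rLo 0 ≤ x
  · by_cases h2 : x ≤ s.real rHi 0
    · simp [hv, h1, h2]
    · simp [hv, h1, h2, (not_le.1 h2).le]
  · by_cases h2 : x ≤ s.real rHi 0
    · simp [hv, hv', h1, h2, (not_le.1 h1).le]
    · simp [hv, hv', h1, h2, (not_le.1 h2).le, (not_le.1 h1).le]

/-- The sum of the first `q` values. -/
noncomputable def partialSum (w : Fin n → ℝ) (q : ℕ) : ℝ :=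
  ∑ i ∈ Finset.univ.filter fun i : Fin n => (i : ℕ) < q, w i

theorem partialSum_zero (w : Fin n → ℝ) : partialSum w 0 = 0 := by
  simp [partialSum]

theorem partialSum_self (w : Fin n → ℝ) : partialSum w n = ∑ i, w i := by
  simp [partialSum]

theorem partialSum_succ (w : Fin n → ℝ) (q : Fin n) :
    partialSum w (q + 1) = partialSum w q + w q := by
  unfold partialSum
  have : (Finset.univ.filter fun i : Fin n => (i : ℕ) < q + 1) =
      insert q (Finset.univ.filter fun i : Fin n => (i : ℕ) < q) := by
    ext i
    simp only [Finset.mem_filter, Finset.mem_univ, true_and, Finset.mem_insert, Fin.ext_iff]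
    omega
  rw [this, Finset.sum_insert (by simp), add_comm]

theorem totals_spec {D : Data n} {t : Fin n → ℝ} {ε C c : ℝ} {s : State}
    (h : InputInMem D t ε C c s) (hn : 0 < n) {c₁ c₂ : ℝ} (hD : D.Bounded c₁ c₂) :
    Runs totalsProg s (n * (totalsBody.time + 20) + 60) fun s' =>
      s'.real rMTot 0 = ∑ i, D.m i ∧ s'.real rBTot 0 = ∑ i, D.b i ∧
      c₁ ≤ s'.real rLo 0 ∧ s'.real rHi 0 ≤ c₂ ∧
      (∀ i, s'.real rLo 0 ≤ D.m i ∧ D.m i ≤ s'.real rHi 0) ∧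
      ∀ i, s'.real rLo 0 ≤ D.b i ∧ D.b i ≤ s'.real rHi 0 := by
  unfold totalsProg
  have h0 := h.m ⟨0, hn⟩
  refine ((Runs.of_loopFree rfl s).seq fun s₁ hk₁ hs₁ => Runs.loop (m := n)
    (b := totalsBody.time) (fun q s' => s'.nat aI 0 = q ∧ s'.real rMTot 0 = partialSum D.m q ∧
      s'.real rBTot 0 = partialSum D.b q ∧ c₁ ≤ s'.real rLo 0 ∧ s'.real rHi 0 ≤ c₂ ∧
      ∀ i : Fin n, (i : ℕ) < q → (s'.real rLo 0 ≤ D.m i ∧ D.m i ≤ s'.real rHi 0) ∧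
        s'.real rLo 0 ≤ D.b i ∧ D.b i ≤ s'.real rHi 0)
    ⟨?_, ?_, ?_, ?_, ?_, fun i hi => by omega⟩
    (fun q hq s' hk ⟨h1, h2, h3, h4, h5, h6⟩ => ⟨?_, ?_⟩) (fun s' hk ⟨h1, _⟩ => ?_)).mono ?_
    fun s' _ ⟨_, h2, h3, h4, h5, h6⟩ => ⟨?_, ?_, h4, h5, fun i => (h6 i i.2).1,
      fun i => (h6 i i.2).2⟩
  · subst hs₁; simp [Prog.run, NExp.eval]
  · subst hs₁; simp [Prog.run, NExp.eval, RExp.eval, partialSum_zero]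
  · subst hs₁; simp [Prog.run, NExp.eval, RExp.eval, partialSum_zero]
  · subst hs₁; simpa [Prog.run, NExp.eval, RExp.eval, h0] using (hD ⟨0, hn⟩).1.1
  · subst hs₁; simpa [Prog.run, NExp.eval, RExp.eval, h0] using (hD ⟨0, hn⟩).1.2
  · have := ((h.keeps hk₁ rfl).keeps hk rfl).num
    simp only [Test.Holds, NExp.eval, h1, this]; omega
  · have hi := (h.keeps hk₁ rfl).keeps hk rfl
    have hm := hi.m ⟨q, hq⟩
    have hb := hi.b ⟨q, hq⟩
    unfold totalsBody
    refine ((setR_spec rMTot _ s').seq fun s₂ hk₂ hs₂ => (setR_spec rBTot _ s₂).seq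
      fun s₃ hk₃ hs₃ => (boundProg_spec (x := D.m ⟨q, hq⟩) ?_ fun y => ?_).seq
      fun s₄ hk₄ ⟨l₄, u₄⟩ => (boundProg_spec (x := D.b ⟨q, hq⟩) ?_ fun y => ?_).seq
      fun s₅ hk₅ ⟨l₅, u₅⟩ => (setN_spec aI _ s₅).mono le_rfl fun s₆ hk₆ hs₆ => ?_).mono ?_
      fun _ _ h => h
    · subst hs₃ hs₂; simp [RExp.eval, NExp.eval, h1, hm]
    · subst hs₃ hs₂; simp [RExp.eval, NExp.eval, h1, hm]
    · simp [RExp.eval, NExp.eval, hk₄.nat aI rfl, hk₃.nat aI rfl, hk₂.nat aI rfl, h1,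
        hk₄.real rB rfl, hk₃.real rB rfl, hk₂.real rB rfl, hb]
    · simp [RExp.eval, NExp.eval, hk₄.nat aI rfl, hk₃.nat aI rfl, hk₂.nat aI rfl, h1,
        hk₄.real rB rfl, hk₃.real rB rfl, hk₂.real rB rfl, hb]
    · rw [hk₃.real rLo rfl, hk₂.real rLo rfl] at l₄
      rw [hk₃.real rHi rfl, hk₂.real rHi rfl] at u₄
      rw [l₄] at l₅
      rw [u₄] at u₅
      have hDq := hD ⟨q, hq⟩
      rw [hk₆.real rLo rfl, hk₆.real rHi rfl, l₅, u₅]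
      refine ⟨?_, ?_, ?_, le_min (le_min h4 hDq.1.1) hDq.2.1, max_le (max_le h5 hDq.1.2) hDq.2.2,
        fun i hi' => ?_⟩
      · subst hs₆
        simp [NExp.eval, hk₅.nat aI rfl, hk₄.nat aI rfl, hk₃.nat aI rfl, hk₂.nat aI rfl, h1]
      · rw [hk₆.real rMTot rfl, hk₅.real rMTot rfl, hk₄.real rMTot rfl, hk₃.real rMTot rfl, hs₂]
        simp [RExp.eval, NExp.eval, h1, hm, h2, partialSum_succ D.m ⟨q, hq⟩]
      · rw [hk₆.real rBTot rfl, hk₅.real rBTot rfl, hk₄.real rBTot rfl, hs₃, hs₂]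
        simp [RExp.eval, NExp.eval, h1, hb, h3, partialSum_succ D.b ⟨q, hq⟩]
      · rcases Nat.lt_or_ge i q with hlt | hle
        · obtain ⟨⟨k1, k2⟩, k3, k4⟩ := h6 i hlt
          simp only [min_le_iff, le_max_iff]
          tauto
        · obtain rfl : i = ⟨q, hq⟩ := Fin.ext (by dsimp only; omega)
          simp
    · simp only [Prog.time, NExp.cost, RExp.cost]; omega
  · have := ((h.keeps hk₁ rfl).keeps hk rfl).num
    simp only [Test.Holds, NExp.eval, h1, this]; omega
  · have : (setN aI (.lit 0) ;; setR rMTot (.ofNat (.lit 0)) ;; setR rBTot (.ofNat (.lit 0)) ;;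
      setR rLo (.get rM (.lit 0)) ;; setR rHi (.get rM (.lit 0)) : Prog).time ≤ 30 := by decide
    simp only [NExp.cost, Test.cost]
    nlinarith
  · rw [h2, partialSum_self]
  · rw [h3, partialSum_self]

/-- Assigns to the variable `a` the first value, from `k` on, for which the test fails. -/
def firstProg (a k : ℕ) (t : Test) : Prog := setN a (.lit k) ;; .loop t (incr a)

theorem first_spec {t : Test} {a k : ℕ} {P : ℕ → Prop} {s : State}
    (ht : ∀ v, t.Holds (s.setNat a 0 v) ↔ ¬ P v) (hP : ∃ v, k ≤ v ∧ P v) :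
    ∃ v, k ≤ v ∧ P v ∧ (∀ u, k ≤ u → u < v → ¬ P u) ∧
      Runs (firstProg a k t) s ((v + 1) * (t.cost + 10)) fun s' => s' = s.setNat a 0 v := by
  have hset : ∀ u v, (s.setNat a 0 u).setNat a 0 v = s.setNat a 0 v := by
    intro u v; simp [State.setNat]
  have hval : (s.setNat a 0 k).nat a 0 = k := by simp
  obtain ⟨v, h1, h2, h3, h4⟩ := Runs.linearSearch (t := t) (a := a) (P := P)
    (s := s.setNat a 0 k) (fun v => by rw [hset, ht]) (by rwa [hval])
  rw [hval] at h1 h3 h4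
  refine ⟨v, h1, h2, h3, ((setN_spec a _ s).seq (U := (v - k) * (t.cost + 7) + (t.cost + 1))
    (R := fun s' => s' = s.setNat a 0 v) fun s₁ _ hs₁ => ?_).mono ?_ fun _ _ h => h⟩
  · subst hs₁
    simpa only [hset, NExp.eval] using h4
  · simp only [NExp.cost]
    have : (v - k) * (t.cost + 7) ≤ v * (t.cost + 10) := Nat.mul_le_mul (by omega) (by omega)
    rw [add_mul]
    omega

/-- Computes `κ`, the least positive number with `C * hi ≤ κ * lo`. -/
def kappaProg : Prog :=
  firstProg aKappa 1 (.not (.realLe (.mul (.get rIn (.lit 1)) (rv rHi))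
    (.mul (.ofNat (nv aKappa)) (rv rLo))))

theorem kappa_spec {D : Data n} {t : Fin n → ℝ} {ε C c lo hi : ℝ} {s : State}
    (h : InputInMem D t ε C c s) (hlo : s.real rLo 0 = lo) (hhi : s.real rHi 0 = hi)
    (hpos : 0 < lo) (hC : 0 ≤ C * hi) :
    ∃ κ : ℕ, 1 ≤ κ ∧ C * hi ≤ κ * lo ∧ κ ≤ C * hi / lo + 1 ∧
      Runs kappaProg s ((κ + 1) * 30) fun s' => s'.nat aKappa 0 = κ := by
  obtain ⟨κ, h1, h2, h3, h4⟩ := first_spec (a := aKappa) (k := 1) (s := s)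
    (t := .not (.realLe (.mul (.get rIn (.lit 1)) (rv rHi))
      (.mul (.ofNat (nv aKappa)) (rv rLo)))) (P := fun v => C * hi ≤ v * lo)
    (fun v => by simp [Test.Holds, RExp.eval, NExp.eval, h.C, hlo, hhi])
    (by
      obtain ⟨v, hv⟩ := exists_nat_ge (C * hi / lo)
      refine ⟨v + 1, by omega, ?_⟩
      rw [div_le_iff₀ hpos] at hv
      push_cast
      linarith)
  refine ⟨κ, h1, h2, ?_, h4.mono (Nat.mul_le_mul_left _ (by
    simp only [Test.cost, RExp.cost, NExp.cost]; omega)) fun s' _ hs => by rw [hs]; simp⟩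
  rcases Nat.eq_or_lt_of_le h1 with h5 | h5
  · rw [← h5]
    have : 0 ≤ C * hi / lo := by positivity
    push_cast
    linarith
  · have := h3 (κ - 1) (by omega) (by omega)
    rw [not_le, ← lt_div_iff₀ hpos, Nat.cast_sub h1] at this
    push_cast at this
    linarith

/-- Computes the number of levels, the least `k` with `n < 2 ^ k`. -/
def levProg : Prog :=
  (setN aLev (.lit 0) ;; setN aI (.lit 1)) ;;
  .loop (.natLe (nv aI) (nv aN)) (setN aI (.add (nv aI) (nv aI)) ;; incr aLev)

theorem lev_spec {s : State} (hn : 0 < n) (h : s.nat aN 0 = n) :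
    Runs levProg s ((Nat.log 2 n + 1) * 30 + 20) fun s' => s'.nat aLev 0 = Nat.log 2 n + 1 := by
  unfold levProg
  refine ((Runs.of_loopFree rfl s).seq fun s₁ hk₁ hs₁ => Runs.loop (m := Nat.log 2 n + 1)
    (b := 20) (fun k s' => s'.nat aI 0 = 2 ^ k ∧ s'.nat aLev 0 = k) ⟨?_, ?_⟩
    (fun k hk s' hk' ⟨h1, h2⟩ => ⟨?_, Runs.of_run rfl ?_ |>.mono (by decide) fun _ _ h => h⟩)
    fun s' hk' ⟨h1, h2⟩ => ?_).mono
    ?_ fun s' _ hs => hs.2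
  · subst hs₁; simp [Prog.run, NExp.eval]
  · subst hs₁; simp [Prog.run, NExp.eval]
  · simp only [Test.Holds, NExp.eval, h1, hk'.nat aN rfl, hk₁.nat aN rfl, h]
    exact (Nat.le_log_iff_pow_le one_lt_two hn.ne').1 (by omega)
  · simp [Prog.run, NExp.eval, h1, h2, pow_succ, mul_two]
  · simp only [Test.Holds, NExp.eval, h1, hk'.nat aN rfl, hk₁.nat aN rfl, h, not_le]
    exact Nat.lt_pow_succ_log_self one_lt_two n
  · simp only [Prog.time, NExp.cost, Test.cost]; omega

/-- The number `L ^ 3`, where `L` bounds the slopes `σ`. -/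
def cubeExp : RExp := .mul (.mul (rv rRatio) (rv rRatio)) (rv rRatio)

/-- Computes the number `F₀` of directions on level 0. It is the least one that keeps the error of
`exists_tab_pair` below the allowed amount. -/
def dirsProg : Prog :=
  firstProg aDirs 1 (.not (.realLe
    (.mul (.mul (.mul (.ofNat (.lit 4)) (.get rIn (.lit 2))) cubeExp)
      (.ofNat (.add (nv aLev) (.lit 2))))
    (.mul (.mul (.ofNat (nv aDirs)) (.ofNat (nv aN))) (rv rEps))))

theorem dirs_spec {D : Data n} {t : Fin n → ℝ} {ε C c L e : ℝ} {lev : ℕ} {s : State}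
    (h : InputInMem D t ε C c s) (hn : 0 < n) (hL : s.real rRatio 0 = L) (he : s.real rEps 0 = e)
    (hlev : s.nat aLev 0 = lev) (hpos : 0 < e) (hc : 0 ≤ c) (hL0 : 0 ≤ L) :
    ∃ F : ℕ, 0 < F ∧ 4 * c * L ^ 3 * (lev + 2) ≤ F * n * e ∧
      (F : ℝ) ≤ 4 * c * L ^ 3 * (lev + 2) / (n * e) + 1 ∧
      Runs dirsProg s ((F + 1) * 50) fun s' => s'.nat aDirs 0 = F := by
  have hne : 0 < n * e := mul_pos (by exact_mod_cast hn) hpos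
  obtain ⟨F, h1, h2, h3, h4⟩ := first_spec (a := aDirs) (k := 1) (s := s)
    (t := .not (.realLe
      (.mul (.mul (.mul (.ofNat (.lit 4)) (.get rIn (.lit 2))) cubeExp)
        (.ofNat (.add (nv aLev) (.lit 2))))
      (.mul (.mul (.ofNat (nv aDirs)) (.ofNat (nv aN))) (rv rEps))))
    (P := fun v => 4 * c * L ^ 3 * (lev + 2) ≤ v * n * e)
    (fun v => by
      simp [Test.Holds, RExp.eval, NExp.eval, cubeExp, h.c, hL, he, hlev, h.num, pow_succ])
    (by
      obtain ⟨v, hv⟩ := exists_nat_ge (4 * c * L ^ 3 * (lev + 2) / (n * e))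
      refine ⟨v + 1, by omega, ?_⟩
      rw [div_le_iff₀ hne] at hv
      push_cast
      linarith)
  refine ⟨F, h1, h2, ?_, h4.mono (Nat.mul_le_mul_left _ (by
    simp only [Test.cost, RExp.cost, NExp.cost, cubeExp]; omega)) fun s' _ hs => by rw [hs]; simp⟩
  rcases Nat.eq_or_lt_of_le h1 with h5 | h5
  · rw [← h5]
    have : 0 ≤ 4 * c * L ^ 3 * (lev + 2) / (n * e) := by positivity
    push_cast
    linarith
  · have := h3 (F - 1) (by omega) (by omega)
    rw [not_le, mul_assoc, ← lt_div_iff₀ hne, Nat.cast_sub h1] at this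
    push_cast at this
    linarith

/-- Computes the size `F₀ * 2 ^ lev` of the tables by repeated doubling. -/
def sizeProg : Prog :=
  (setN aSize (nv aDirs) ;; setN aI (.lit 0)) ;;
  .loop (natLt (nv aI) (nv aLev)) (setN aSize (.add (nv aSize) (nv aSize)) ;; incr aI)

theorem size_spec {s : State} {F lev : ℕ} (hF : s.nat aDirs 0 = F) (hlev : s.nat aLev 0 = lev) :
    Runs sizeProg s (lev * 30 + 30) fun s' => s'.nat aSize 0 = F * 2 ^ lev := by
  unfold sizeProg
  refine ((Runs.of_loopFree rfl s).seq fun s₁ hk₁ hs₁ => Runs.loop (m := lev)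
    (b := 20) (fun k s' => s'.nat aSize 0 = F * 2 ^ k ∧ s'.nat aI 0 = k) ⟨?_, ?_⟩
    (fun k hk s' hk' ⟨h1, h2⟩ => ⟨?_, Runs.of_run rfl ?_ |>.mono (by decide) fun _ _ h => h⟩)
    fun s' hk' ⟨h1, h2⟩ => ?_).mono
    ?_ fun s' _ hs => hs.1
  · subst hs₁; simp [Prog.run, NExp.eval, hF]
  · subst hs₁; simp [Prog.run, NExp.eval]
  · simp only [Test.Holds, NExp.eval, h2, hk'.nat aLev rfl, hk₁.nat aLev rfl, hlev]; omega
  · simp [Prog.run, NExp.eval, h1, h2]; ring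
  · simp only [Test.Holds, NExp.eval, h2, hk'.nat aLev rfl, hk₁.nat aLev rfl, hlev]; omega
  · simp only [Prog.time, NExp.cost, Test.cost]; omega

/-- The factor `Q` such that a spacing of the grid with `st * Q ≤ ε * n` is fine enough. -/
def spacingExp : RExp :=
  .add (.ofNat (.lit 4)) (.mul (.mul (.ofNat (.lit 24)) (.get rIn (.lit 2))) cubeExp)

/-- Computes the spacing of the grid; where it would be less than `κ`, all ordinates are used. -/
def stepProg : Prog :=
  firstProg aStep 0 (.realLe (.mul (.ofNat (.add (nv aStep) (.lit 1))) spacingExp)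
    (.mul (rv rEps) (.ofNat (nv aN)))) ;;
  .ite (.natLe (nv aKappa) (nv aStep)) .skip (setN aStep (.lit 1))

theorem step_spec {D : Data n} {t : Fin n → ℝ} {ε C c L e : ℝ} {κ : ℕ} {s : State}
    (h : InputInMem D t ε C c s) (hL : s.real rRatio 0 = L) (he : s.real rEps 0 = e)
    (hκ : s.nat aKappa 0 = κ) (hκ1 : 1 ≤ κ) (hpos : 0 < e) (he1 : e ≤ 1) (hc : 0 ≤ c)
    (hL0 : 0 ≤ L) :
    ∃ st : ℕ, 0 < st ∧ (st = 1 ∨ κ ≤ st ∧ 4 * st ≤ n ∧ 24 * c * L ^ 3 * st ≤ e * n) ∧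
      e * n ≤ 2 * κ * (4 + 24 * c * L ^ 3) * st ∧
      Runs stepProg s ((n + 2) * 60) fun s' => s'.nat aStep 0 = st := by
  have hL3 : 0 ≤ 24 * c * L ^ 3 := by positivity
  have hn0 : (0 : ℝ) ≤ n := by positivity
  set Q : ℝ := 4 + 24 * c * L ^ 3 with hQ
  obtain ⟨v, -, h2, h3, h4⟩ := first_spec (a := aStep) (k := 0) (s := s)
    (t := .realLe (.mul (.ofNat (.add (nv aStep) (.lit 1))) spacingExp)
      (.mul (rv rEps) (.ofNat (nv aN))))
    (P := fun v => e * n < (v + 1) * Q)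
    (fun v => by
      simp [Test.Holds, RExp.eval, NExp.eval, spacingExp, cubeExp, h.c, hL, he, h.num, hQ,
        pow_succ])
    (by
      obtain ⟨v, hv⟩ := exists_nat_ge (e * n)
      refine ⟨v, by omega, ?_⟩
      have : (0 : ℝ) ≤ v := by positivity
      nlinarith)
  have hvQ : v * Q ≤ e * n := by
    rcases Nat.eq_zero_or_pos v with rfl | hv
    · simp only [Nat.cast_zero, zero_mul]; positivity
    · have := h3 (v - 1) (by omega) (by omega)
      rw [not_lt, Nat.cast_sub hv] at this
      push_cast at this
      linarith
  have hv0 : (0 : ℝ) ≤ v := by positivity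
  have h4v : 4 * v ≤ n := by
    have : (4 * v : ℝ) ≤ n := by nlinarith
    exact_mod_cast this
  have hκr : (1 : ℝ) ≤ κ := by exact_mod_cast hκ1
  have hrun : ∀ st, (if κ ≤ v then v else 1) = st →
      Runs stepProg s ((n + 2) * 60) fun s' => s'.nat aStep 0 = st := by
    intro st hst
    unfold stepProg
    refine (h4.seq fun s₁ hk₁ hs₁ => Runs.of_run rfl ?_).mono ?_ fun _ _ h => h
    · have e1 : s₁.nat aStep 0 = v := by rw [hs₁]; simp
      have e2 : s₁.nat aKappa 0 = κ := by rw [hk₁.nat aKappa rfl, hκ]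
      rw [← hst]
      by_cases hκv : κ ≤ v
      · simp [Prog.run, Test.Holds, NExp.eval, e1, e2, hκv]
      · simp [Prog.run, Test.Holds, NExp.eval, e1, e2, hκv]
    · simp only [Prog.time, Test.cost, RExp.cost, NExp.cost, spacingExp, cubeExp]
      omega
  by_cases hκv : κ ≤ v
  · have hv1 : (1 : ℝ) ≤ v := by exact_mod_cast hκ1.trans hκv
    refine ⟨v, by omega, .inr ⟨hκv, h4v, ?_⟩, ?_, hrun v (if_pos hκv)⟩
    · nlinarith
    · have : (1 : ℝ) * (v * Q) ≤ κ * (v * Q) := by gcongr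
      have : Q ≤ v * Q := le_mul_of_one_le_left (by positivity) hv1
      linarith
  · have hv1 : ((v : ℝ) + 1) ≤ κ := by exact_mod_cast (not_le.1 hκv)
    refine ⟨1, one_pos, .inl rfl, ?_, hrun 1 (if_neg hκv)⟩
    have : ((v : ℝ) + 1) * Q ≤ κ * Q := by gcongr
    have : 0 ≤ κ * Q := by positivity
    push_cast
    linarith

end Scan

/-! ### Preparing the search: orders and ordinates -/

namespace Scan

open RealRAM

variable {n : ℕ}

/-- The test whether the point `aJ` comes before the point `aI` with respect to the values in the
array `r`. -/
def beforeTest (r : ℕ) : Test :=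
  .and (.realLe (.get r (nv aJ)) (.get r (nv aI)))
    (.not (.and (.realLe (.get r (nv aI)) (.get r (nv aJ))) (.natLe (nv aI) (nv aJ))))

def rankBody (r : ℕ) : Prog := .ite (beforeTest r) (incr aRank) .skip ;; incr aJ

/-- Computes the rank of the point `aI`. -/
def rankProg (r : ℕ) : Prog :=
  (setN aRank (.lit 0) ;; setN aJ (.lit 0)) ;; .loop (natLt (nv aJ) (nv aN)) (rankBody r)

/-- Sorts the points by the values in the array `r`; the array `o` receives their order. -/
def sortProg (r o : ℕ) : Prog :=
  setN aI (.lit 0) ;; .loop (natLt (nv aI) (nv aN))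
    (rankProg r ;; .setNat o (nv aRank) (nv aI) ;; incr aI)

open Classical in
theorem rank_spec {r : ℕ} {f : Fin n → ℝ} {s : State} (hn : s.nat aN 0 = n)
    (hf : ∀ i : Fin n, s.real r i = f i) {i : Fin n} (hi : s.nat aI 0 = i) :
    Runs (rankProg r) s (n * 60 + 30) fun s' => s'.nat aRank 0 = rank f i := by
  unfold rankProg
  refine ((Runs.of_loopFree rfl s).seq fun s₁ hk₁ hs₁ => Runs.loop (m := n) (b := 40)
    (fun q s' => s'.nat aJ 0 = q ∧ s'.nat aRank 0 =
      (Finset.univ.filter fun j : Fin n => (j : ℕ) < q ∧ Before f j i).card) ⟨?_, ?_⟩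
    (fun q hq s' hk ⟨h1, h2⟩ => ⟨?_, Runs.of_run rfl ?_ |>.mono ?_ fun _ _ h => h⟩)
    fun s' hk ⟨h1, h2⟩ => ?_).mono ?_ fun s' _ hs => ?_
  · subst hs₁; simp [Prog.run, NExp.eval]
  · subst hs₁; simp [Prog.run, NExp.eval]
  · simp only [Test.Holds, NExp.eval, h1, hk.nat aN rfl, hk₁.nat aN rfl, hn]; omega
  · have hr : s'.real r = s.real r := (hk.real r rfl).trans (hk₁.real r rfl)
    have hi' : s'.nat aI 0 = i := by rw [hk.nat aI rfl, hk₁.nat aI rfl, hi]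
    have hfq : s'.real r q = f ⟨q, hq⟩ := by rw [hr]; exact hf ⟨q, hq⟩
    have hfi : s'.real r i = f i := by rw [hr]; exact hf i
    have htest : (beforeTest r).Holds s' ↔ Before f ⟨q, hq⟩ i := by
      simp only [beforeTest, Test.Holds, RExp.eval, NExp.eval, h1, hi', hfq, hfi]
      rfl
    have hset : (Finset.univ.filter fun j : Fin n => (j : ℕ) < q + 1 ∧ Before f j i) =
        if Before f ⟨q, hq⟩ i then
          insert ⟨q, hq⟩ (Finset.univ.filter fun j : Fin n => (j : ℕ) < q ∧ Before f j i)
        else Finset.univ.filter fun j : Fin n => (j : ℕ) < q ∧ Before f j i := by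
      ext j
      have hj : (j : ℕ) < q + 1 ↔ j = ⟨q, hq⟩ ∨ (j : ℕ) < q := by rw [Fin.ext_iff]; dsimp only; omega
      split_ifs with hb <;> simp only [Finset.mem_filter, Finset.mem_univ, true_and,
        Finset.mem_insert, hj]
      · constructor
        · rintro ⟨h | h, h'⟩
          · exact .inl h
          · exact .inr ⟨h, h'⟩
        · rintro (rfl | ⟨h, h'⟩)
          · exact ⟨.inl rfl, hb⟩
          · exact ⟨.inr h, h'⟩
      · constructor
        · rintro ⟨rfl | h, h'⟩
          · exact absurd h' hb
          · exact ⟨h, h'⟩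
        · rintro ⟨h, h'⟩
          exact ⟨.inr h, h'⟩
    rw [hset]
    by_cases hb : Before f ⟨q, hq⟩ i
    · rw [if_pos hb, Finset.card_insert_of_notMem (by simp), ← h2]
      simp [rankBody, Prog.run, htest, hb, NExp.eval, h1]
    · rw [if_neg hb, ← h2]
      simp [rankBody, Prog.run, htest, hb, NExp.eval, h1]
  · simp [rankBody, beforeTest, Prog.time, Test.cost, RExp.cost, NExp.cost]
  · simp only [Test.Holds, NExp.eval, h1, hk.nat aN rfl, hk₁.nat aN rfl, hn]; omega
  · simp only [Prog.time, NExp.cost, Test.cost]; omega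
  · rw [hs.2]
    unfold rank
    congr 1
    ext j
    simp

theorem sort_spec {r o : ℕ} {f : Fin n → ℝ} {π : Equiv.Perm (Fin n)}
    (hπ : ∀ q, rank f (π q) = q) {s : State} (hn : s.nat aN 0 = n)
    (hf : ∀ i : Fin n, s.real r i = f i) (ho₀ : o ≠ aN) (ho₁ : o ≠ aI)
    (ho₂ : o ≠ aRank) (ho₃ : o ≠ aJ) :
    Runs (sortProg r o) s (n * (n * 60 + 60) + 20) fun s' =>
      ∀ q : Fin n, s'.nat o q = π q := by
  unfold sortProg
  refine ((setN_spec aI _ s).seq fun s₁ hk₁ hs₁ => Runs.loop (m := n) (b := n * 60 + 50)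
    (fun i s' => s'.nat aI 0 = i ∧ s'.nat aN 0 = n ∧
      ∀ i' : Fin n, (i' : ℕ) < i → s'.nat o (rank f i') = i') ⟨?_, ?_, fun i' h => by omega⟩
    (fun i hi s' hk ⟨h1, h2, h3⟩ => ⟨?_, ?_⟩)
    fun s' hk ⟨h1, h2, h3⟩ => ?_).mono ?_ fun s' _ ⟨_, _, hs⟩ q => ?_
  · subst hs₁; simp [NExp.eval]
  · rw [hk₁.nat aN rfl, hn]
  · simp only [Test.Holds, NExp.eval, h1, h2]; omega
  · have hr : s'.real r = s.real r := (hk.real r rfl).trans (hk₁.real r rfl)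
    refine ((rank_spec (i := ⟨i, hi⟩) h2 (by rwa [hr]) h1).seq fun s₂ hk₂ hs₂ =>
      Runs.of_run (p := .setNat o (nv aRank) (nv aI) ;; incr aI) rfl ?_).mono ?_ fun _ _ h => h
    · have e1 : s₂.nat aI 0 = i := by rw [hk₂.nat aI rfl, h1]
      have e2 : s₂.nat aN 0 = n := by rw [hk₂.nat aN rfl, h2]
      have e3 : s₂.nat o = s'.nat o := hk₂.nat o (by
        have h₂ : Nat.beq o aRank = false :=
          Bool.eq_false_iff.2 fun h => ho₂ (Nat.eq_of_beq_eq_true h)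
        have h₃ : Nat.beq o aJ = false :=
          Bool.eq_false_iff.2 fun h => ho₃ (Nat.eq_of_beq_eq_true h)
        simp [rankProg, rankBody, Prog.writesNat, h₂, h₃])
      refine ⟨?_, ?_, fun i' hi' => ?_⟩
      · simp [Prog.run, NExp.eval, ho₁.symm, e1]
      · simp [Prog.run, NExp.eval, ho₀.symm, e2]
      · have : (Prog.run (.setNat o (nv aRank) (nv aI) ;; incr aI) s₂).nat o =
            fun q => if q = rank f ⟨i, hi⟩ then i else s'.nat o q := by
          funext q
          simp [Prog.run, NExp.eval, ho₁, e1, e3, hs₂]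
        rw [this]
        dsimp only
        -- the ranks are distinct, so that no entry is overwritten
        split_ifs with he
        · exact (congrArg Fin.val (rank_injective f he)).symm
        · refine h3 i' (lt_of_le_of_ne (by omega) fun hii => he ?_)
          congr 1
          exact Fin.ext hii
    · simp only [Prog.time, NExp.cost]; omega
  · simp only [Test.Holds, NExp.eval, h1, h2]; omega
  · simp only [NExp.cost, Test.cost]; nlinarith
  · have := hs (π q) (π q).2
    rwa [hπ] at this

/-- `Y` of the position given by `e` in the order by ordinates. -/
def ordinateExp (e : NExp) : RExp := .get rY (.get aOrdY e)

/-- Writes the ordinates at the position `aI` and at the position `aI` from the end. -/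
def tableBody₁ : Prog :=
  .setReal rGY (nv aI) (ordinateExp (nv aI)) ;;
  .setReal rGY (.add (nv aKappa) (nv aI))
    (ordinateExp (.sub (.sub (nv aN) (.lit 1)) (nv aI))) ;; incr aI

/-- Appends the ordinate at the position `aI`, and moves on by `aStep` positions. -/
def tableBody₂ : Prog :=
  .setReal rGY (nv aGrid) (ordinateExp (nv aI)) ;; incr aGrid ;;
  setN aI (.add (nv aI) (nv aStep))

/-- Writes the table of ordinates: the first `κ` ones, the last `κ` ones, and those at the
multiples of `aStep`. -/
def tableProg : Prog :=
  (setN aI (.lit 0) ;; .loop (natLt (nv aI) (nv aKappa)) tableBody₁) ;;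
  (setN aI (.lit 0) ;; setN aGrid (.add (nv aKappa) (nv aKappa))) ;;
  .loop (natLt (nv aI) (nv aN)) tableBody₂

/-- The memory that determines the table of ordinates. -/
structure TableInput (Y : ℕ → ℝ) (n κ st : ℕ) (s : State) : Prop where
  ordinate : ∀ q, s.real rY (s.nat aOrdY q) = Y q
  num : s.nat aN 0 = n
  kappa : s.nat aKappa 0 = κ
  step : s.nat aStep 0 = st

theorem TableInput.keeps {Y : ℕ → ℝ} {n κ st : ℕ} {s s' : State} {p : Prog}
    (h : TableInput Y n κ st s) (hk : Keeps p s s') (h1 : p.writesReal rY = false)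
    (h2 : p.writesNat aOrdY = false) (h3 : p.writesNat aN = false)
    (h4 : p.writesNat aKappa = false) (h5 : p.writesNat aStep = false) :
    TableInput Y n κ st s' :=
  ⟨by rw [hk.real _ h1, hk.nat _ h2]; exact h.ordinate, by rw [hk.nat _ h3, h.num],
    by rw [hk.nat _ h4, h.kappa], by rw [hk.nat _ h5, h.step]⟩

theorem table_spec {Y : ℕ → ℝ} {n κ st : ℕ} {s : State} (hst : 0 < st)
    (h : TableInput Y n κ st s) :
    Runs tableProg s (κ * 60 + n * 50 + 60) fun s' =>
      s'.nat aGrid 0 = κ + κ + (n + st - 1) / st ∧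
      (∀ q < κ, s'.real rGY q = Y q ∧ s'.real rGY (κ + q) = Y (n - 1 - q)) ∧
      ∀ a < (n + st - 1) / st, s'.real rGY (κ + κ + a) = Y (a * st) := by
  unfold tableProg
  set m := (n + st - 1) / st with hm
  have hmst : ∀ a, a < m ↔ a * st < n := fun a => by
    rw [hm, Nat.lt_iff_add_one_le, Nat.le_div_iff_mul_le hst, add_mul]
    omega
  have hmn : m ≤ n := by
    by_contra hlt
    have := (hmst n).1 (not_le.1 hlt)
    nlinarith
  refine (((setN_spec aI _ s).seq fun s₁ hk₁ hs₁ => Runs.loop (m := κ) (b := 50)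
    (fun i s' => s'.nat aI 0 = i ∧
      ∀ q < i, s'.real rGY q = Y q ∧ s'.real rGY (κ + q) = Y (n - 1 - q))
    ⟨by subst hs₁; simp [NExp.eval], fun q hq => by omega⟩
    (fun i hi s' hk ⟨h1, h2⟩ => ⟨?_, Runs.of_run rfl ?_ |>.mono (by decide) fun _ _ h => h⟩)
    fun s' hk ⟨h1, h2⟩ => ?_).seq fun s₂ hk₂ ⟨_, h₂⟩ =>
    (Runs.of_loopFree rfl s₂).seq fun s₃ hk₃ hs₃ => Runs.loop (m := m) (b := 40)
    (fun i s' => s'.nat aI 0 = i * st ∧ s'.nat aGrid 0 = κ + κ + i ∧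
      (∀ q < κ, s'.real rGY q = Y q ∧ s'.real rGY (κ + q) = Y (n - 1 - q)) ∧
      ∀ a < i, s'.real rGY (κ + κ + a) = Y (a * st))
    ⟨?_, ?_, fun q hq => ?_, fun a ha => by omega⟩
    (fun i hi s' hk ⟨h1, h2, h3, h4⟩ =>
      ⟨?_, Runs.of_run rfl ?_ |>.mono (by decide) fun _ _ h => h⟩)
    fun s' hk ⟨h1, h2, h3, h4⟩ => ?_).mono ?_ fun s' _ hs => hs.2
  · simp only [Test.Holds, NExp.eval, h1, hk.nat aKappa rfl, hk₁.nat aKappa rfl, h.kappa]; omega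
  · have h' := (h.keeps hk₁ rfl rfl rfl rfl rfl).keeps hk rfl rfl rfl rfl rfl
    have e : (tableBody₁.run s').real rGY = fun q =>
        if q = κ + i then Y (n - 1 - i) else if q = i then Y i else s'.real rGY q := by
      funext q
      simp [tableBody₁, Prog.run, NExp.eval, RExp.eval, ordinateExp, h1, h'.kappa, h'.num,
        h'.ordinate]
    refine ⟨by simp [tableBody₁, Prog.run, NExp.eval, h1], fun q hq => ?_⟩
    rw [e]
    dsimp only
    rcases Nat.lt_or_ge q i with hlt | hle
    · rw [if_neg (by omega), if_neg (by omega), if_neg (by omega), if_neg (by omega)]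
      exact h2 q hlt
    · obtain rfl : q = i := by omega
      rw [if_neg (by omega), if_pos rfl, if_pos rfl]
      exact ⟨rfl, rfl⟩
  · simp only [Test.Holds, NExp.eval, h1, hk.nat aKappa rfl, hk₁.nat aKappa rfl, h.kappa]; omega
  · subst hs₃; simp [Prog.run, NExp.eval]
  · have := (h.keeps hk₂ rfl rfl rfl rfl rfl).kappa
    subst hs₃; simp [Prog.run, NExp.eval, this]
  · rw [hk₃.real rGY rfl]; exact h₂ q hq
  · have h' := ((h.keeps hk₂ rfl rfl rfl rfl rfl).keeps hk₃ rfl rfl rfl rfl rfl).keeps hk rfl rfl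
      rfl rfl rfl
    simp only [Test.Holds, NExp.eval, h1, h'.num]
    exact (hmst i).1 hi
  · have h' := ((h.keeps hk₂ rfl rfl rfl rfl rfl).keeps hk₃ rfl rfl rfl rfl rfl).keeps hk rfl rfl
      rfl rfl rfl
    have e : (tableBody₂.run s').real rGY = fun q =>
        if q = κ + κ + i then Y (i * st) else s'.real rGY q := by
      funext q
      simp [tableBody₂, Prog.run, NExp.eval, RExp.eval, ordinateExp, h1, h2, h'.ordinate]
    refine ⟨by simp [tableBody₂, Prog.run, NExp.eval, h1, h'.step, add_mul],
      by simp [tableBody₂, Prog.run, NExp.eval, h2, add_assoc], fun q hq => ?_, fun a ha => ?_⟩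
    · rw [e]
      dsimp only
      rw [if_neg (by omega), if_neg (by omega)]
      exact h3 q hq
    · rw [e]
      dsimp only
      rcases Nat.lt_or_ge a i with hlt | hle
      · rw [if_neg (by omega)]
        exact h4 a hlt
      · obtain rfl : a = i := by omega
        rw [if_pos rfl]
  · have h' := ((h.keeps hk₂ rfl rfl rfl rfl rfl).keeps hk₃ rfl rfl rfl rfl rfl).keeps hk rfl rfl
      rfl rfl rfl
    simp only [Test.Holds, NExp.eval, h1, h'.num]
    intro hcon
    exact absurd ((hmst m).2 (by omega)) (lt_irrefl _)
  · simp only [Prog.time, NExp.cost, Test.cost]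
    omega

/-- The accuracy `min ε 1`, and the squared ratio of the bounds for the weights. -/
def scalarsProg : Prog :=
  .ite (.realLe (.get rIn (.lit 0)) one) (setR rEps (.get rIn (.lit 0))) (setR rEps one) ;;
  setR rRatio (.mul (.div (rv rHi) (rv rLo)) (.div (rv rHi) (rv rLo)))

theorem scalars_spec {D : Data n} {t : Fin n → ℝ} {ε C c lo hi : ℝ} {s : State}
    (h : InputInMem D t ε C c s) (hlo : s.real rLo 0 = lo) (hhi : s.real rHi 0 = hi) :
    Runs scalarsProg s 40 fun s' => s'.real rEps 0 = min ε 1 ∧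
      s'.real rRatio 0 = (hi / lo) ^ 2 := by
  refine (Runs.of_run rfl ?_).mono (show scalarsProg.time ≤ 40 by decide) fun _ _ h => h
  unfold scalarsProg
  by_cases h1 : ε ≤ 1
  · simp [Prog.run, Test.Holds, RExp.eval, NExp.eval, one, h.eps, h1, hlo, hhi, pow_two]
  · simp [Prog.run, Test.Holds, RExp.eval, NExp.eval, one, h.eps, h1, hlo, hhi, pow_two,
      (not_le.1 h1).le]

/-- Computes everything that the search needs. -/
def setupProg : Prog :=
  totalsProg ;; scalarsProg ;; kappaProg ;; levProg ;; dirsProg ;; sizeProg ;; stepProg ;;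
  sortProg rX aOrdX ;; sortProg rY aOrdY ;; tableProg

/-- The results of the preparation. -/
structure Setting.Prepared (S : Setting n) (ε c₁ c₂ lo hi : ℝ) (κ g st : ℕ) (G : ℕ → ℝ)
    (π : Equiv.Perm (Fin n)) : Prop where
  fits : S.Fits lo hi (min ε 1) κ
  sorted : Monotone (S.D.yAt π)
  spacing : st = 1 ∨
    κ ≤ st ∧ 4 * st ≤ n ∧ 24 * S.c * ((hi / lo) ^ 2) ^ 3 * st ≤ min ε 1 * n
  covers : S.Covers κ g st G π
  lo_ge : c₁ ≤ lo
  hi_le : hi ≤ c₂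
  kappa_le : (κ : ℝ) ≤ S.C * hi / lo + 1
  lev_eq : S.lev = Nat.log 2 n + 1
  dirs_le : (S.F₀ : ℝ) ≤ 4 * S.c * ((hi / lo) ^ 2) ^ 3 * (S.lev + 2) / (n * min ε 1) + 1
  step_pos : 0 < st
  step_ge : min ε 1 * n ≤ 2 * κ * (4 + 24 * S.c * ((hi / lo) ^ 2) ^ 3) * st
  grid_eq : g = κ + κ + (n + st - 1) / st

/-- A bound for the time that `setupProg` takes. -/
def setupCost (n κ lev F : ℕ) : ℕ :=
  (n + 1) * (n * 120 + totalsBody.time + 500) + 90 * κ + 60 * lev + 50 * F + 500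

/-- The entries that `tableProg` writes cover the grid. -/
theorem covers_of_table {S : Setting n} {κ st : ℕ} {G : ℕ → ℝ} {π : Equiv.Perm (Fin n)}
    {Y : ℕ → ℝ} (hY : ∀ q : Fin n, Y q = S.D.yAt π q) (hst : 0 < st)
    (h1 : ∀ q < κ, G q = Y q ∧ G (κ + q) = Y (n - 1 - q))
    (h2 : ∀ a < (n + st - 1) / st, G (κ + κ + a) = Y (a * st)) :
    S.Covers κ (κ + κ + (n + st - 1) / st) st G π := by
  have hlast : ∀ q : Fin n, n ≤ q + κ → ∃ a < κ, G (κ + a) = S.D.yAt π q := fun q hq => by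
    have := q.2
    refine ⟨n - 1 - q, by omega, ?_⟩
    rw [(h1 _ (by omega)).2, ← hY]
    congr 1
    omega
  refine ⟨fun q hq => ?_, fun q hq => ⟨q, hq, by rw [(h1 q hq).1, hY]⟩, hlast⟩
  rcases hq with hq | hq | ⟨a, ha⟩
  · exact ⟨q, by rw [add_assoc]; exact Nat.lt_add_right _ hq, by rw [(h1 q hq).1, hY]⟩
  · obtain ⟨a, ha, haq⟩ := hlast q hq
    exact ⟨κ + a, Nat.lt_add_right _ (by omega), haq⟩
  · have hlt : a < (n + st - 1) / st := by
      have := q.2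
      rw [Nat.lt_iff_add_one_le, Nat.le_div_iff_mul_le hst, add_mul, mul_comm a]
      omega
    exact ⟨κ + κ + a, by omega, by rw [h2 a hlt, ← hY, mul_comm, ← ha]⟩

theorem setup_spec {D : Data n} {t : Fin n → ℝ} {ε C c c₁ c₂ : ℝ} {s : State}
    (h : InputInMem D t ε C c s) (hn : 0 < n) (hD : D.Bounded c₁ c₂) (hc₁ : 0 < c₁) (hC : 0 < C)
    (hc : 0 < c) (hε : 0 < ε) :
    ∃ (S : Setting n) (lo hi : ℝ) (κ g st : ℕ) (G : ℕ → ℝ) (π : Equiv.Perm (Fin n)),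
      (S.D = D ∧ S.t = t ∧ S.C = C ∧ S.c = c) ∧ S.Prepared ε c₁ c₂ lo hi κ g st G π ∧
      Runs setupProg s (setupCost n κ S.lev S.F₀) fun s' =>
        S.SearchInMem κ g G (s'.real rTau 0) s' := by
  obtain ⟨s₁, ⟨f1, f2, f3, f4, f5, f6⟩, hk₁, hr₁⟩ := (totals_spec h hn hD).exists_final
  have m₁ := h.keeps hk₁ rfl
  obtain ⟨lo, hlo⟩ : ∃ lo, s₁.real rLo 0 = lo := ⟨_, rfl⟩
  obtain ⟨hi, hhi⟩ : ∃ hi, s₁.real rHi 0 = hi := ⟨_, rfl⟩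
  rw [hlo] at f3
  rw [hhi] at f4
  rw [hlo, hhi] at f5 f6
  have hpos : 0 < lo := hc₁.trans_le f3
  have hwith : D.Within lo hi := ⟨hpos, f5, f6⟩
  have hhipos : 0 < hi := hpos.trans_le ((f5 ⟨0, hn⟩).1.trans (f5 ⟨0, hn⟩).2)
  obtain ⟨s₂, ⟨e1, e2⟩, hk₂, hr₂⟩ := (scalars_spec m₁ hlo hhi).exists_final
  have m₂ := m₁.keeps hk₂ rfl
  obtain ⟨κ, κ1, κ2, κ3, hrκ⟩ := kappa_spec m₂ (by rw [hk₂.real rLo rfl, hlo])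
    (by rw [hk₂.real rHi rfl, hhi]) hpos (by positivity)
  obtain ⟨s₃, e3, hk₃, hr₃⟩ := hrκ.exists_final
  have m₃ := m₂.keeps hk₃ rfl
  obtain ⟨s₄, e4, hk₄, hr₄⟩ := (lev_spec hn m₃.num).exists_final
  have m₄ := m₃.keeps hk₄ rfl
  have hε' : 0 < min ε 1 := lt_min hε one_pos
  have e2' : s₄.real rRatio 0 = (hi / lo) ^ 2 := by
    rw [hk₄.real rRatio rfl, hk₃.real rRatio rfl, e2]
  have e1' : s₄.real rEps 0 = min ε 1 := by rw [hk₄.real rEps rfl, hk₃.real rEps rfl, e1]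
  obtain ⟨F, F1, F2, F3, hrF⟩ := dirs_spec m₄ hn e2' e1' e4 hε' hc.le (by positivity)
  obtain ⟨s₅, e5, hk₅, hr₅⟩ := hrF.exists_final
  have m₅ := m₄.keeps hk₅ rfl
  obtain ⟨s₆, e6, hk₆, hr₆⟩ :=
    (size_spec e5 (by rw [hk₅.nat aLev rfl, e4])).exists_final
  have m₆ := m₅.keeps hk₆ rfl
  obtain ⟨st, st1, st2, st3, hrst⟩ := step_spec (κ := κ) m₆
    (by rw [hk₆.real rRatio rfl, hk₅.real rRatio rfl, e2'])
    (by rw [hk₆.real rEps rfl, hk₅.real rEps rfl, e1'])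
    (by rw [hk₆.nat aKappa rfl, hk₅.nat aKappa rfl, hk₄.nat aKappa rfl, e3]) κ1 hε'
    (min_le_right _ _) hc.le (by positivity)
  obtain ⟨s₇, e7, hk₇, hr₇⟩ := hrst.exists_final
  have m₇ := m₆.keeps hk₇ rfl
  obtain ⟨π, hπ, hπmono⟩ := exists_sorting fun i => (D.pt i).1
  obtain ⟨π', hπ', hπmono'⟩ := exists_sorting fun i => (D.pt i).2
  obtain ⟨s₈, e8, hk₈, hr₈⟩ := (sort_spec (o := aOrdX) hπ m₇.num m₇.x (by decide) (by decide)
    (by decide) (by decide)).exists_final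
  have m₈ := m₇.keeps hk₈ rfl
  obtain ⟨s₉, e9, hk₉, hr₉⟩ := (sort_spec (o := aOrdY) hπ' m₈.num m₈.y (by decide) (by decide)
    (by decide) (by decide)).exists_final
  have m₉ := m₈.keeps hk₉ rfl
  have hκ₉ : s₉.nat aKappa 0 = κ := by
    rw [hk₉.nat aKappa rfl, hk₈.nat aKappa rfl, hk₇.nat aKappa rfl, hk₆.nat aKappa rfl,
      hk₅.nat aKappa rfl, hk₄.nat aKappa rfl, e3]
  obtain ⟨s', ⟨t1, t2, t3⟩, hk, hr⟩ := (table_spec (n := n) (κ := κ)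
    (Y := fun q => s₉.real rY (s₉.nat aOrdY q)) st1 ⟨fun q => rfl, m₉.num, hκ₉,
      by rw [hk₉.nat aStep rfl, hk₈.nat aStep rfl, e7]⟩).exists_final
  have m' := m₉.keeps hk rfl
  refine ⟨⟨D, t, C, c, (hi / lo) ^ 2, F, Nat.log 2 n + 1, π⟩, lo, hi, κ,
    κ + κ + (n + st - 1) / st, st, s'.real rGY, π', ⟨rfl, rfl, rfl, rfl⟩, ⟨⟨hn, hwith, hC, hc.le,
      hε'.le, rfl, F1, F2, Nat.lt_pow_succ_log_self one_lt_two n, κ1, κ2, hπmono⟩, hπmono', st2,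
      covers_of_table (fun q => ?_) st1 t2 t3, f3, f4, κ3, rfl, F3, st1, st3, rfl⟩, ?_⟩
  · dsimp only
    rw [e9 q, m₉.y]
    rfl
  · refine (hr₁.seq fun _ _ h₁ => h₁ ▸ hr₂.seq fun _ _ h₂ => h₂ ▸ hr₃.seq fun _ _ h₃ =>
      h₃ ▸ hr₄.seq fun _ _ h₄ => h₄ ▸ hr₅.seq fun _ _ h₅ => h₅ ▸ hr₆.seq fun _ _ h₆ =>
      h₆ ▸ hr₇.seq fun _ _ h₇ => h₇ ▸ hr₈.seq fun _ _ h₈ => h₈ ▸ hr₉.seq fun _ _ h₉ =>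
      h₉ ▸ hr).mono ?_ fun s'' _ hs'' => ?_
    · unfold setupCost
      dsimp only
      ring_nf
      omega
    · rw [hs'']
      have d1 : s'.nat aOrdX = s₈.nat aOrdX := by
        rw [hk.nat aOrdX rfl, hk₉.nat aOrdX rfl]
      have d2 : s'.nat aDirs = s₅.nat aDirs := by
        rw [hk.nat aDirs rfl, hk₉.nat aDirs rfl, hk₈.nat aDirs rfl, hk₇.nat aDirs rfl,
          hk₆.nat aDirs rfl]
      have d3 : s'.nat aLev = s₄.nat aLev := by
        rw [hk.nat aLev rfl, hk₉.nat aLev rfl, hk₈.nat aLev rfl, hk₇.nat aLev rfl,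
          hk₆.nat aLev rfl, hk₅.nat aLev rfl]
      have d4 : s'.nat aSize = s₆.nat aSize := by
        rw [hk.nat aSize rfl, hk₉.nat aSize rfl, hk₈.nat aSize rfl, hk₇.nat aSize rfl]
      have d5 : s'.real rMTot = s₁.real rMTot := by
        rw [hk.real rMTot rfl, hk₉.real rMTot rfl, hk₈.real rMTot rfl, hk₇.real rMTot rfl,
          hk₆.real rMTot rfl, hk₅.real rMTot rfl, hk₄.real rMTot rfl, hk₃.real rMTot rfl,
          hk₂.real rMTot rfl]
      have d6 : s'.real rBTot = s₁.real rBTot := by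
        rw [hk.real rBTot rfl, hk₉.real rBTot rfl, hk₈.real rBTot rfl, hk₇.real rBTot rfl,
          hk₆.real rBTot rfl, hk₅.real rBTot rfl, hk₄.real rBTot rfl, hk₃.real rBTot rfl,
          hk₂.real rBTot rfl]
      have d7 : s'.real rRatio = s₂.real rRatio := by
        rw [hk.real rRatio rfl, hk₉.real rRatio rfl, hk₈.real rRatio rfl, hk₇.real rRatio rfl,
          hk₆.real rRatio rfl, hk₅.real rRatio rfl, hk₄.real rRatio rfl, hk₃.real rRatio rfl]
      exact ⟨⟨m'.num, fun q => by rw [d1]; exact e8 q, by rw [d2]; exact e5, by rw [d3]; exact e4,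
        by rw [d4]; exact e6, m'.x, m'.y, m'.m, m'.b, m'.t, m'.C, m'.c, by rw [d5]; exact f1,
        by rw [d6]; exact f2, by rw [d7]; exact e2⟩, by rw [hk.nat aKappa rfl, hκ₉], t1, rfl, rfl⟩

end Scan

/-! ### The two algorithms -/

namespace Scan

open RealRAM

variable {n : ℕ}

/-- Searches the boxes for the time window that begins at the timestamp of the point `e`. -/
def windowProg (e : NExp) : Prog := setR rTau (.get rT e) ;; searchProg

/-- The algorithm for rectangles. The input has constant timestamps. -/
def rectProg : Prog := setupProg ;; windowProg (.lit 0)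

/-- The algorithm for prospective time windows, which may be assumed to begin at the timestamp of
a point. -/
def prospectiveProg : Prog :=
  setupProg ;; setN aTime (.lit 0) ;;
    .loop (natLt (nv aTime) (nv aN)) (windowProg (nv aTime) ;; incr aTime)

/-- All boxes for the time window that begins at `τ` have been taken into account. -/
def Setting.WindowTried (S : Setting n) (ε τ : ℝ) (s : State) : Prop :=
  ∀ x₁ x₂ y₁ y₂, S.D.Supported S.C (S.D.box S.t τ x₁ x₂ y₁ y₂) →
    Beats s (S.D.disc S.c (S.D.box S.t τ x₁ x₂ y₁ y₂) - ε)

theorem Setting.WindowTried.mono {S : Setting n} {ε τ : ℝ} {s s' : State}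
    (h : S.WindowTried ε τ s) (hs : S.Improves s s') : S.WindowTried ε τ s' :=
  fun x₁ x₂ y₁ y₂ hsup => hs.beats _ (h x₁ x₂ y₁ y₂ hsup)

section

variable {S : Setting n} {ε c₁ c₂ lo hi : ℝ} {κ g st : ℕ} {G : ℕ → ℝ} {π : Equiv.Perm (Fin n)}

theorem window_spec (hS : S.Prepared ε c₁ c₂ lo hi κ g st G π) {s : State} {τ : ℝ}
    (h : S.SearchInMem κ g G τ s) {e : NExp} {i : Fin n} (he : e.eval s = i) :
    Runs (windowProg e) s (e.cost + S.searchCost κ g + 10) fun s' => S.Improves s s' ∧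
      S.WindowTried (min ε 1) (S.t i) s' ∧ S.SearchInMem κ g G (S.t i) s' := by
  unfold windowProg
  refine ((setR_spec rTau _ s).seq fun s₁ hk₁ hs₁ => (search_spec (τ := S.t i) hS.fits hS.sorted
    hS.spacing hS.covers ?_).mono le_rfl (Q' := fun s' => S.Improves s s' ∧
      S.WindowTried (min ε 1) (S.t i) s' ∧ S.SearchInMem κ g G (S.t i) s')
    fun s₂ hk₂ ⟨i₂, t₂⟩ => ?_).mono
    (by simp only [RExp.cost]; omega) fun _ _ h => h
  all_goals
    have h₁ : S.SearchInMem κ g G (S.t i) s₁ := ⟨h.mem.keeps hk₁ rfl,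
      by rw [hk₁.nat aKappa rfl, h.kappa], by rw [hk₁.nat aGrid rfl, h.grid],
      by rw [hk₁.real rGY rfl, h.ordinate], by rw [hs₁]; simp [RExp.eval, he, h.mem.t]⟩
  · exact h₁
  · exact ⟨(Setting.Improves.of_keeps S hk₁ rfl rfl).trans i₂, t₂,
      h₁.keeps hk₂ rfl rfl rfl rfl rfl⟩

theorem windows_spec (hS : S.Prepared ε c₁ c₂ lo hi κ g st G π) {s : State} {τ : ℝ}
    (h : S.SearchInMem κ g G τ s) :
    Runs (setN aTime (.lit 0) ;;
      .loop (natLt (nv aTime) (nv aN)) (windowProg (nv aTime) ;; incr aTime)) s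
      ((n + 1) * (S.searchCost κ g + 50)) fun s' => S.Improves s s' ∧
      ∀ i, S.WindowTried (min ε 1) (S.t i) s' := by
  refine ((setN_spec aTime _ s).seq fun s₁ hk₁ hs₁ => Runs.loop (m := n)
    (b := S.searchCost κ g + 30) (fun q s' => S.Improves s s' ∧ s'.nat aTime 0 = q ∧
      (∃ τ, S.SearchInMem κ g G τ s') ∧ ∀ i : Fin n, (i : ℕ) < q →
        S.WindowTried (min ε 1) (S.t i) s')
    ⟨.of_keeps S hk₁ rfl rfl, by rw [hs₁]; simp [NExp.eval], ⟨τ, h.keeps hk₁ rfl rfl rfl rfl rfl⟩,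
      fun i hi => by omega⟩
    (fun q hq s' hk ⟨h1, h2, ⟨τ', h3⟩, h4⟩ => ⟨?_, ?_⟩)
    fun s' hk ⟨h1, h2, ⟨τ', h3⟩, h4⟩ => ?_).mono ?_ fun s' _ hs => ⟨hs.1, fun i => hs.2.2.2 i i.2⟩
  · simp only [Test.Holds, NExp.eval, h2, h3.mem.num]; omega
  · refine ((window_spec hS h3 (e := nv aTime) (i := ⟨q, hq⟩) h2).seq fun s₂ hk₂ ⟨i₂, t₂, m₂⟩ =>
      (setN_spec aTime _ s₂).mono le_rfl (Q' := fun s' => S.Improves s s' ∧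
      s'.nat aTime 0 = q + 1 ∧ (∃ τ, S.SearchInMem κ g G τ s') ∧ ∀ i : Fin n, (i : ℕ) < q + 1 →
        S.WindowTried (min ε 1) (S.t i) s') fun s₃ hk₃ hs₃ => ?_).mono
      (by simp only [NExp.cost]; omega) fun _ _ h => h
    have i₃ : S.Improves s₂ s₃ := .of_keeps S hk₃ rfl rfl
    refine ⟨(h1.trans i₂).trans i₃, ?_, ⟨_, m₂.keeps hk₃ rfl rfl rfl rfl rfl⟩, fun i hi => ?_⟩
    · rw [hs₃]; simp [NExp.eval, hk₂.nat aTime rfl, h2]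
    · rcases Nat.lt_or_ge i q with hlt | hle
      · exact (h4 i hlt).mono (i₂.trans i₃)
      · obtain rfl : i = ⟨q, hq⟩ := Fin.ext (by dsimp only; omega)
        exact t₂.mono i₃
  · simp only [Test.Holds, NExp.eval, h2, h3.mem.num]; omega
  · simp only [NExp.cost, Test.cost]
    nlinarith

/-- A nonempty box with an arbitrary time window equals one whose window begins at the timestamp
of a point. -/
theorem Data.exists_box_eq (D : Data n) (t : Fin n → ℝ) {τ x₁ x₂ y₁ y₂ : ℝ}
    (h : (D.box t τ x₁ x₂ y₁ y₂).Nonempty) :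
    ∃ i, D.box t τ x₁ x₂ y₁ y₂ = D.box t (t i) x₁ x₂ y₁ y₂ := by
  obtain ⟨i, hi, hmin⟩ := Finset.exists_min_image _ t h
  refine ⟨i, ?_⟩
  ext j
  constructor
  · intro hj
    have := hmin j hj
    rw [Data.mem_box] at hj ⊢
    tauto
  · intro hj
    rw [Data.mem_box] at hi hj ⊢
    have : τ ≤ t j := hi.2.2.2.2.trans hj.2.2.2.2
    tauto

end

/-- If some region has enough support, then the output is a region whose discrepancy is within
`ε` of the maximum. -/
theorem Setting.Fits.approxMaxProspective {S : Setting n} {lo hi ε : ℝ} {κ : ℕ}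
    (hS : S.Fits lo hi (min ε 1) κ) {s : State} (hs : S.Sound s)
    (ht : ∀ i, S.WindowTried (min ε 1) (S.t i) s) :
    ApproxMaxProspective S.D S.t ε S.C S.c s := by
  have key : ∀ (R' : Rect) (τ' : ℝ), S.D.Supported S.C (S.D.insideSince S.t R' τ') →
      Beats s (S.D.disc S.c (S.D.insideSince S.t R' τ') - min ε 1) := by
    intro R' τ' hR
    rw [Data.insideSince_eq_box] at hR ⊢
    obtain ⟨i, hi⟩ := S.D.exists_box_eq S.t
      (hS.within.nonempty_of_supported hS.npos hS.C_pos hR)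
    rw [hi] at hR ⊢
    exact ht i _ _ _ _ hR
  rintro ⟨R₀, τ₀, h₀⟩
  obtain ⟨R, h1, h2, h3⟩ := hs (key R₀ τ₀ h₀).1
  refine ⟨R, h1, h2, h3, fun R' τ' h' => ?_⟩
  have h4 : _ ≤ outputValue s := (key R' τ' h').2
  have := min_le_left ε 1
  linarith

theorem Data.insideSince_zero (D : Data n) (R : Rect) {τ : ℝ} (hτ : τ ≤ 0) :
    D.insideSince 0 R τ = D.inside R := by
  ext i
  simp [Data.insideSince, Data.inside, hτ]

theorem Setting.Fits.approxMaxRect {S : Setting n} {lo hi ε : ℝ} {κ : ℕ}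
    (hS : S.Fits lo hi (min ε 1) κ) (h0 : S.t = 0) {s : State} (hs : S.Sound s)
    (ht : ∀ i, S.WindowTried (min ε 1) (S.t i) s) : ApproxMaxRect S.D ε S.C S.c s := by
  have key := hS.approxMaxProspective hs ht
  rw [h0] at key
  rintro ⟨R₀, h₀⟩
  obtain ⟨R, h1, h2, h3, h4⟩ := key ⟨R₀, 0, by rwa [S.D.insideSince_zero R₀ le_rfl]⟩
  have hτ : outputTime s ≤ 0 := by
    obtain ⟨i, hi⟩ := hS.within.nonempty_of_supported hS.npos hS.C_pos h2
    rw [Data.insideSince_eq_box, Data.mem_box] at hi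
    exact hi.2.2.2.2
  rw [S.D.insideSince_zero R hτ] at h2 h3
  refine ⟨R, h1, h2, h3, fun R' h' => ?_⟩
  rw [← S.D.insideSince_zero R' le_rfl] at h' ⊢
  exact h4 R' 0 h'

/-- The setting and the memory after the preparation. -/
theorem exists_prepared {D : Data n} {t : Fin n → ℝ} {ε C c c₁ c₂ : ℝ} (hn : 0 < n)
    (hD : D.Bounded c₁ c₂) (hc₁ : 0 < c₁) (hC : 0 < C) (hc : 0 < c) (hε : 0 < ε) :
    ∃ (S : Setting n) (lo hi : ℝ) (κ g st : ℕ) (G : ℕ → ℝ) (π : Equiv.Perm (Fin n)),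
      (S.D = D ∧ S.t = t ∧ S.C = C ∧ S.c = c) ∧ S.Prepared ε c₁ c₂ lo hi κ g st G π ∧
      Runs setupProg (input D t ε C c) (setupCost n κ S.lev S.F₀) fun s' =>
        S.SearchInMem κ g G (s'.real rTau 0) s' ∧ S.Sound s' := by
  obtain ⟨S, lo, hi, κ, g, st, G, π, hS, hP, hr⟩ :=
    setup_spec (inputInMem_input D t ε C c) hn hD hc₁ hC hc hε
  refine ⟨S, lo, hi, κ, g, st, G, π, hS, hP, hr.mono le_rfl fun s' hk h => ⟨h, fun hf => ?_⟩⟩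
  rw [hk.nat aFound rfl] at hf
  simp [input] at hf

theorem rect_spec {D : Data n} {ε C c c₁ c₂ : ℝ} (hn : 0 < n)
    (hD : D.Bounded c₁ c₂) (hc₁ : 0 < c₁) (hC : 0 < C) (hc : 0 < c) (hε : 0 < ε) :
    ∃ (S : Setting n) (lo hi : ℝ) (κ g st : ℕ) (G : ℕ → ℝ) (π : Equiv.Perm (Fin n)),
      (S.C = C ∧ S.c = c) ∧ S.Prepared ε c₁ c₂ lo hi κ g st G π ∧
      Runs rectProg (input D 0 ε C c) (setupCost n κ S.lev S.F₀ + (S.searchCost κ g + 20))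
        (ApproxMaxRect D ε C c) := by
  obtain ⟨S, lo, hi, κ, g, st, G, π, ⟨rfl, h0, rfl, rfl⟩, hP, hr⟩ :=
    exists_prepared (t := 0) hn hD hc₁ hC hc hε
  refine ⟨S, lo, hi, κ, g, st, G, π, ⟨rfl, rfl⟩, hP, hr.seq fun s₁ hk₁ ⟨m₁, hs₁⟩ =>
    (window_spec hP m₁ (e := .lit 0) (i := ⟨0, hn⟩) rfl).mono ?_ fun s' _ ⟨himp, ht, _⟩ =>
    hP.fits.approxMaxRect h0 (himp.sound hs₁) fun i => ?_⟩
  · simp only [NExp.cost]; omega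
  · rw [h0] at ht ⊢
    exact ht

theorem prospective_spec {D : Data n} {t : Fin n → ℝ} {ε C c c₁ c₂ : ℝ} (hn : 0 < n)
    (hD : D.Bounded c₁ c₂) (hc₁ : 0 < c₁) (hC : 0 < C) (hc : 0 < c) (hε : 0 < ε) :
    ∃ (S : Setting n) (lo hi : ℝ) (κ g st : ℕ) (G : ℕ → ℝ) (π : Equiv.Perm (Fin n)),
      (S.C = C ∧ S.c = c) ∧ S.Prepared ε c₁ c₂ lo hi κ g st G π ∧
      Runs prospectiveProg (input D t ε C c)
        (setupCost n κ S.lev S.F₀ + (n + 1) * (S.searchCost κ g + 50))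
        (ApproxMaxProspective D t ε C c) := by
  obtain ⟨S, lo, hi, κ, g, st, G, π, ⟨rfl, rfl, rfl, rfl⟩, hP, hr⟩ :=
    exists_prepared (t := t) hn hD hc₁ hC hc hε
  exact ⟨S, lo, hi, κ, g, st, G, π, ⟨rfl, rfl⟩, hP, hr.seq fun s₁ hk₁ ⟨m₁, hs₁⟩ =>
    (windows_spec hP m₁).mono le_rfl fun s' _ ⟨himp, ht⟩ =>
    hP.fits.approxMaxProspective (himp.sound hs₁) ht⟩

end Scan

/-! ### The running time -/

namespace Scan

open RealRAM

variable {n : ℕ}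

theorem half_le_log {n : ℕ} (hn : 2 ≤ n) : 1 / 2 ≤ Real.log n := by
  have h2 : Real.log 2 ≤ Real.log n := Real.log_le_log two_pos (by exact_mod_cast hn)
  have := Real.log_two_gt_d9
  linarith

theorem natLog_le {n : ℕ} (hn : 2 ≤ n) : (Nat.log 2 n : ℝ) ≤ 2 * Real.log n := by
  have h1 : ((2 ^ Nat.log 2 n : ℕ) : ℝ) ≤ n := by
    exact_mod_cast Nat.pow_log_le_self 2 (by omega)
  have h2 := Real.log_le_log (by positivity) h1
  push_cast at h2
  rw [Real.log_pow] at h2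
  have h3 := Real.log_two_gt_d9
  have h4 : (0 : ℝ) ≤ Nat.log 2 n := by positivity
  nlinarith

/-- Bounds for the results of the preparation, in terms of `ℓ = log n` and `m = max 1 (1 / ε)`,
with a factor `K` that depends on the constants only. -/
structure Setting.Moderate (S : Setting n) (κ g : ℕ) (K ℓ m : ℝ) : Prop where
  kappa : (κ : ℝ) ≤ K
  lev : (S.lev + 1 : ℝ) ≤ 6 * ℓ
  dirs : (S.F₀ : ℝ) ≤ K * ℓ * m / n + 1
  size : (S.size + 1 : ℝ) ≤ 3 * n + 2 * K * ℓ * m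
  grid : (g + 1 : ℝ) ≤ K * m
  grid' : (g + 1 : ℝ) ≤ K * n

/-- The factor of `Setting.Moderate`. -/
noncomputable def moderateFactor (c₁ c₂ C c : ℝ) : ℝ :=
  32 * c * ((c₂ / c₁) ^ 2) ^ 3 + 4 +
    2 * (C * (c₂ / c₁) + 1) * (5 + 24 * c * ((c₂ / c₁) ^ 2) ^ 3)

theorem max_one_inv {ε : ℝ} (hε : 0 < ε) : max 1 (1 / ε) = 1 / min ε 1 := by
  rcases le_total ε 1 with h | h
  · rw [min_eq_left h, max_eq_right]
    rwa [le_div_iff₀ hε, one_mul]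
  · rw [min_eq_right h, max_eq_left] <;> norm_num
    exact inv_le_one_of_one_le₀ h

theorem Setting.Prepared.moderate {S : Setting n} {ε c₁ c₂ lo hi : ℝ} {κ g st : ℕ} {G : ℕ → ℝ}
    {π : Equiv.Perm (Fin n)} (h : S.Prepared ε c₁ c₂ lo hi κ g st G π) (hn : 2 ≤ n)
    (hc₁ : 0 < c₁) (hε : 0 < ε) :
    S.Moderate κ g (moderateFactor c₁ c₂ S.C S.c) (Real.log n) (max 1 (1 / ε)) := by
  have hm1 : 1 ≤ max 1 (1 / ε) := le_max_left _ _
  have hme : max 1 (1 / ε) * min ε 1 = 1 := by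
    rw [max_one_inv hε]
    exact one_div_mul_cancel (lt_min hε one_pos).ne'
  have he : 0 < min ε 1 := lt_min hε one_pos
  have hℓ := half_le_log hn
  have hlog := natLog_le hn
  have hdirs := h.dirs_le
  have hstep := h.step_ge
  generalize max 1 (1 / ε) = m at *
  generalize min ε 1 = e at *
  generalize Real.log n = ℓ at *
  have hn2 : (2 : ℝ) ≤ n := by exact_mod_cast hn
  have hlo := h.fits.within.pos
  have hC := h.fits.C_pos
  have hc := h.fits.c_nonneg
  have hρ : hi / lo ≤ c₂ / c₁ := by
    have := h.fits.within.one_le_ratio h.fits.npos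
    rw [one_le_div hlo] at this
    exact div_le_div₀ (by linarith [h.hi_le]) h.hi_le hc₁ h.lo_ge
  have hρ1 : 1 ≤ hi / lo := h.fits.within.one_le_ratio h.fits.npos
  have hW : ((hi / lo) ^ 2) ^ 3 ≤ ((c₂ / c₁) ^ 2) ^ 3 := by gcongr
  have hW1 : 1 ≤ ((hi / lo) ^ 2) ^ 3 := one_le_pow₀ (one_le_pow₀ hρ1)
  have hκ : (κ : ℝ) ≤ S.C * (c₂ / c₁) + 1 := by
    have h1 := h.kappa_le
    have h2 : S.C * (hi / lo) ≤ S.C * (c₂ / c₁) := by gcongr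
    rw [mul_div_assoc] at h1
    linarith
  have hκ1 : (1 : ℝ) ≤ κ := by exact_mod_cast h.fits.kappa_pos
  have hlev : (S.lev : ℝ) = Nat.log 2 n + 1 := by rw [h.lev_eq]; push_cast; rfl
  unfold moderateFactor
  generalize ((c₂ / c₁) ^ 2) ^ 3 = W at *
  generalize ((hi / lo) ^ 2) ^ 3 = V at *
  set k := S.C * (c₂ / c₁) + 1 with hk
  have hcV : S.c * V ≤ S.c * W := by gcongr
  have hcV0 : 0 ≤ S.c * V := by positivity
  set K := 32 * S.c * W + 4 + 2 * k * (5 + 24 * S.c * W) with hK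
  have hk1 : 1 ≤ k := hκ1.trans hκ
  have hcW0 : 0 ≤ S.c * W := hcV0.trans hcV
  have hkW : 0 ≤ k * (S.c * W) := mul_nonneg (by linarith) hcW0
  have hF : (S.F₀ : ℝ) ≤ K * ℓ * m / n + 1 := by
    refine hdirs.trans (add_le_add ?_ le_rfl)
    rw [div_le_div_iff₀ (by positivity) (by positivity)]
    have h1 : (S.lev : ℝ) + 2 ≤ 8 * ℓ := by linarith
    have h2 : 4 * S.c * V * (S.lev + 2) ≤ 4 * S.c * W * (8 * ℓ) := by
      have := mul_le_mul hcV h1 (by positivity) hcW0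
      linarith
    calc 4 * S.c * V * (S.lev + 2) * n ≤ 4 * S.c * W * (8 * ℓ) * n := by gcongr
      _ = 32 * S.c * W * ℓ * n * (m * e) := by rw [hme]; ring
      _ ≤ K * ℓ * n * (m * e) := by
        rw [hme]
        gcongr
        linarith
      _ = K * ℓ * m * (n * e) := by ring
  have hK0 : 0 ≤ K := by linarith
  have hm0 : 0 < m := by linarith
  have hmn : e * n ≤ 2 * κ * (4 + 24 * S.c * V) * st := hstep
  have hst : (0 : ℝ) < st := by exact_mod_cast h.step_pos
  -- the number of multiples of the spacing below `n`
  have hq : (((n + st - 1) / st : ℕ) : ℝ) ≤ n / st + 1 := by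
    refine Nat.cast_div_le.trans ?_
    rw [div_add_one hst.ne']
    gcongr
    have : n + st - 1 ≤ n + st := Nat.sub_le _ _
    exact_mod_cast this
  have hg : (g + 1 : ℝ) ≤ 2 * k + 2 + n / st := by
    rw [h.grid_eq]
    push_cast at hq ⊢
    linarith
  refine ⟨by linarith, by linarith, hF, ?_, ?_, ?_⟩
  · have h2 : ((2 ^ S.lev : ℕ) : ℝ) ≤ 2 * n := by
      rw [h.lev_eq, pow_succ, mul_comm]
      have := Nat.pow_log_le_self 2 (show n ≠ 0 by omega)
      exact_mod_cast Nat.mul_le_mul_left 2 this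
    unfold Setting.size
    push_cast at h2 ⊢
    calc (S.F₀ : ℝ) * 2 ^ S.lev + 1 ≤ (K * ℓ * m / n + 1) * (2 * n) + 1 := by gcongr
      _ = 2 * K * ℓ * m + 2 * n + 1 := by field_simp
      _ ≤ _ := by linarith
  · have h1 : (n : ℝ) / st ≤ 2 * k * (4 + 24 * S.c * W) * m := by
      rw [div_le_iff₀ hst]
      calc (n : ℝ) = m * (e * n) := by rw [← mul_assoc, hme, one_mul]
        _ ≤ m * (2 * κ * (4 + 24 * S.c * V) * st) := by gcongr
        _ ≤ m * (2 * k * (4 + 24 * S.c * W) * st) := by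
          gcongr ?_ * ?_
          gcongr ?_ * ?_
          exact mul_le_mul (by linarith) (by linarith) (by linarith) (by linarith)
        _ = _ := by ring
    have h2 : 2 * k + 2 ≤ (2 * k + 2) * m := le_mul_of_one_le_right (by linarith) hm1
    have h3 : (2 * k + 2 + 2 * k * (4 + 24 * S.c * W)) * m ≤ K * m := by
      gcongr
      linarith
    linarith
  · have h1 : (n : ℝ) / st ≤ n := div_le_self (by linarith) (by exact_mod_cast h.step_pos)
    have h2 : 2 * k + 2 ≤ (2 * k + 2) * n := le_mul_of_one_le_right (by linarith) (by linarith)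
    have h3 : (2 * k + 3) * n ≤ K * n := by
      gcongr
      linarith
    linarith

/-- The factor by which `Setting.stripCost` exceeds the number of elementary steps. -/
def unitCost : ℕ := buildBody.time + tryProg.time + levelCost + initTabBody.time + 500

/-- A factor for the bound of `Setting.searchCost`. -/
noncomputable def searchFactor (K : ℝ) : ℝ :=
  (K + 1) ^ 2 * ((34 + 12 * K) * unitCost + 150) +
    K ^ 2 * (2 * ((22 + 16 * K) * unitCost + 150) + 12 * K * unitCost)

/-- A factor for the bound of `setupCost`. -/
noncomputable def setupFactor (K : ℝ) : ℝ :=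
  8 * (620 + totalsBody.time) + 90 * K + 360 + 50 * (2 * K + 1) + 500

section

variable {S : Setting n} {κ g : ℕ} {K ℓ m : ℝ}

theorem Setting.Moderate.K_pos (h : S.Moderate κ g K ℓ m) (hm : 1 ≤ m) : 0 < K := by
  have h1 := h.grid
  by_contra hK
  have h2 : (0 : ℝ) ≤ g := by positivity
  nlinarith

theorem Setting.Moderate.stripCost_le (h : S.Moderate κ g K ℓ m) (hn : 2 ≤ n) {w : ℕ} {W : ℝ}
    (hw : (w + 1 : ℝ) ≤ W) :
    (S.stripCost w : ℝ) ≤ (2 * n * W + 18 * n * ℓ + 12 * K * (ℓ ^ 2 * m)) * unitCost := by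
  have hn2 : (2 : ℝ) ≤ n := by exact_mod_cast hn
  have h1 : ((n : ℝ) + 2) * (w + 1) ≤ 2 * n * W := by
    have : (0 : ℝ) ≤ w + 1 := by positivity
    exact mul_le_mul (by linarith) hw this (by linarith)
  have h2 : (S.size + 1 : ℝ) * (S.lev + 1) ≤ (3 * n + 2 * K * ℓ * m) * (6 * ℓ) :=
    mul_le_mul h.size h.lev (by positivity) (le_trans (by positivity) h.size)
  have : (S.stripCost w : ℝ) = ((n + 2) * (w + 1) + (S.size + 1) * (S.lev + 1)) * unitCost := by
    unfold Setting.stripCost unitCost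
    push_cast
    rfl
  rw [this]
  exact mul_le_mul_of_nonneg_right (by linarith) (by positivity)

/-- The functions of `N` that occur in the running time are at most proportional to
`m * N ^ 2 * ℓ ^ 2`. -/
theorem growth_le {N : ℝ} (hN : 2 ≤ N) (hℓ : 1 / 2 ≤ ℓ) (hm : 1 ≤ m) :
    1 ≤ m * N ^ 2 * ℓ ^ 2 ∧ N * ℓ ≤ m * N ^ 2 * ℓ ^ 2 ∧ N ^ 2 ≤ 4 * (m * N ^ 2 * ℓ ^ 2) ∧
      ℓ ^ 2 * m ≤ m * N ^ 2 * ℓ ^ 2 ∧ m * N ^ 2 * ℓ ≤ 2 * (m * N ^ 2 * ℓ ^ 2) ∧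
      ℓ ≤ 2 * ℓ ^ 2 := by
  have hℓ2 : ℓ ≤ 2 * ℓ ^ 2 := by nlinarith
  have hNℓ : 1 ≤ N * ℓ := by nlinarith
  have u0 : (N * ℓ) ^ 2 ≤ m * N ^ 2 * ℓ ^ 2 := by
    rw [mul_assoc, ← mul_pow]
    exact le_mul_of_one_le_left (by positivity) hm
  refine ⟨(one_le_pow₀ hNℓ).trans u0, (le_self_pow₀ hNℓ two_ne_zero).trans u0, ?_, ?_, ?_, hℓ2⟩
  · have : N ^ 2 * 1 ≤ N ^ 2 * (4 * ℓ ^ 2) := by gcongr; linarith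
    rw [mul_pow] at u0
    linarith
  · have hN1 : 1 ≤ N ^ 2 := one_le_pow₀ (by linarith)
    have : ℓ ^ 2 * m * 1 ≤ ℓ ^ 2 * m * N ^ 2 := by gcongr
    linarith
  · have : m * N ^ 2 * ℓ ≤ m * N ^ 2 * (2 * ℓ ^ 2) := by gcongr
    linarith

/-- In the second part of the search, the time for a strip consists of a part proportional to
`n * ℓ` and of a part proportional to `ℓ ^ 2 * m`. The number of strips is estimated by
`(K * m) * (K * n)` for the former, and by `(K * n) ^ 2` for the latter. -/
theorem Setting.Moderate.searchCost_le (h : S.Moderate κ g K ℓ m) (hn : 2 ≤ n) (hℓ : 1 / 2 ≤ ℓ)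
    (hm : 1 ≤ m) : (S.searchCost κ g : ℝ) ≤ searchFactor K * (m * n ^ 2 * ℓ ^ 2) := by
  have hK := h.K_pos hm
  have hn2 : (2 : ℝ) ≤ n := by exact_mod_cast hn
  have hB : (0 : ℝ) ≤ unitCost := by positivity
  have s1 := h.stripCost_le hn (w := n) (W := 2 * n) (by linarith)
  have s2 := h.stripCost_le hn (w := 4 * κ) (W := 4 * K + 1)
    (by push_cast; linarith [h.kappa])
  have hg := h.grid
  have hg' := h.grid'
  have hκ := h.kappa
  obtain ⟨u1, u2, u3, u4, u5, hℓ2⟩ := growth_le hn2 hℓ hm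
  have hNℓ : 1 ≤ (n : ℝ) * ℓ := by nlinarith
  generalize hN : (n : ℝ) = N at *
  set U := m * N ^ 2 * ℓ ^ 2 with hU
  have hU0 : 0 ≤ U := by linarith
  have p1 : (S.stripCost n : ℝ) + 150 ≤ ((34 + 12 * K) * unitCost + 150) * U := by
    have : (2 * N * (2 * N) + 18 * N * ℓ + 12 * K * (ℓ ^ 2 * m)) * unitCost ≤
        ((34 + 12 * K) * U) * unitCost := by
      gcongr
      have := mul_le_mul_of_nonneg_left u4 hK.le
      linarith
    linarith
  have p2 : (S.stripCost (4 * κ) : ℝ) + 150 ≤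
      ((22 + 16 * K) * unitCost + 150) * (N * ℓ) + 12 * K * unitCost * (ℓ ^ 2 * m) := by
    have : N * (4 * K + 1) ≤ 2 * (N * ℓ) * (4 * K + 1) := by
      gcongr
      nlinarith
    have : (2 * N * (4 * K + 1) + 18 * N * ℓ + 12 * K * (ℓ ^ 2 * m)) * unitCost ≤
        ((22 + 16 * K) * (N * ℓ) + 12 * K * (ℓ ^ 2 * m)) * unitCost := by
      gcongr
      linarith
    linarith
  have p3 : ((g : ℝ) + 1) ^ 2 * (N * ℓ) ≤ K ^ 2 * (2 * U) := by
    calc ((g : ℝ) + 1) ^ 2 * (N * ℓ) ≤ (K * m) * (K * N) * (N * ℓ) := by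
          rw [pow_two]
          have : (0 : ℝ) ≤ g + 1 := by positivity
          gcongr
      _ = K ^ 2 * (m * N ^ 2 * ℓ) := by ring
      _ ≤ _ := by gcongr
  have p4 : ((g : ℝ) + 1) ^ 2 * (ℓ ^ 2 * m) ≤ K ^ 2 * U := by
    calc ((g : ℝ) + 1) ^ 2 * (ℓ ^ 2 * m) ≤ (K * N) ^ 2 * (ℓ ^ 2 * m) := by gcongr
      _ = _ := by rw [hU]; ring
  have e : (S.searchCost κ g : ℝ) = (κ + 1) ^ 2 * (S.stripCost n + 150) +
      (g + 1) ^ 2 * (S.stripCost (4 * κ) + 150) := by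
    unfold Setting.searchCost
    push_cast
    ring
  have q1 : ((κ : ℝ) + 1) ^ 2 * (S.stripCost n + 150) ≤
      (K + 1) ^ 2 * (((34 + 12 * K) * unitCost + 150) * U) := by gcongr
  have q2 : ((g : ℝ) + 1) ^ 2 * (S.stripCost (4 * κ) + 150) ≤
      ((22 + 16 * K) * unitCost + 150) * (K ^ 2 * (2 * U)) +
        12 * K * unitCost * (K ^ 2 * U) := by
    calc ((g : ℝ) + 1) ^ 2 * (S.stripCost (4 * κ) + 150) ≤ ((g : ℝ) + 1) ^ 2 *
          (((22 + 16 * K) * unitCost + 150) * (N * ℓ) + 12 * K * unitCost * (ℓ ^ 2 * m)) := by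
          gcongr
      _ = ((22 + 16 * K) * unitCost + 150) * (((g : ℝ) + 1) ^ 2 * (N * ℓ)) +
          12 * K * unitCost * (((g : ℝ) + 1) ^ 2 * (ℓ ^ 2 * m)) := by ring
      _ ≤ _ := by gcongr
  rw [e]
  unfold searchFactor
  linarith

theorem Setting.Moderate.setupCost_le (h : S.Moderate κ g K ℓ m) (hn : 2 ≤ n) (hℓ : 1 / 2 ≤ ℓ)
    (hm : 1 ≤ m) :
    (setupCost n κ S.lev S.F₀ : ℝ) ≤ setupFactor K * (m * n ^ 2 * ℓ ^ 2) := by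
  have hK := h.K_pos hm
  have hn2 : (2 : ℝ) ≤ n := by exact_mod_cast hn
  have hκ := h.kappa
  have hlev := h.lev
  have hF := h.dirs
  obtain ⟨u1, u2, u3, u4, -, hℓ2⟩ := growth_le hn2 hℓ hm
  set N : ℝ := (n : ℝ) with hN
  set U := m * N ^ 2 * ℓ ^ 2 with hU
  have hU0 : 0 ≤ U := by linarith
  have hb : (0 : ℝ) ≤ totalsBody.time := by positivity
  have p1 : (N + 1) * (N * 120 + totalsBody.time + 500) ≤
      8 * (620 + totalsBody.time) * U := by
    calc (N + 1) * (N * 120 + totalsBody.time + 500) ≤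
          (2 * N) * ((620 + totalsBody.time) * N) := by
          gcongr
          · linarith
          · nlinarith
      _ = 2 * (620 + totalsBody.time) * N ^ 2 := by ring
      _ ≤ 2 * (620 + totalsBody.time) * (4 * U) := by gcongr
      _ = _ := by ring
  have p2 : (S.F₀ : ℝ) ≤ (2 * K + 1) * U := by
    have h1 : K * ℓ * m / N ≤ K * ℓ * m := div_le_self (by positivity) (by linarith)
    have h2 : ℓ * m ≤ 2 * (ℓ ^ 2 * m) := by
      have : ℓ * m ≤ 2 * ℓ ^ 2 * m := by gcongr
      linarith
    have h3 := mul_le_mul_of_nonneg_left (h2.trans (mul_le_mul_of_nonneg_left u4 zero_le_two))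
      hK.le
    linarith
  have p3 : ℓ ≤ U := (le_mul_of_one_le_left (by linarith) (by linarith)).trans u2
  have p4 : K ≤ K * U := le_mul_of_one_le_right hK.le u1
  have e : (setupCost n κ S.lev S.F₀ : ℝ) = (N + 1) * (N * 120 + totalsBody.time + 500) +
      90 * κ + 60 * S.lev + 50 * S.F₀ + 500 := by
    unfold setupCost
    push_cast
    ring
  rw [e]
  unfold setupFactor
  linarith

end

end Scan

theorem mainTheorem3 :
    (∃ p : RealRAM.Prog, ∀ c₁ c₂ C c : ℝ, 0 < c₁ → 0 < c₂ → 0 < C → 0 < c →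
      ∃ K : ℝ, ∀ n : ℕ, 2 ≤ n → ∀ D : Scan.Data n, D.Bounded c₁ c₂ → ∀ ε : ℝ, 0 < ε →
        ∃ (s : RealRAM.State) (T : ℕ),
          RealRAM.Exec p (Scan.input D 0 ε C c) s T ∧
          (T : ℝ) ≤ K * (max 1 (1 / ε) * (n : ℝ) ^ 2 * Real.log n ^ 2) ∧
          Scan.ApproxMaxRect D ε C c s) ∧
    (∃ p : RealRAM.Prog, ∀ c₁ c₂ C c : ℝ, 0 < c₁ → 0 < c₂ → 0 < C → 0 < c →
      ∃ K : ℝ, ∀ n : ℕ, 2 ≤ n → ∀ (D : Scan.Data n) (t : Fin n → ℝ), D.Bounded c₁ c₂ →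
        ∀ ε : ℝ, 0 < ε →
        ∃ (s : RealRAM.State) (T : ℕ),
          RealRAM.Exec p (Scan.input D t ε C c) s T ∧
          (T : ℝ) ≤ K * (max 1 (1 / ε) * (n : ℝ) ^ 3 * Real.log n ^ 2) ∧
          Scan.ApproxMaxProspective D t ε C c s) := by
  refine ⟨⟨Scan.rectProg, fun c₁ c₂ C c hc₁ _ hC hc => ⟨Scan.setupFactor
    (Scan.moderateFactor c₁ c₂ C c) + Scan.searchFactor (Scan.moderateFactor c₁ c₂ C c) + 20,
    fun n hn D hD ε hε => ?_⟩⟩, ⟨Scan.prospectiveProg, fun c₁ c₂ C c hc₁ _ hC hc =>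
    ⟨Scan.setupFactor (Scan.moderateFactor c₁ c₂ C c) +
      2 * (Scan.searchFactor (Scan.moderateFactor c₁ c₂ C c) + 50),
    fun n hn D t hD ε hε => ?_⟩⟩⟩
  · obtain ⟨S, lo, hi, κ, g, st, G, π, ⟨rfl, rfl⟩, hP, s, T, hE, hT, hs⟩ :=
      Scan.rect_spec (by omega) hD hc₁ hC hc hε
    have hM := hP.moderate hn hc₁ hε
    have hℓ := Scan.half_le_log hn
    have hn2 : (2 : ℝ) ≤ n := by exact_mod_cast hn
    have hm : 1 ≤ max 1 (1 / ε) := le_max_left _ _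
    have b1 := hM.searchCost_le hn hℓ hm
    have b2 := hM.setupCost_le hn hℓ hm
    have b3 := (Scan.growth_le hn2 hℓ hm).1
    refine ⟨s, T, hE, ?_, hs⟩
    have hT' : (T : ℝ) ≤ _ := Nat.cast_le.2 hT
    push_cast at hT'
    linarith
  · obtain ⟨S, lo, hi, κ, g, st, G, π, ⟨rfl, rfl⟩, hP, s, T, hE, hT, hs⟩ :=
      Scan.prospective_spec (by omega) hD hc₁ hC hc hε
    have hM := hP.moderate hn hc₁ hε
    have hℓ := Scan.half_le_log hn
    have hn2 : (2 : ℝ) ≤ n := by exact_mod_cast hn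
    have hm : 1 ≤ max 1 (1 / ε) := le_max_left _ _
    have b1 := hM.searchCost_le hn hℓ hm
    have b2 := hM.setupCost_le hn hℓ hm
    have b3 := (Scan.growth_le hn2 hℓ hm).1
    refine ⟨s, T, hE, ?_, hs⟩
    have hT' : (T : ℝ) ≤ _ := Nat.cast_le.2 hT
    push_cast at hT'
    rw [show max 1 (1 / ε) * (n : ℝ) ^ 3 * Real.log n ^ 2 =
      n * (max 1 (1 / ε) * (n : ℝ) ^ 2 * Real.log n ^ 2) by ring]
    generalize max 1 (1 / ε) * (n : ℝ) ^ 2 * Real.log n ^ 2 = U at *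
    have h1 : ((n : ℝ) + 1) * (S.searchCost κ g + 50) ≤ (2 * n) *
        ((Scan.searchFactor (Scan.moderateFactor c₁ c₂ S.C S.c) + 50) * U) :=
      mul_le_mul (by linarith) (by linarith) (by positivity) (by linarith)
    have h0 : 0 ≤ Scan.setupFactor (Scan.moderateFactor c₁ c₂ S.C S.c) * U :=
      (Nat.cast_nonneg _).trans b2
    have h2 := le_mul_of_one_le_left h0 (by linarith : (1 : ℝ) ≤ n)
    linarith
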